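/- **Setting.** A chip is the rectangle $[0,W]\times[0,H]$. On it, $n$ axis-parallel rectangular modules $m_i=[x_i,x_i+w_i]\times[y_i,y_i+h_i]$ with $w_i,h_i>0$ have been placed, with pairwise disjoint interiors. A new module of width $w_m>0$ and height $h_m>0$ is given. The *free space* $S\subseteq\mathbb R^2$ is the set of all feasible positions of the center of the new module, i.e. of all points $c$ such that the $w_m\times h_m$ rectangle centered at $c$ lies on the chip and its interior is disjoint from the interior of every $m_i$ (touching is allowed, so $S$ is closed and may have parts of width or height $0$, which belong to the contour). The *contour* of the free space is its topological boundary $\partial S$; it consists of horizontal and vertical segments, possibly single points. **Algorithm FindContourSegments.** Every module is expanded by $w_m/2$ to the left and right and by $h_m/2$ to the top and bottom, and the chip is shrunk to $F'=[\frac{w_m}2,W-\frac{w_m}2]\times[\frac{h_m}2,H-\frac{h_m}2]$. A horizontal sweep finds the vertical contour segments. It processes, in lexicographic order with $\mathit{Close}<\mathit{Open}$, the events $(p,t,b,e)$: an $\mathit{Open}$ event for the left side and a $\mathit{Close}$ event for the right side of each expanded module, where $p$ is the $x$-coordinate of the side and $[b,e]$ its $y$-range; in addition the outside of the chip to its left is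 open at the start and closes at $p=\frac{w_m}2$, and the outside to its right opens at $p=W-\frac{w_m}2$. The currently open intervals are kept in a segment tree over the range $[\frac{h_m}2,H-\frac{h_m}2]$, in which every end coordinate is represented by an elementary interval of its own (infinitesimal perturbation), so that uncovered gaps of length $0$ between abutting intervals are found. At an $\mathit{Open}$ event the maximal uncovered pieces of $[b,e]$ are retrieved and reported as segments at position $p$, and then the interval is inserted; at a $\mathit{Close}$ event the interval is deleted and then the uncovered pieces of $[b,e]$ are retrieved and reported. A second sweep, with the roles of the coordinates exchanged, finds the horizontal contour segments. **Theorem.** FindContourSegments computes the contour of the free space in $O(n\log n)$ time. That is: 1. For every such input, the union of all segments reported by the two sweeps is $\partial S$; moreover every vertical segment of positive length contained in $\partial S$ is covered by the segments reported by the horizontal sweep, and every horizontal segment of positive length contained in $\partial S$ is covered by the segments reported by the vertical sweep. 2. There is an absolute constant $C$ such that for every such input with $n\ge 2$ modules the algorithm executes at most $C\,n\log n$ elementary steps, in the unit-cost model in which every comparison or arithmetic operation on real numbers and every procedure call (with a bounded number of pointer operations) costs one step. -/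

import Mathlib

/-! ### Cost model

Unit-cost model of a real RAM.  A computation returns a value together with the number of steps
that were executed.  Comparing two numbers, or adding, subtracting or halving numbers, costs one
step each.  Every call of a procedure (hence every pass through a loop, loops being recursive
procedures) costs one further step, which pays for the bounded number of pointer operations
(inspecting and allocating list cells, tree nodes and records, updating a counter or a flag) that
the body performs itself. -/

/-- A value together with the number of steps used for computing it. -/
structure Timed (α : Type) where
  val : α
  cost : ℕ

namespace Timed

instance : Monad Timed where
  pure a := ⟨a, 0⟩
  bind x f := ⟨(f x.val).val, x.cost + (f x.val).cost⟩

/-- One elementary step. -/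
def tick : Timed Unit := ⟨(), 1⟩

/-- The comparison `x < y` of two numbers. -/
def lt {K : Type} [LinearOrder K] (x y : K) : Timed Bool := ⟨decide (x < y), 1⟩

/-- The comparison `x ≤ y` of two numbers. -/
def le {K : Type} [LinearOrder K] (x y : K) : Timed Bool := ⟨decide (x ≤ y), 1⟩

/-- Addition of two numbers. -/
def add {K : Type} [Field K] (x y : K) : Timed K := ⟨x + y, 1⟩

/-- Subtraction of two numbers. -/
def sub {K : Type} [Field K] (x y : K) : Timed K := ⟨x - y, 1⟩

/-- Halving a number. -/
def half {K : Type} [Field K] (x : K) : Timed K := ⟨x / 2, 1⟩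

/-- Merging two sorted lists. -/
def merge {α : Type} (cmp : α → α → Timed Bool) : List α → List α → Timed (List α)
  | [], ys => do
      tick
      return ys
  | x :: xs, [] => do
      tick
      return x :: xs
  | x :: xs, y :: ys => do
      tick
      let c ← cmp x y
      if c then
        let r ← merge cmp xs (y :: ys)
        return x :: r
      else
        let r ← merge cmp (x :: xs) ys
        return y :: r
termination_by xs ys => xs.length + ys.length

/-- Merge sort of the first `n` entries of a list; the remaining entries are returned as the second
component. -/
def sortFirst {α : Type} (cmp : α → α → Timed Bool) (n : ℕ) (l : List α) :
    Timed (List α × List α) :=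
  match n, l with
  | 0, l => do
      tick
      return ([], l)
  | _ + 1, [] => do
      tick
      return ([], [])
  | 1, x :: xs => do
      tick
      return ([x], xs)
  | k + 2, l => do
      tick
      let p ← sortFirst cmp ((k + 2) / 2) l
      let q ← sortFirst cmp ((k + 2) - (k + 2) / 2) p.2
      let r ← merge cmp p.1 q.1
      return (r, q.2)
termination_by n

/-- The length of a list, by running through it. -/
def length {α : Type} : List α → Timed ℕ
  | [] => do
      tick
      return 0
  | _ :: xs => do
      tick
      let k ← length xs
      return k + 1

/-- Merge sort. -/
def sort {α : Type} (cmp : α → α → Timed Bool) (l : List α) : Timed (List α) := do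
  tick
  let n ← length l
  let p ← sortFirst cmp n l
  return p.1

end Timed

open Timed

/-! ### Segment tree

The coverage of the transversal line by open intervals has to be recorded exactly, including
single uncovered points between two abutting intervals.  Therefore interval ends are perturbed by
an infinitesimal `ε`: a `Key` `⟨c, false⟩` stands for `c - ε` and `⟨c, true⟩` for `c`.  The
elementary interval from `⟨c, false⟩` to `⟨c, true⟩` represents the single point `c`, the
elementary interval from `⟨c, true⟩` to `⟨c', false⟩` represents the open interval `(c, c')`. So the
open interval `(b, e)` is the key range from `⟨b, true⟩` to `⟨e, false⟩` and the closed interval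
`[b, e]` is the key range from `⟨b, false⟩` to `⟨e, true⟩`. -/

/-- A symbolically perturbed coordinate: `⟨c, false⟩` is `c - ε`, `⟨c, true⟩` is `c`. -/
structure Key (K : Type) where
  coord : K
  plus : Bool

/-- Lexicographic comparison of keys. -/
def Key.le {K : Type} [LinearOrder K] (a b : Key K) : Timed Bool := do
  tick
  if ← Timed.lt a.coord b.coord then return true
  else if ← Timed.lt b.coord a.coord then return false
  else return (!a.plus || b.plus)

/-- A segment tree whose leaves are elementary intervals.  Leaves and nodes carry the two ends of
their range and the number of stored intervals that have this leaf or node as one of their canonical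
pieces.  An inner node has two flags: whether its range is completely covered by, respectively
completely free of, the intervals stored at it or below it. -/
inductive SegTree (K : Type) where
  | empty : SegTree K
  | leaf (l r : Key K) (cnt : ℕ) : SegTree K
  | node (l r : Key K) (cnt : ℕ) (full free : Bool) (left right : SegTree K) : SegTree K

namespace SegTree

/-- The range is covered by the intervals stored at the root or below. -/
def isFull {K : Type} : SegTree K → Bool
  | empty => true
  | leaf _ _ cnt => decide (0 < cnt)
  | node _ _ _ full _ _ _ => full

/-- No interval is stored at the root or below. -/
def isFree {K : Type} : SegTree K → Bool
  | empty => true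
  | leaf _ _ cnt => decide (cnt = 0)
  | node _ _ _ _ free _ _ => free

/-- An inner node with its two flags computed from the counter and the children. -/
def mk {K : Type} (l r : Key K) (cnt : ℕ) (L R : SegTree K) : SegTree K :=
  node l r cnt (decide (0 < cnt) || (L.isFull && R.isFull))
    (decide (cnt = 0) && L.isFree && R.isFree) L R

/-- The balanced tree with `m` leaves whose elementary intervals start at the key `k` and end at
the successive keys of the given list; the last used key and the unused keys are returned too. -/
def build {K : Type} (m : ℕ) (k : Key K) (ks : List (Key K)) :
    Timed (SegTree K × Key K × List (Key K)) :=
  match m, ks with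
  | 0, ks => do
      tick
      return (empty, k, ks)
  | _ + 1, [] => do
      tick
      return (empty, k, [])
  | 1, k' :: ks => do
      tick
      return (leaf k k' 0, k', ks)
  | j + 2, ks => do
      tick
      let (L, k₁, ks₁) ← build ((j + 2) / 2) k ks
      let (R, k₂, ks₂) ← build ((j + 2) - (j + 2) / 2) k₁ ks₁
      return (mk k k₂ 0 L R, k₂, ks₂)
termination_by m

/-- The segment tree over an increasing list of keys. -/
def ofKeys {K : Type} : List (Key K) → Timed (SegTree K)
  | [] => do
      tick
      return empty
  | k :: ks => do
      tick
      let m ← length ks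
      let p ← build m k ks
      return p.1

/-- Is the range from `l` to `r` contained in the range from `s` to `t`? -/
def contained {K : Type} [LinearOrder K] (s t l r : Key K) : Timed Bool := do
  tick
  let c ← Key.le s l
  let d ← Key.le r t
  return c && d

/-- Have the ranges from `l` to `r` and from `s` to `t` at most an end in common? -/
def apart {K : Type} [LinearOrder K] (s t l r : Key K) : Timed Bool := do
  tick
  let c ← Key.le t l
  let d ← Key.le r s
  return c || d

/-- Insertion (`ins = true`) or deletion (`ins = false`) of the interval from `s` to `t`. -/
def update {K : Type} [LinearOrder K] (ins : Bool) (s t : Key K) : SegTree K → Timed (SegTree K)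
  | empty => do
      tick
      return empty
  | leaf l r cnt => do
      tick
      if ← contained s t l r then
        return leaf l r (if ins then cnt + 1 else cnt - 1)
      else
        return leaf l r cnt
  | node l r cnt full free L R => do
      tick
      if ← contained s t l r then
        return mk l r (if ins then cnt + 1 else cnt - 1) L R
      else if ← apart s t l r then
        return node l r cnt full free L R
      else
        let L' ← update ins s t L
        let R' ← update ins s t R
        return mk l r cnt L' R'

/-- Appends the piece from `l` to `r` to a list of pieces (the last piece is at the head), joining
it to the last piece if that one ends at `l`. -/
def push {K : Type} [LinearOrder K] (l r : Key K) : List (Key K × Key K) →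
    Timed (List (Key K × Key K))
  | [] => do
      tick
      return [(l, r)]
  | (a, b) :: acc => do
      tick
      if ← Key.le l b then
        return (a, r) :: acc
      else
        return (l, r) :: (a, b) :: acc

/-- Retrieves the maximal uncovered pieces in the range from `s` to `t`, in increasing order, and
appends them to `acc`. -/
def query {K : Type} [LinearOrder K] (s t : Key K) : SegTree K → List (Key K × Key K) →
    Timed (List (Key K × Key K))
  | empty, acc => do
      tick
      return acc
  | leaf l r cnt, acc => do
      tick
      if 0 < cnt then
        return acc
      else if ← contained s t l r then
        push l r acc
      else
        return acc
  | node l r _ full free L R, acc => do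
      tick
      if full then
        return acc
      else if ← apart s t l r then
        return acc
      else
        let c ← contained s t l r
        if free && c then
          push l r acc
        else
          let acc' ← query s t L acc
          query s t R acc'

end SegTree

/-! ### Plane sweep -/

/-- An axis-parallel rectangle given by its lower left corner, its width and its height. -/
structure Rect (K : Type) where
  x : K
  y : K
  w : K
  h : K

/-- A rectangle as seen by a sweep: it extends from `p₁` to `p₂` in the direction of the sweep and
from `b` to `e` in the transversal direction. -/
structure Box (K : Type) where
  p₁ : K
  p₂ : K
  b : K
  e : K

/-- An event of a sweep: at position `pos`, a rectangle with the transversal extent from `b` to `e`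
begins (`isOpen = true`) or ends (`isOpen = false`). -/
structure Event (K : Type) where
  pos : K
  isOpen : Bool
  b : K
  e : K

/-- Lexicographic comparison of events, closing events before opening ones. -/
def Event.le {K : Type} [LinearOrder K] (u v : Event K) : Timed Bool := do
  tick
  if ← Timed.lt u.pos v.pos then return true
  else if ← Timed.lt v.pos u.pos then return false
  else if !u.isOpen && v.isOpen then return true
  else if u.isOpen && !v.isOpen then return false
  else if ← Timed.lt u.b v.b then return true
  else if ← Timed.lt v.b u.b then return false
  else Timed.le u.e v.e

/-- A segment orthogonal to the direction of the sweep: at position `pos`, from `lo` to `hi`. -/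
structure Seg (K : Type) where
  pos : K
  lo : K
  hi : K

namespace Sweep

/-- Two events for each rectangle. -/
def events {K : Type} : List (Box K) → List (Event K) → Timed (List (Event K))
  | [], acc => do
      tick
      return acc
  | r :: rs, acc => do
      tick
      events rs (⟨r.p₁, true, r.b, r.e⟩ :: ⟨r.p₂, false, r.b, r.e⟩ :: acc)

/-- Collects `c` if it lies between `lo` and `hi`. -/
def collect {K : Type} [LinearOrder K] (lo hi c : K) (acc : List K) : Timed (List K) := do
  tick
  if ← Timed.le lo c then
    if ← Timed.le c hi then
      return c :: acc
    else
      return acc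
  else
    return acc

/-- The transversal coordinates of the rectangles which lie between `lo` and `hi`. -/
def coords {K : Type} [LinearOrder K] (lo hi : K) : List (Box K) → List K → Timed (List K)
  | [], acc => do
      tick
      return acc
  | r :: rs, acc => do
      tick
      let acc₁ ← collect lo hi r.b acc
      let acc₂ ← collect lo hi r.e acc₁
      coords lo hi rs acc₂

/-- Both keys of every coordinate in a sorted list, without repetitions. -/
def keys {K : Type} [LinearOrder K] : List K → Timed (List (Key K))
  | [] => do
      tick
      return []
  | [c] => do
      tick
      return [⟨c, false⟩, ⟨c, true⟩]
  | c :: d :: cs => do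
      tick
      let ks ← keys (d :: cs)
      if ← Timed.lt c d then
        return ⟨c, false⟩ :: ⟨c, true⟩ :: ks
      else
        return ks

/-- Outputs the retrieved pieces as segments at position `p`. -/
def emit {K : Type} (p : K) : List (Key K × Key K) → List (Seg K) → Timed (List (Seg K))
  | [], out => do
      tick
      return out
  | (l, r) :: ps, out => do
      tick
      emit p ps (⟨p, l.coord, r.coord⟩ :: out)

/-- Processes the events.  For an opening event, the uncovered part of the closed side is retrieved
and then the open interval is inserted; for a closing event, the interval is deleted and then the
uncovered part of the closed side is retrieved. -/
def process {K : Type} [LinearOrder K] : List (Event K) → SegTree K → List (Seg K) →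
    Timed (List (Seg K))
  | [], _, out => do
      tick
      return out
  | ev :: evs, T, out => do
      tick
      if ev.isOpen then
        let ps ← T.query ⟨ev.b, false⟩ ⟨ev.e, true⟩ []
        let out' ← emit ev.pos ps out
        let T' ← T.update true ⟨ev.b, true⟩ ⟨ev.e, false⟩
        process evs T' out'
      else
        let T' ← T.update false ⟨ev.b, true⟩ ⟨ev.e, false⟩
        let ps ← T'.query ⟨ev.b, false⟩ ⟨ev.e, true⟩ []
        let out' ← emit ev.pos ps out
        process evs T' out'

/-- One plane sweep.  The free space is restricted to positions between `p₁` and `p₂` and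
transversal coordinates between `lo` and `hi`.  The two sides of the chip met by the sweep act as two
additional rectangles whose transversal extent, from `b` to `e`, is larger than that from `lo` to
`hi`: the first one has already been opened when the sweep starts and ends at `p₁`, the second one
begins at `p₂` and stays open. -/
def run {K : Type} [LinearOrder K] (p₁ p₂ lo hi b e : K) (rs : List (Box K)) :
    Timed (List (Seg K)) := do
  tick
  let L ← events rs [⟨p₁, false, b, e⟩, ⟨p₂, true, b, e⟩]
  let L' ← sort Event.le L
  let cs₀ ← collect lo hi lo []
  let cs₁ ← collect lo hi hi cs₀
  let cs ← coords lo hi rs cs₁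
  let cs' ← sort Timed.le cs
  let ks ← keys cs'
  let T ← SegTree.ofKeys ks
  let T' ← T.update true ⟨b, true⟩ ⟨e, false⟩
  process L' T' []

end Sweep

/-! ### The algorithm -/

/-- Expands all modules by `a` to the left and right and by `c` to the bottom and top. -/
def expandAll {K : Type} [Field K] (a c : K) : List (Rect K) → Timed (List (Box K))
  | [] => do
      tick
      return []
  | m :: ms => do
      tick
      let x₁ ← Timed.sub m.x a
      let r ← Timed.add m.x m.w
      let x₂ ← Timed.add r a
      let y₁ ← Timed.sub m.y c
      let t ← Timed.add m.y m.h
      let y₂ ← Timed.add t c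
      let bs ← expandAll a c ms
      return ⟨x₁, x₂, y₁, y₂⟩ :: bs

/-- Exchanges the roles of the two coordinate directions. -/
def swapAll {K : Type} : List (Box K) → Timed (List (Box K))
  | [] => do
      tick
      return []
  | r :: rs => do
      tick
      let bs ← swapAll rs
      return ⟨r.b, r.e, r.p₁, r.p₂⟩ :: bs

/-- The output of the algorithm: a list of vertical and a list of horizontal segments. -/
structure Contour (K : Type) where
  vertical : List (Seg K)
  horizontal : List (Seg K)

/-- Expand the existing modules and shrink the chip, reducing the new module to a point; then
find the vertical contour segments by a horizontal sweep and the horizontal contour segments by a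
vertical sweep.  `W`, `H` are the width and height of the chip, `wm`, `hm` those of the new module. -/
def findContourSegments {K : Type} [Field K] [LinearOrder K] (W H : K) (M : List (Rect K))
    (wm hm : K) : Timed (Contour K) := do
  tick
  let a ← Timed.half wm
  let c ← Timed.half hm
  let xhi ← Timed.sub W a
  let yhi ← Timed.sub H c
  let xb ← Timed.sub 0 a
  let xe ← Timed.add W a
  let yb ← Timed.sub 0 c
  let ye ← Timed.add H c
  let B ← expandAll a c M
  let v ← Sweep.run a xhi c yhi yb ye B
  let B' ← swapAll B
  let h ← Sweep.run c yhi a xhi xb xe B'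
  return ⟨v, h⟩

/-! ### The free space and its contour -/

/-- The closed rectangle as a set of points. -/
def Rect.closed (r : Rect ℝ) : Set (ℝ × ℝ) :=
  Set.Icc r.x (r.x + r.w) ×ˢ Set.Icc r.y (r.y + r.h)

/-- The open rectangle as a set of points. -/
def Rect.inner (r : Rect ℝ) : Set (ℝ × ℝ) :=
  Set.Ioo r.x (r.x + r.w) ×ˢ Set.Ioo r.y (r.y + r.h)

/-- The existing modules are nondegenerate rectangles on the chip with pairwise disjoint interiors
(they may touch). -/
structure IsPlacement (W H : ℝ) (M : List (Rect ℝ)) : Prop where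
  pos : ∀ m ∈ M, 0 < m.w ∧ 0 < m.h
  on_chip : ∀ m ∈ M, m.closed ⊆ Rect.closed ⟨0, 0, W, H⟩
  disj : M.Pairwise fun m m' => Disjoint m.inner m'.inner

/-- The rectangle occupied by the new module when its center is at `c`. -/
noncomputable def moduleAt (wm hm : ℝ) (c : ℝ × ℝ) : Rect ℝ :=
  ⟨c.1 - wm / 2, c.2 - hm / 2, wm, hm⟩

/-- The free space: the feasible positions of the center of the new module, i.e. those for
which the new module lies on the chip and does not overlap an existing module (touching is
allowed). -/
def freeSpace (W H : ℝ) (M : List (Rect ℝ)) (wm hm : ℝ) : Set (ℝ × ℝ) :=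
  {c | (moduleAt wm hm c).closed ⊆ Rect.closed ⟨0, 0, W, H⟩ ∧
    ∀ m ∈ M, Disjoint (moduleAt wm hm c).inner m.inner}

/-- The points on vertical output segments. -/
def Contour.verticalPart (G : Contour ℝ) : Set (ℝ × ℝ) :=
  ⋃ s ∈ G.vertical, {s.pos} ×ˢ Set.Icc s.lo s.hi

/-- The points on horizontal output segments. -/
def Contour.horizontalPart (G : Contour ℝ) : Set (ℝ × ℝ) :=
  ⋃ s ∈ G.horizontal, Set.Icc s.lo s.hi ×ˢ {s.pos}

/-- `G` describes the contour, i.e. the topological boundary, of the set `S`: its segments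
(which may be single points) make up the boundary of `S`, all vertical segments of the boundary
are found among the vertical ones and all horizontal segments among the horizontal ones. -/
structure Contour.IsContourOf (G : Contour ℝ) (S : Set (ℝ × ℝ)) : Prop where
  vertical_le : ∀ s ∈ G.vertical, s.lo ≤ s.hi
  horizontal_le : ∀ s ∈ G.horizontal, s.lo ≤ s.hi
  union_eq : G.verticalPart ∪ G.horizontalPart = frontier S
  vertical_all : ∀ p a b : ℝ, a < b → {p} ×ˢ Set.Icc a b ⊆ frontier S →
    {p} ×ˢ Set.Icc a b ⊆ G.verticalPart
  horizontal_all : ∀ p a b : ℝ, a < b → Set.Icc a b ×ˢ {p} ⊆ frontier S →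
    Set.Icc a b ×ˢ {p} ⊆ G.horizontalPart

/-! Shrinking the new module to its center turns the free space into a closed rectangle minus
finitely many open boxes (`freeSpace_eq`). A point of this set is a boundary point exactly if it
lies on a chip side or on a side of a box. Away from all closed sides only finitely many open
conditions matter, and every side is a limit of forbidden points (`frontier_uncovered`). A vertical
boundary segment of positive length meets horizontal sides that do not explain it as a whole in
finitely many points only, so by closedness it lies on vertical sides (`mem_onSide_of_segment`).

A sweep reports exactly those points of the sides orthogonal to it that lie in no open box
(`Sweep.mem_run_iff`). A box properly crossed by the sweep line is stored at every event there, so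
nothing forbidden is reported. Conversely, several events may share a position. Among the closing
events whose side contains the given point the last one works, among the opening events the first
one: there no box that merely touches the line hides the point. The tree is exact because each tree
that occurs has the form `fill A T`, a function of a fixed skeleton `T` and the multiset `A` of
stored intervals. Updates change `A` by one element (`update_insert`, `update_delete`), and a
retrieval amounts to scanning the uncovered leaves (`query_val`).

For the running time only the retrievals are delicate. One of them costs O(height) for each change
between covered and uncovered inside the retrieved side (`Spans.query_cost_le`), and a single side
can contain many changes. Apart from at most six keys, each change at an event of a box `X` is an
uncovered end of an active box `B` whose transversal extent is nested in that of `X`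
(`retrieve_cost_le`). Because the modules are disjoint and are all expanded by the same amounts,
such a `B` cannot also extend `X` in the sweep direction (`IsPlacement.not_cross`). Hence a `B` that
is open when `X` opens closes before `X`, and until then `X` shields it from being charged again.
Thus `B` is charged by at most one opening event and, reversing time, by at most one closing event
(`IsTimeline.sum_card_charged_le`). There are O(n) changes altogether, the height is O(log n), and
merge sort has the same bound. -/

/-! ### Cost calculus and merge sort -/

namespace Timed

variable {α β : Type}

@[simp] theorem bind_val (x : Timed α) (f : α → Timed β) : (x >>= f).val = (f x.val).val := rfl

@[simp] theorem bind_cost (x : Timed α) (f : α → Timed β) :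
    (x >>= f).cost = x.cost + (f x.val).cost := rfl

@[simp] theorem pure_val (a : α) : (pure a : Timed α).val = a := rfl

@[simp] theorem pure_cost (a : α) : (pure a : Timed α).cost = 0 := rfl

@[simp] theorem tick_cost : tick.cost = 1 := rfl

@[simp] theorem ite_val (c : Prop) [Decidable c] (x y : Timed α) :
    (if c then x else y).val = if c then x.val else y.val := by split <;> rfl

theorem ite_cost (c : Prop) [Decidable c] (x y : Timed α) :
    (if c then x else y).cost = if c then x.cost else y.cost := by split <;> rfl

section LinearOrder

variable {K : Type} [LinearOrder K]

@[simp] theorem lt_val (x y : K) : (lt x y).val = decide (x < y) := rfl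
@[simp] theorem lt_cost (x y : K) : (lt x y).cost = 1 := rfl
@[simp] theorem le_val (x y : K) : (le x y).val = decide (x ≤ y) := rfl
@[simp] theorem le_cost (x y : K) : (le x y).cost = 1 := rfl

end LinearOrder

section Field

variable {K : Type} [Field K]

@[simp] theorem add_val (x y : K) : (add x y).val = x + y := rfl
@[simp] theorem add_cost (x y : K) : (add x y).cost = 1 := rfl
@[simp] theorem sub_val (x y : K) : (sub x y).val = x - y := rfl
@[simp] theorem sub_cost (x y : K) : (sub x y).cost = 1 := rfl
@[simp] theorem half_val (x : K) : (half x).val = x / 2 := rfl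
@[simp] theorem half_cost (x : K) : (half x).cost = 1 := rfl

end Field

theorem merge_val (cmp : α → α → Timed Bool) (xs ys : List α) :
    (merge cmp xs ys).val = List.merge xs ys (fun x y => (cmp x y).val) := by
  fun_induction merge cmp xs ys <;> simp_all [List.merge]

theorem merge_cost_le {cmp : α → α → Timed Bool} {k : ℕ} (hk : ∀ x y, (cmp x y).cost ≤ k)
    (xs ys : List α) : (merge cmp xs ys).cost ≤ (k + 1) * (xs.length + ys.length) + 1 := by
  fun_induction merge cmp xs ys with
  | case1 ys => simp
  | case2 x xs => simp
  | case3 x xs y ys ih₁ ih₂ =>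
    have := hk x y
    simp only [bind_cost, tick_cost, ite_cost, pure_cost, List.length_cons] at *
    split <;> nlinarith

@[simp] theorem length_val (l : List α) : (length l).val = l.length := by
  induction l <;> simp_all [length]

@[simp] theorem length_cost (l : List α) : (length l).cost = l.length + 1 := by
  induction l <;> simp_all [length]; omega

/-- The larger half is the rounded-up one, and halving with rounding up lowers the rounded-up
logarithm by one. This drives both the depth of merge sort and the height of the segment tree. -/
theorem clog_two_halves (k : ℕ) :
    Nat.clog 2 ((k + 2) / 2) + 1 ≤ Nat.clog 2 (k + 2) ∧
      Nat.clog 2 ((k + 2) - (k + 2) / 2) + 1 ≤ Nat.clog 2 (k + 2) := by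
  rw [Nat.clog_of_two_le (b := 2) (n := k + 2) (by omega) (by omega)]
  constructor <;> gcongr <;> omega

theorem sortFirst_perm (cmp : α → α → Timed Bool) (n : ℕ) (l : List α) :
    (sortFirst cmp n l).val.1.Perm (l.take n) ∧ (sortFirst cmp n l).val.2 = l.drop n := by
  fun_induction sortFirst cmp n l with
  | case1 => simp
  | case2 => simp
  | case3 => simp
  | case4 k l h ih₁ ih₂ =>
    simp only [bind_val, pure_val, merge_val] at *
    obtain ⟨h₁, h₂⟩ := ih₁
    obtain ⟨h₃, h₄⟩ := ih₂ (sortFirst cmp ((k + 2) / 2) l).val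
    rw [h₂] at h₃ h₄ ⊢
    refine ⟨(List.merge_perm_append _).trans ((h₁.append h₃).trans ?_), ?_⟩
    · rw [← List.take_add]
      exact List.Perm.of_eq (by congr 1; omega)
    · rw [h₄, List.drop_drop]
      congr 1; omega

theorem sortFirst_pairwise {cmp : α → α → Timed Bool} {r : α → α → Prop}
    (hr : ∀ x y, (cmp x y).val = true ↔ r x y) (ht : ∀ x y z, r x y → r y z → r x z)
    (htot : ∀ x y, r x y ∨ r y x) (n : ℕ) (l : List α) :
    (sortFirst cmp n l).val.1.Pairwise r := by
  fun_induction sortFirst cmp n l with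
  | case1 => simp
  | case2 => simp
  | case3 => simp
  | case4 k l h ih₁ ih₂ =>
    simp only [bind_val, pure_val, merge_val] at *
    obtain rfl : r = fun x y => (cmp x y).val = true := by ext; rw [hr]
    refine List.pairwise_merge (le := fun x y => (cmp x y).val) ht ?_ _ _ ih₁
      (ih₂ (sortFirst cmp ((k + 2) / 2) l).val)
    intro a b
    simpa using htot a b

/-- On each of the `Nat.clog 2 n` levels merging costs `k + 1` per entry; the remaining 3 per entry
absorb the constant overhead of the calls. -/
theorem sortFirst_cost_le {cmp : α → α → Timed Bool} {k : ℕ} (hk : ∀ x y, (cmp x y).cost ≤ k)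
    (n : ℕ) (l : List α) : (sortFirst cmp n l).cost ≤ 1 + (k + 4) * (n * Nat.clog 2 n) := by
  fun_induction sortFirst cmp n l with
  | case1 => simp
  | case2 => simp
  | case3 => simp
  | case4 j l h ih₁ ih₂ =>
    have hm := merge_cost_le hk (sortFirst cmp ((j + 2) / 2) l).val.1
      (sortFirst cmp ((j + 2) - (j + 2) / 2) (sortFirst cmp ((j + 2) / 2) l).val.2).val.1
    have l₁ := (sortFirst_perm cmp ((j + 2) / 2) l).1.length_eq
    have l₂ := (sortFirst_perm cmp ((j + 2) - (j + 2) / 2)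
      (sortFirst cmp ((j + 2) / 2) l).val.2).1.length_eq
    rw [List.length_take] at l₁ l₂
    obtain ⟨c₁, c₂⟩ := clog_two_halves j
    simp only [bind_cost, tick_cost, pure_cost, Nat.succ_eq_add_one, add_assoc, Nat.reduceAdd] at *
    generalize Nat.clog 2 (j + 2) = c at *
    obtain ⟨c, rfl⟩ : ∃ c', c = c' + 1 := ⟨c - 1, by omega⟩
    have e₁ : (j + 2) / 2 * Nat.clog 2 ((j + 2) / 2) ≤ (j + 2) / 2 * c := by gcongr; omega
    have e₂ : ((j + 2) - (j + 2) / 2) * Nat.clog 2 ((j + 2) - (j + 2) / 2) ≤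
        ((j + 2) - (j + 2) / 2) * c := by gcongr; omega
    have e₃ : (j + 2) / 2 * c + ((j + 2) - (j + 2) / 2) * c = (j + 2) * c := by
      rw [← Nat.add_mul]; congr 1; omega
    have hl : (k + 1) * ((sortFirst cmp ((j + 2) / 2) l).val.1.length +
      (sortFirst cmp ((j + 2) - (j + 2) / 2) (sortFirst cmp ((j + 2) / 2) l).val.2).val.1.length)
        ≤ (k + 1) * (j + 2) := by
      exact Nat.mul_le_mul_left _ (by omega)
    replace ih₂ := ih₂ (sortFirst cmp ((j + 2) / 2) l).val
    generalize (sortFirst cmp ((j + 2) / 2) l) = S₁ at *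
    generalize (sortFirst cmp ((j + 2) - (j + 2) / 2) S₁.val.2) = S₂ at *
    generalize (merge cmp S₁.val.1 S₂.val.1) = S₃ at *
    have e₄ := Nat.mul_le_mul_left (k + 4) (Nat.add_le_add e₁ e₂)
    rw [e₃, Nat.mul_add] at e₄
    have e₅ : (k + 4) * ((j + 2) * (c + 1)) =
      (k + 4) * ((j + 2) * c) + (k + 1) * (j + 2) + 3 * (j + 2) := by ring
    omega

theorem sort_perm (cmp : α → α → Timed Bool) (l : List α) : (sort cmp l).val.Perm l := by
  simpa [sort] using (sortFirst_perm cmp l.length l).1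

theorem sort_pairwise {cmp : α → α → Timed Bool} {r : α → α → Prop}
    (hr : ∀ x y, (cmp x y).val = true ↔ r x y) (ht : ∀ x y z, r x y → r y z → r x z)
    (htot : ∀ x y, r x y ∨ r y x) (l : List α) : (sort cmp l).val.Pairwise r := by
  simpa [sort] using sortFirst_pairwise hr ht htot l.length l

theorem sort_cost_le {cmp : α → α → Timed Bool} {k : ℕ} (hk : ∀ x y, (cmp x y).cost ≤ k)
    (l : List α) :
    (sort cmp l).cost ≤ l.length + 3 + (k + 4) * (l.length * Nat.clog 2 l.length) := by
  have := sortFirst_cost_le hk l.length l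
  simp only [sort, bind_cost, tick_cost, pure_cost, length_cost, length_val]
  omega

end Timed

/-! ### Order of the perturbed coordinates -/

theorem Key.lex_injective {K : Type} :
    Function.Injective fun k : Key K => toLex (k.coord, k.plus) := by
  rintro ⟨a, b⟩ ⟨c, d⟩ h
  simpa using h

/-- Keys are ordered lexicographically. -/
instance Key.instLinearOrder {K : Type} [LinearOrder K] : LinearOrder (Key K) :=
  LinearOrder.lift' (fun k => toLex (k.coord, k.plus)) Key.lex_injective

namespace Key

variable {K : Type} [LinearOrder K]

theorem le_def (a b : Key K) :
    a ≤ b ↔ a.coord < b.coord ∨ a.coord = b.coord ∧ a.plus ≤ b.plus :=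
  Prod.Lex.le_iff

theorem lt_def (a b : Key K) :
    a < b ↔ a.coord < b.coord ∨ a.coord = b.coord ∧ a.plus < b.plus :=
  Prod.Lex.lt_iff

@[simp] theorem false_le_false (c d : K) : (⟨c, false⟩ : Key K) ≤ ⟨d, false⟩ ↔ c ≤ d := by
  rw [le_def]; simp [le_iff_lt_or_eq (a := c)]

@[simp] theorem true_le_true (c d : K) : (⟨c, true⟩ : Key K) ≤ ⟨d, true⟩ ↔ c ≤ d := by
  rw [le_def]; simp [le_iff_lt_or_eq (a := c)]

@[simp] theorem false_le_true (c d : K) : (⟨c, false⟩ : Key K) ≤ ⟨d, true⟩ ↔ c ≤ d := by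
  rw [le_def]; simp [le_iff_lt_or_eq (a := c)]

@[simp] theorem true_le_false (c d : K) : (⟨c, true⟩ : Key K) ≤ ⟨d, false⟩ ↔ c < d := by
  simp [le_def]

theorem coord_le {a b : Key K} (h : a ≤ b) : a.coord ≤ b.coord := by
  rcases (le_def a b).1 h with h | h
  · exact h.le
  · exact h.1.le

@[simp] theorem le_val (a b : Key K) : (Key.le a b).val = decide (a ≤ b) := by
  obtain ⟨c, p⟩ := a
  obtain ⟨d, q⟩ := b
  rcases lt_trichotomy c d with h | rfl | h
  · simp [Key.le, le_def, h]
  · cases p <;> cases q <;> simp [Key.le]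
  · simp [Key.le, le_def, h, h.not_gt, h.ne']

theorem le_cost_le (a b : Key K) : (Key.le a b).cost ≤ 3 := by
  simp only [Key.le, bind_cost, tick_cost, lt_cost, ite_cost, pure_cost]
  split_ifs <;> omega

end Key

/-! ### Segment trees: correctness of updates and retrievals -/

namespace SegTree

variable {K : Type} [LinearOrder K]

@[simp] theorem contained_val (s t l r : Key K) :
    (contained s t l r).val = decide (s ≤ l ∧ r ≤ t) := by
  simp [contained]

@[simp] theorem apart_val (s t l r : Key K) :
    (apart s t l r).val = decide (t ≤ l ∨ r ≤ s) := by
  simp [apart]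

theorem contained_cost_le (s t l r : Key K) : (contained s t l r).cost ≤ 7 := by
  have := Key.le_cost_le s l
  have := Key.le_cost_le r t
  simp only [contained, bind_cost, tick_cost, pure_cost]
  omega

theorem apart_cost_le (s t l r : Key K) : (apart s t l r).cost ≤ 7 := by
  have := Key.le_cost_le t l
  have := Key.le_cost_le r s
  simp only [apart, bind_cost, tick_cost, pure_cost]
  omega

theorem push_cost_le (l r : Key K) (acc : List (Key K × Key K)) :
    1 ≤ (push l r acc).cost ∧ (push l r acc).cost ≤ 4 := by
  rcases acc with _ | ⟨⟨a, b⟩, acc⟩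
  · simp [push]
  · have := Key.le_cost_le l b
    simp only [push, bind_cost, tick_cost, ite_cost, pure_cost]
    split_ifs <;> omega

theorem length_push_le (l r : Key K) (acc : List (Key K × Key K)) :
    (push l r acc).val.length ≤ acc.length + 1 := by
  rcases acc with _ | ⟨⟨a, b⟩, acc⟩
  · simp [push]
  · simp only [push, bind_val, ite_val, pure_val]
    split_ifs <;> simp

/-- The leaf ranges of a tree from left to right. -/
def leaves {K : Type} : SegTree K → List (Key K × Key K)
  | empty => []
  | leaf l r _ => [(l, r)]
  | node _ _ _ _ _ L R => leaves L ++ leaves R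

/-- The height of a tree, leaves having height `0`. -/
def height {K : Type} : SegTree K → ℕ
  | empty => 0
  | leaf _ _ _ => 0
  | node _ _ _ _ _ L R => max (height L) (height R) + 1

/-- The tree covers the range from `l` to `r` by nonempty elementary intervals. -/
inductive Spans : SegTree K → Key K → Key K → Prop
  | leaf {l r : Key K} {c : ℕ} : l < r → Spans (leaf l r c) l r
  | node {l m r : Key K} {c : ℕ} {f g : Bool} {L R : SegTree K} :
      Spans L l m → Spans R m r → Spans (node l r c f g L R) l r

/-- The tree with the given skeleton in which the intervals of the multiset are stored. -/
def fill (A : Multiset (Key K × Key K)) : SegTree K → SegTree K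
  | empty => empty
  | leaf l r _ => leaf l r (A.countP fun i => i.1 ≤ l ∧ r ≤ i.2)
  | node l r _ _ _ L R => mk l r (A.countP fun i => i.1 ≤ l ∧ r ≤ i.2)
      (fill (A.filter fun i => ¬(i.1 ≤ l ∧ r ≤ i.2)) L)
      (fill (A.filter fun i => ¬(i.1 ≤ l ∧ r ≤ i.2)) R)

/-- A range is covered by some interval of the multiset. -/
def Covered (A : Multiset (Key K × Key K)) (l r : Key K) : Prop :=
  ∃ i ∈ A, i.1 ≤ l ∧ r ≤ i.2

@[simp] theorem isFull_node {K : Type} (l r : Key K) (c : ℕ) (f g : Bool) (L R : SegTree K) :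
    (node l r c f g L R).isFull = f := rfl

@[simp] theorem isFree_node {K : Type} (l r : Key K) (c : ℕ) (f g : Bool) (L R : SegTree K) :
    (node l r c f g L R).isFree = g := rfl

namespace Spans

theorem lt {T : SegTree K} {l r : Key K} (h : Spans T l r) : l < r := by
  induction h with
  | leaf h => exact h
  | node _ _ h₁ h₂ => exact h₁.trans h₂

theorem of_mem_leaves {T : SegTree K} {l r : Key K} (h : Spans T l r) :
    ∀ i ∈ T.leaves, l ≤ i.1 ∧ i.1 < i.2 ∧ i.2 ≤ r := by
  induction h with
  | leaf h => simpa [leaves] using h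
  | node h₁ h₂ ih₁ ih₂ =>
    intro i hi
    simp only [leaves, List.mem_append] at hi
    rcases hi with hi | hi
    · exact ⟨(ih₁ i hi).1, (ih₁ i hi).2.1, (ih₁ i hi).2.2.trans h₂.lt.le⟩
    · exact ⟨h₁.lt.le.trans (ih₂ i hi).1, (ih₂ i hi).2.1, (ih₂ i hi).2.2⟩

theorem exists_first {T : SegTree K} {l r : Key K} (h : Spans T l r) :
    ∃ k, (l, k) ∈ T.leaves := by
  induction h with
  | leaf h => simp [leaves]
  | node h₁ h₂ ih₁ ih₂ =>
    obtain ⟨k, hk⟩ := ih₁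
    exact ⟨k, by simp [leaves, hk]⟩

theorem exists_last {T : SegTree K} {l r : Key K} (h : Spans T l r) :
    ∃ k, (k, r) ∈ T.leaves := by
  induction h with
  | leaf h => simp [leaves]
  | node h₁ h₂ ih₁ ih₂ =>
    obtain ⟨k, hk⟩ := ih₂
    exact ⟨k, by simp [leaves, hk]⟩

/-- Node ranges are nonempty, so an interval that at most touches the root range contains no range
of the subtree and increases no counter. This justifies stopping an update at such a node. -/
theorem fill_cons_of_apart {T : SegTree K} {l r s t : Key K} (h : Spans T l r)
    (hst : t ≤ l ∨ r ≤ s) (A : Multiset (Key K × Key K)) : fill ((s, t) ::ₘ A) T = fill A T := by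
  induction h generalizing A with
  | @leaf l r c h =>
    have : ¬(s ≤ l ∧ r ≤ t) := by
      rintro ⟨h₁, h₂⟩
      rcases hst with h' | h'
      · exact absurd (h.trans_le (h₂.trans h')) (lt_irrefl _)
      · exact absurd (h.trans_le (h'.trans h₁)) (lt_irrefl _)
    simp [fill, this]
  | @node l m r c f g L R h₁ h₂ ih₁ ih₂ =>
    have hlt := h₁.lt.trans h₂.lt
    have : ¬(s ≤ l ∧ r ≤ t) := by
      rintro ⟨h₃, h₄⟩
      rcases hst with h' | h'
      · exact absurd (hlt.trans_le (h₄.trans h')) (lt_irrefl _)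
      · exact absurd (hlt.trans_le (h'.trans h₃)) (lt_irrefl _)
    have e₁ : t ≤ l ∨ m ≤ s := hst.imp id h₂.lt.le.trans
    have e₂ : t ≤ m ∨ r ≤ s := hst.imp (fun h => h.trans h₁.lt.le) id
    simp only [fill, Multiset.countP_cons, this, if_false, add_zero, not_false_eq_true,
      Multiset.filter_cons_of_pos, ih₁ e₁, ih₂ e₂]

/-- Here `A` is the multiset handed down to this subtree; intervals absorbed at an ancestor are not
in it. The flag is therefore a local notion, and a retrieval has to bring it together with global
coverage. -/
theorem isFull_fill {T : SegTree K} {l r : Key K} (h : Spans T l r)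
    (A : Multiset (Key K × Key K)) :
    (fill A T).isFull = true ↔ ∀ i ∈ T.leaves, Covered A i.1 i.2 := by
  induction h generalizing A with
  | leaf h => simp [fill, isFull, leaves, Covered, Multiset.countP_pos]
  | @node l m r c f g L R h₁ h₂ ih₁ ih₂ =>
    have hsp := Spans.node (c := c) (f := f) (g := g) h₁ h₂
    by_cases hc : ∃ i ∈ A, i.1 ≤ l ∧ r ≤ i.2
    · have h' : 0 < A.countP fun i => i.1 ≤ l ∧ r ≤ i.2 := Multiset.countP_pos.2 hc
      simp only [fill, mk, isFull_node, h', decide_true, Bool.true_or, true_iff]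
      obtain ⟨i, hi, h₃, h₄⟩ := hc
      intro j hj
      obtain ⟨h₅, -, h₆⟩ := hsp.of_mem_leaves j hj
      exact ⟨i, hi, h₃.trans h₅, h₆.trans h₄⟩
    · have h' : ¬ 0 < A.countP fun i => i.1 ≤ l ∧ r ≤ i.2 := by rwa [Multiset.countP_pos]
      -- If no interval contains the whole range, nothing is absorbed at this node and both children
      -- receive all of `A`.
      have hA : (A.filter fun i => ¬(i.1 ≤ l ∧ r ≤ i.2)) = A :=
        Multiset.filter_eq_self.2 fun i hi h => hc ⟨i, hi, h⟩
      simp only [fill, mk, isFull_node, h', hA, decide_false, Bool.false_or, Bool.and_eq_true, ih₁, ih₂,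
        leaves, List.mem_append, or_imp, forall_and]

theorem isFree_fill {T : SegTree K} {l r : Key K} (h : Spans T l r)
    (A : Multiset (Key K × Key K)) :
    (fill A T).isFree = true ↔ ∀ i ∈ T.leaves, ¬Covered A i.1 i.2 := by
  induction h generalizing A with
  | leaf h => simp [fill, isFree, leaves, Covered, Multiset.countP_eq_zero]
  | @node l m r c f g L R h₁ h₂ ih₁ ih₂ =>
    have hsp := Spans.node (c := c) (f := f) (g := g) h₁ h₂
    by_cases hc : ∃ i ∈ A, i.1 ≤ l ∧ r ≤ i.2
    · have h' : ¬ (A.countP fun i => i.1 ≤ l ∧ r ≤ i.2) = 0 :=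
        (Multiset.countP_pos.2 hc).ne'
      simp only [fill, mk, isFree_node, h', decide_false, Bool.false_and, Bool.false_eq_true, false_iff,
        not_forall, not_not]
      obtain ⟨i, hi, h₃, h₄⟩ := hc
      obtain ⟨k, hk⟩ := hsp.exists_first
      obtain ⟨h₅, -, h₆⟩ := hsp.of_mem_leaves _ hk
      exact ⟨_, hk, i, hi, h₃.trans h₅, h₆.trans h₄⟩
    · have h' : (A.countP fun i => i.1 ≤ l ∧ r ≤ i.2) = 0 := by
        rw [Multiset.countP_eq_zero]; exact fun i hi h => hc ⟨i, hi, h⟩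
      have hA : (A.filter fun i => ¬(i.1 ≤ l ∧ r ≤ i.2)) = A :=
        Multiset.filter_eq_self.2 fun i hi h => hc ⟨i, hi, h⟩
      simp only [fill, mk, isFree_node, h', hA, decide_true, Bool.true_and, Bool.and_eq_true, ih₁, ih₂,
        leaves, List.mem_append, or_imp, forall_and]

/-- Since a filled tree depends only on skeleton and multiset, one update step suffices to control
every history of updates. The interval is either absorbed here and filtered away from the children,
or irrelevant below, or passed on to both children unchanged. -/
theorem update_insert {T : SegTree K} {l r : Key K} (h : Spans T l r) (s t : Key K)
    (A : Multiset (Key K × Key K)) :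
    (update true s t (fill A T)).val = fill ((s, t) ::ₘ A) T := by
  induction h generalizing A with
  | @leaf l r c h =>
    by_cases hc : s ≤ l ∧ r ≤ t <;> simp [fill, update, hc]
  | @node l m r c f g L R h₁ h₂ ih₁ ih₂ =>
    by_cases hc : s ≤ l ∧ r ≤ t
    · simp [fill, update, mk, hc]
    · by_cases ha : t ≤ l ∨ r ≤ s
      · rw [(Spans.node h₁ h₂).fill_cons_of_apart ha]
        simp only [fill, mk, update, bind_val, pure_val, contained_val, apart_val, hc, ha,
          decide_true, decide_false, if_true, if_false, Bool.false_eq_true]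
      · simp only [fill, update, mk, bind_val, pure_val, contained_val, apart_val, hc, ha,
          decide_false, if_false, Bool.false_eq_true, ih₁, ih₂, Multiset.countP_cons,
          add_zero, not_false_eq_true, Multiset.filter_cons_of_pos]

/-- The interval is known to be stored, so every counter that is decreased is positive and the
truncated subtraction is exact. -/
theorem update_delete {T : SegTree K} {l r : Key K} (h : Spans T l r) (s t : Key K)
    (A : Multiset (Key K × Key K)) :
    (update false s t (fill ((s, t) ::ₘ A) T)).val = fill A T := by
  induction h generalizing A with
  | @leaf l r c h =>
    by_cases hc : s ≤ l ∧ r ≤ t <;> simp [fill, update, hc]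
  | @node l m r c f g L R h₁ h₂ ih₁ ih₂ =>
    by_cases hc : s ≤ l ∧ r ≤ t
    · simp [fill, update, mk, hc]
    · by_cases ha : t ≤ l ∨ r ≤ s
      · rw [(Spans.node h₁ h₂).fill_cons_of_apart ha]
        simp only [fill, mk, update, bind_val, pure_val, contained_val, apart_val, hc, ha,
          decide_true, decide_false, if_true, if_false, Bool.false_eq_true]
      · simp only [fill, update, mk, bind_val, pure_val, contained_val, apart_val, hc, ha,
          decide_false, if_false, Bool.false_eq_true, ih₁, ih₂, Multiset.countP_cons,
          add_zero, not_false_eq_true, Multiset.filter_cons_of_pos]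

/-- Consecutive leaves share a key, so successive pushes are joined. This makes the shortcut at a
completely free node agree with a scan of its leaves. -/
theorem foldl_push_leaves {T : SegTree K} {l r : Key K} (h : Spans T l r)
    (acc : List (Key K × Key K)) :
    T.leaves.foldl (fun a i => (push i.1 i.2 a).val) acc = (push l r acc).val := by
  induction h generalizing acc with
  | leaf h => simp [leaves]
  | @node l m r c f g L R h₁ h₂ ih₁ ih₂ =>
    simp only [leaves, List.foldl_append, ih₁, ih₂]
    rcases acc with _ | ⟨⟨a, b⟩, acc⟩
    · simp [push]
    · by_cases hb : l ≤ b <;> simp [push, hb]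

-- The tests at a node only skip work in a left-to-right scan of the leaves. A full node has no
-- uncovered leaf, a node apart from the range has no leaf inside it, and at a free contained node
-- all leaves qualify and are joined to one piece.
open Classical in
theorem query_val {T : SegTree K} {l r : Key K} (h : Spans T l r) (s t : Key K)
    (A : Multiset (Key K × Key K)) (acc : List (Key K × Key K)) :
    (query s t (fill A T) acc).val =
      (T.leaves.filter fun i => (s ≤ i.1 ∧ i.2 ≤ t) ∧ ¬Covered A i.1 i.2).foldl
        (fun a i => (push i.1 i.2 a).val) acc := by
  induction h generalizing A acc with
  | @leaf l r c h =>
    by_cases hA : Covered A l r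
    · have hc : 0 < A.countP fun i => i.1 ≤ l ∧ r ≤ i.2 := Multiset.countP_pos.2 hA
      simp [query, fill, leaves, hc, hA]
    · have hc : ¬ 0 < A.countP fun i => i.1 ≤ l ∧ r ≤ i.2 := by
        rw [Multiset.countP_pos]; exact hA
      by_cases hst : s ≤ l ∧ r ≤ t <;> simp [query, fill, leaves, hc, hA, hst]
  | @node l m r c f g L R h₁ h₂ ih₁ ih₂ =>
    have hsp := Spans.node (c := c) (f := f) (g := g) h₁ h₂
    have hfull := hsp.isFull_fill A
    have hfree := hsp.isFree_fill A
    by_cases hfu : ∀ i ∈ (SegTree.node l r c f g L R).leaves, Covered A i.1 i.2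
    · have : ((SegTree.node l r c f g L R).leaves.filter
          fun i => (s ≤ i.1 ∧ i.2 ≤ t) ∧ ¬Covered A i.1 i.2) = [] := by
        rw [List.filter_eq_nil_iff]
        intro i hi
        simp [hfu i hi]
      rw [this]
      rw [← hfull] at hfu
      simp only [fill, mk, isFull_node] at hfu
      simp only [query, fill, mk, bind_val, hfu, if_true, pure_val, List.foldl_nil]
    -- A node that is not full has no interval stored at itself, so descending into the children
    -- forgets no coverage. This is why the search never needs the counters of ancestors.
    have hnc : (A.filter fun i => ¬(i.1 ≤ l ∧ r ≤ i.2)) = A := by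
      rw [Multiset.filter_eq_self]
      intro i hi h'
      refine hfu fun j hj => ?_
      obtain ⟨h₅, -, h₆⟩ := hsp.of_mem_leaves j hj
      exact ⟨i, hi, h'.1.trans h₅, h₆.trans h'.2⟩
    rw [← hfull, Bool.not_eq_true] at hfu
    simp only [fill, mk, isFull_node] at hfu
    simp only [query, fill, mk, bind_val, ite_val, hfu, if_false, pure_val, Bool.false_eq_true,
      apart_val, decide_eq_true_eq, contained_val]
    by_cases ha : t ≤ l ∨ r ≤ s
    · have : ((SegTree.node l r c f g L R).leaves.filter
          fun i => (s ≤ i.1 ∧ i.2 ≤ t) ∧ ¬Covered A i.1 i.2) = [] := by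
        rw [List.filter_eq_nil_iff]
        intro i hi
        obtain ⟨h₅, h₆, h₇⟩ := hsp.of_mem_leaves i hi
        have : ¬(s ≤ i.1 ∧ i.2 ≤ t) := by
          rintro ⟨h₈, h₉⟩
          rcases ha with h' | h'
          · exact absurd (h₆.trans_le (h₉.trans (h'.trans h₅))) (lt_irrefl _)
          · exact absurd (h₆.trans_le (h₇.trans (h'.trans h₈))) (lt_irrefl _)
        simp [this]
      rw [this, if_pos ha, List.foldl_nil]
    rw [if_neg ha]
    split_ifs with hb
    · rw [Bool.and_eq_true] at hb
      obtain ⟨hb, hst⟩ := hb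
      have hb' := hfree.1 (by simpa only [fill, mk, isFree_node] using hb)
      have hst' : s ≤ l ∧ r ≤ t := by simpa using hst
      have : ((SegTree.node l r c f g L R).leaves.filter
          fun i => (s ≤ i.1 ∧ i.2 ≤ t) ∧ ¬Covered A i.1 i.2) =
          (SegTree.node l r c f g L R).leaves := by
        rw [List.filter_eq_self]
        intro i hi
        obtain ⟨h₅, h₆, h₇⟩ := hsp.of_mem_leaves i hi
        simp [hb' i hi, hst'.1.trans h₅, h₇.trans hst'.2]
      rw [this, hsp.foldl_push_leaves]
    · rw [hnc, ih₁, ih₂, leaves, List.filter_append, List.foldl_append]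

end Spans

/-- Every new piece comes from a push, which costs a step. Hence reporting the pieces can be charged
to finding them. -/
theorem length_query_le (s t : Key K) (T : SegTree K) (acc : List (Key K × Key K)) :
    (query s t T acc).val.length ≤ acc.length + (query s t T acc).cost := by
  induction T generalizing acc with
  | empty => simp [query]
  | leaf l r c =>
    have := length_push_le l r acc
    have := push_cost_le l r acc
    simp only [query, bind_val, ite_val, bind_cost, ite_cost, pure_val, pure_cost, tick_cost]
    split_ifs <;> omega
  | node l r c f g L R ih₁ ih₂ =>
    have := length_push_le l r acc
    have := push_cost_le l r acc
    have := ih₁ acc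
    have := ih₂ (query s t L acc).val
    simp only [query, bind_val, ite_val, bind_cost, ite_cost, pure_val, pure_cost, tick_cost]
    split_ifs <;> omega

end SegTree

/-! ### Segment trees: cost in terms of the break keys inside a range -/

namespace SegTree

variable {K : Type} [LinearOrder K]

theorem card_filter_add_card_filter_le (D : Finset (Key K)) {l m r : Key K} (h₁ : l < m)
    (h₂ : m < r) :
    (D.filter fun d => l < d ∧ d < m).card + (D.filter fun d => m < d ∧ d < r).card ≤
      (D.filter fun d => l < d ∧ d < r).card := by
  rw [← Finset.card_union_of_disjoint]
  · apply Finset.card_le_card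
    intro d hd
    simp only [Finset.mem_union, Finset.mem_filter] at hd ⊢
    rcases hd with hd | hd
    · exact ⟨hd.1, hd.2.1, hd.2.2.trans h₂⟩
    · exact ⟨hd.1, h₁.trans hd.2.1, hd.2.2⟩
  · rw [Finset.disjoint_left]
    intro d hd hd'
    simp only [Finset.mem_filter] at hd hd'
    exact absurd (hd.2.2.trans hd'.2.1) (lt_irrefl _)

/-- Induction step for costs of the form `k * (1 + 2 * height * breaks)`. A node that recurses has a
break key inside, so going one level up adds at least `2 * k` to the bound, which pays for the node
itself and for the second constant term. -/
theorem recursive_cost_le {k c₀ c₁ c₂ h h₁ h₂ d d₁ d₂ : ℕ} (hc₀ : c₀ ≤ k)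
    (hc₁ : c₁ ≤ k * (1 + 2 * (h₁ * d₁))) (hc₂ : c₂ ≤ k * (1 + 2 * (h₂ * d₂)))
    (hh : h = max h₁ h₂ + 1) (hd : d₁ + d₂ ≤ d) (hd' : 0 < d) :
    c₀ + (c₁ + c₂) ≤ k * (1 + 2 * (h * d)) := by
  obtain ⟨g, hg⟩ : ∃ g, g = max h₁ h₂ := ⟨_, rfl⟩
  have e₁ : h₁ * d₁ ≤ g * d₁ := Nat.mul_le_mul_right _ (by omega)
  have e₂ : h₂ * d₂ ≤ g * d₂ := Nat.mul_le_mul_right _ (by omega)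
  have e₃ : g * (d₁ + d₂) ≤ g * d := Nat.mul_le_mul_left _ hd
  rw [hh, ← hg]
  have e₄ : 3 + 2 * (h₁ * d₁) + 2 * (h₂ * d₂) ≤ 1 + 2 * ((g + 1) * d) := by
    rw [Nat.mul_add] at e₃
    rw [Nat.add_mul]
    omega
  have e₅ := Nat.mul_le_mul_left k e₄
  calc _ ≤ k + (k * (1 + 2 * (h₁ * d₁)) + k * (1 + 2 * (h₂ * d₂))) := by omega
    _ = k * (3 + 2 * (h₁ * d₁) + 2 * (h₂ * d₂)) := by ring
    _ ≤ _ := e₅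

namespace Spans

theorem pairwise_leaves {T : SegTree K} {l r : Key K} (h : Spans T l r) :
    T.leaves.Pairwise fun i j => i.2 ≤ j.1 := by
  induction h with
  | leaf h => simp [leaves]
  | node h₁ h₂ ih₁ ih₂ =>
    rw [leaves, List.pairwise_append]
    exact ⟨ih₁, ih₂, fun i hi j hj =>
      (h₁.of_mem_leaves i hi).2.2.trans (h₂.of_mem_leaves j hj).1⟩

/-- An update recurses only where the range is neither contained nor apart, which forces `s` or `t`
strictly inside it. The constant is one step plus 7 for each of the two range tests. -/
theorem update_cost_le {T : SegTree K} {l r : Key K} (h : Spans T l r) (ins : Bool) (s t : Key K)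
    (A : Multiset (Key K × Key K)) (D : Finset (Key K)) (hs : s ∈ D) (ht : t ∈ D) :
    (update ins s t (fill A T)).cost ≤
      15 * (1 + 2 * (T.height * (D.filter fun d => l < d ∧ d < r).card)) := by
  induction h generalizing A with
  | @leaf l r c h =>
    have := contained_cost_le s t l r
    simp only [fill, update, bind_cost, tick_cost, ite_cost, pure_cost]
    split_ifs <;> omega
  | @node l m r c f g L R h₁ h₂ ih₁ ih₂ =>
    have e₁ := contained_cost_le s t l r
    have e₂ := apart_cost_le s t l r
    simp only [fill, mk, update, bind_cost, tick_cost, ite_cost, pure_cost, contained_val,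
      apart_val, decide_eq_true_eq, add_zero]
    split_ifs with hc ha
    · omega
    · omega
    · rw [← add_assoc, ← add_assoc]
      refine recursive_cost_le (by omega) (ih₁ _) (ih₂ _) rfl
        (card_filter_add_card_filter_le D h₁.lt h₂.lt) ?_
      rw [Finset.card_pos]
      push Not at ha hc
      by_cases hsl : s ≤ l
      · exact ⟨t, by simp [ht, ha.1, hc hsl]⟩
      · exact ⟨s, by simp [hs, not_le.1 hsl, ha.2]⟩

/-- If the status of the leaves changes only at keys in `D`, then a subtree without such a key in
its interior is completely covered or completely uncovered. -/
theorem uniform {T : SegTree K} {l r : Key K} (h : Spans T l r) {s t : Key K}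
    {A : Multiset (Key K × Key K)} {D : Finset (Key K)} (hs : s ≤ l) (ht : r ≤ t)
    (hD : ∀ i ∈ T.leaves, ∀ j ∈ T.leaves, i.2 = j.1 → s ≤ i.1 → j.2 ≤ t →
      (Covered A i.1 i.2 ↔ Covered A j.1 j.2) ∨ i.2 ∈ D)
    (hno : ∀ d ∈ D, ¬(l < d ∧ d < r)) :
    (∀ i ∈ T.leaves, Covered A i.1 i.2) ∨ (∀ i ∈ T.leaves, ¬Covered A i.1 i.2) := by
  induction h with
  | leaf h => simp [leaves, em]
  | @node l m r c f g L R h₁ h₂ ih₁ ih₂ =>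
    have hL : ∀ i ∈ L.leaves, i ∈ L.leaves ++ R.leaves := fun i hi =>
      List.mem_append_left _ hi
    have hR : ∀ i ∈ R.leaves, i ∈ L.leaves ++ R.leaves := fun i hi =>
      List.mem_append_right _ hi
    have u₁ := ih₁ hs (h₂.lt.le.trans ht)
      (fun i hi j hj => hD i (hL i hi) j (hL j hj))
      (fun d hd hd' => hno d hd ⟨hd'.1, hd'.2.trans h₂.lt⟩)
    have u₂ := ih₂ (hs.trans h₁.lt.le) ht
      (fun i hi j hj => hD i (hR i hi) j (hR j hj))
      (fun d hd hd' => hno d hd ⟨h₁.lt.trans hd'.1, hd'.2⟩)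
    obtain ⟨i, hi⟩ := h₁.exists_last
    obtain ⟨j, hj⟩ := h₂.exists_first
    -- The last leaf on the left and the first one on the right meet at `m`, which is not a break
    -- key. They transfer the common status of one half to the other.
    have key : Covered A i m ↔ Covered A m j :=
      (hD _ (hL _ hi) _ (hR _ hj) rfl (hs.trans (h₁.of_mem_leaves _ hi).1)
        ((h₂.of_mem_leaves _ hj).2.2.trans ht)).resolve_right
          fun hm => hno m hm ⟨h₁.lt, h₂.lt⟩
    simp only [leaves, List.mem_append, or_imp, forall_and]
    rcases u₁ with u₁ | u₁ <;> rcases u₂ with u₂ | u₂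
    · exact Or.inl ⟨u₁, u₂⟩
    · exact absurd (key.1 (u₁ _ hi)) (u₂ _ hj)
    · exact absurd (key.2 (u₂ _ hj)) (u₁ _ hi)
    · exact Or.inr ⟨u₁, u₂⟩

/-- The search descends only through nodes with a break key strictly inside; at all others one of
the tests stops it. The constant is 1 for the call, 7 for each range test and 4 for a push. -/
theorem query_cost_le {T : SegTree K} {l r : Key K} (h : Spans T l r) {s t : Key K}
    {A : Multiset (Key K × Key K)} {D : Finset (Key K)} (hs : s ∈ D) (ht : t ∈ D)
    (hD : ∀ i ∈ T.leaves, ∀ j ∈ T.leaves, i.2 = j.1 → s ≤ i.1 → j.2 ≤ t →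
      (Covered A i.1 i.2 ↔ Covered A j.1 j.2) ∨ i.2 ∈ D)
    (acc : List (Key K × Key K)) :
    (query s t (fill A T) acc).cost ≤
      19 * (1 + 2 * (T.height * (D.filter fun d => l < d ∧ d < r).card)) := by
  induction h generalizing acc with
  | @leaf l r c h =>
    have := contained_cost_le s t l r
    have := push_cost_le l r acc
    simp only [fill, query, bind_cost, tick_cost, ite_cost, pure_cost]
    split_ifs <;> omega
  | @node l m r c f g L R h₁ h₂ ih₁ ih₂ =>
    have hsp := Spans.node (c := c) (f := f) (g := g) h₁ h₂
    have e₁ := contained_cost_le s t l r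
    have e₂ := apart_cost_le s t l r
    have e₃ := push_cost_le l r acc
    have hfull := hsp.isFull_fill A
    have hfree := hsp.isFree_fill A
    by_cases hfu : ∀ i ∈ (SegTree.node l r c f g L R).leaves, Covered A i.1 i.2
    · rw [← hfull] at hfu
      simp only [fill, mk, isFull_node] at hfu
      simp only [query, fill, mk, bind_cost, hfu, if_true, pure_cost, tick_cost]
      omega
    have hnc : (A.filter fun i => ¬(i.1 ≤ l ∧ r ≤ i.2)) = A := by
      rw [Multiset.filter_eq_self]
      intro i hi h'
      refine hfu fun j hj => ?_
      obtain ⟨h₅, -, h₆⟩ := hsp.of_mem_leaves j hj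
      exact ⟨i, hi, h'.1.trans h₅, h₆.trans h'.2⟩
    have hfu' := hfu
    rw [← hfull, Bool.not_eq_true] at hfu
    simp only [fill, mk, isFull_node] at hfu
    simp only [query, fill, mk, bind_cost, tick_cost, ite_cost, hfu, if_false, pure_cost,
      Bool.false_eq_true, apart_val, decide_eq_true_eq, contained_val]
    split_ifs with ha hb
    · omega
    · omega
    · rw [hnc]
      have hL : ∀ i ∈ L.leaves, i ∈ L.leaves ++ R.leaves := fun i hi =>
        List.mem_append_left _ hi
      have hR : ∀ i ∈ R.leaves, i ∈ L.leaves ++ R.leaves := fun i hi =>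
        List.mem_append_right _ hi
      rw [← add_assoc, ← add_assoc]
      refine recursive_cost_le (by omega)
        (ih₁ (fun i hi j hj => hD i (hL i hi) j (hL j hj)) _)
        (ih₂ (fun i hi j hj => hD i (hR i hi) j (hR j hj)) _) rfl
        (card_filter_add_card_filter_le D h₁.lt h₂.lt) ?_
      rw [Finset.card_pos]
      push Not at ha
      by_contra hne
      -- Without a break key inside, `s` and `t` are not inside either, so the range is contained.
      -- By `uniform` it is then full or free, and the search would have stopped here.
      have hno : ∀ d ∈ D, ¬(l < d ∧ d < r) := fun d hd hd' =>
        hne ⟨d, by simp [hd, hd'.1, hd'.2]⟩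
      have hsl : s ≤ l := not_lt.1 fun h => hno s hs ⟨h, ha.2⟩
      have htr : r ≤ t := not_lt.1 fun h => hno t ht ⟨ha.1, h⟩
      have huf := (hsp.uniform hsl htr hD hno).resolve_left hfu'
      rw [← hfree] at huf
      simp only [fill, mk, isFree_node] at huf
      rw [huf] at hb
      simp [hsl, htr] at hb

end Spans

/-! ### Building the tree -/

/-- The successive pairs of a list starting with `k`. -/
def pairs {K : Type} (k : Key K) : List (Key K) → List (Key K × Key K)
  | [] => []
  | a :: as => (k, a) :: pairs a as

/-- The last entry of a list starting with `k`. -/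
def lastKey {K : Type} (k : Key K) (as : List (Key K)) : Key K := as.foldl (fun _ a => a) k

theorem pairs_append {K : Type} (k : Key K) (as bs : List (Key K)) :
    pairs k (as ++ bs) = pairs k as ++ pairs (lastKey k as) bs := by
  induction as generalizing k with
  | nil => rfl
  | cons a as ih => simp [pairs, ih, lastKey]

theorem lastKey_append {K : Type} (k : Key K) (as bs : List (Key K)) :
    lastKey k (as ++ bs) = lastKey (lastKey k as) bs := by
  simp [lastKey]

theorem lastKey_mem {K : Type} (k : Key K) (as : List (Key K)) : lastKey k as ∈ k :: as := by
  induction as generalizing k with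
  | nil => simp [lastKey]
  | cons a as ih => exact List.mem_cons_of_mem _ (ih a)

/-- The induction must follow the unused keys `rest` and the last used key, because the right half
starts where the left half ended. The cost bound counts the `2 * m - 1` nodes of a binary tree with
`m` leaves. -/
theorem build_spec (m : ℕ) (hm : 1 ≤ m) (k : Key K) (as rest : List (Key K)) (hl : as.length = m)
    (hk : (k :: as).Pairwise (· < ·)) :
    (build m k (as ++ rest)).val.1.leaves = pairs k as ∧
      Spans (build m k (as ++ rest)).val.1 k (lastKey k as) ∧
      (build m k (as ++ rest)).val.2 = (lastKey k as, rest) ∧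
      fill 0 (build m k (as ++ rest)).val.1 = (build m k (as ++ rest)).val.1 ∧
      (build m k (as ++ rest)).val.1.height ≤ Nat.clog 2 m ∧
      (build m k (as ++ rest)).cost + 1 ≤ 2 * m := by
  induction m using Nat.strong_induction_on generalizing k as rest with
  | _ m ih =>
  match m, as with
  | 1, [a] =>
    have hka : k < a := by simpa using hk
    simp only [List.cons_append, List.nil_append, build, bind_val, pure_val, bind_cost, pure_cost,
      tick_cost, leaves, pairs, fill, height, Multiset.countP_zero]
    exact ⟨trivial, .leaf hka, rfl, trivial, Nat.zero_le _, le_rfl⟩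
  | j + 2, a :: as' =>
    obtain ⟨as, has⟩ : ∃ as, as = a :: as' := ⟨_, rfl⟩
    rw [← has] at hl hk ⊢
    have l₁ : (as.take ((j + 2) / 2)).length = (j + 2) / 2 := by
      rw [List.length_take]; omega
    have l₂ : (as.drop ((j + 2) / 2)).length = (j + 2) - (j + 2) / 2 := by
      rw [List.length_drop]; omega
    have hsplit : as.take ((j + 2) / 2) ++ as.drop ((j + 2) / 2) = as := List.take_append_drop _ _
    generalize as.take ((j + 2) / 2) = as₁ at l₁ hsplit
    generalize as.drop ((j + 2) / 2) = as₂ at l₂ hsplit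
    have hk₁ : (k :: as₁).Pairwise (· < ·) := by
      refine hk.sublist ?_
      rw [← hsplit]
      exact (List.sublist_append_left _ _).cons_cons _
    have hk₂ : (lastKey k as₁ :: as₂).Pairwise (· < ·) := by
      rw [← hsplit, ← List.cons_append, List.pairwise_append] at hk
      rw [List.pairwise_cons]
      exact ⟨fun b hb => hk.2.2 _ (lastKey_mem _ _) _ hb, hk.2.1⟩
    obtain ⟨a₁, a₂, a₃, a₄, a₅, a₆⟩ := ih ((j + 2) / 2) (by omega) (by omega) k as₁
      (as₂ ++ rest) l₁ hk₁
    obtain ⟨b₁, b₂, b₃, b₄, b₅, b₆⟩ := ih ((j + 2) - (j + 2) / 2) (by omega) (by omega)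
      (lastKey k as₁) as₂ rest l₂ hk₂
    have hne : as ++ rest ≠ [] := by simp [has]
    have hb : build (j + 2) k (as ++ rest) = (do
        tick
        let (L, k₁, ks₁) ← build ((j + 2) / 2) k (as ++ rest)
        let (R, k₂, ks₂) ← build ((j + 2) - (j + 2) / 2) k₁ ks₁
        return (mk k k₂ 0 L R, k₂, ks₂)) := by
      rw [has, List.cons_append, build]
      simp
    obtain ⟨c₁, c₂⟩ := clog_two_halves j
    rw [hb, ← hsplit, List.append_assoc]
    simp only [bind_val, bind_cost, pure_val, pure_cost, tick_cost, a₃, b₃, leaves, a₁, b₁, mk,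
      pairs_append, lastKey_append, height, fill, a₄, b₄, Multiset.countP_zero,
      Multiset.filter_zero]
    exact ⟨trivial, .node a₂ b₂, trivial, by simp, by omega, by omega⟩

end SegTree

/-! ### Elementary intervals and the skeleton of a sweep's tree -/

namespace SegTree

variable {K : Type} [LinearOrder K]

/-- The range is a point of `C` or an open interval between two adjacent points of `C`. -/
def Elementary (C : List K) (i : Key K × Key K) : Prop :=
  (∃ c ∈ C, i = (⟨c, false⟩, ⟨c, true⟩)) ∨
    ∃ c ∈ C, ∃ c' ∈ C, c < c' ∧ (∀ d ∈ C, d ≤ c ∨ c' ≤ d) ∧ i = (⟨c, true⟩, ⟨c', false⟩)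

/-- The point `y` belongs to the elementary interval. -/
def Locates (y : K) (i : Key K × Key K) : Prop :=
  i = (⟨y, false⟩, ⟨y, true⟩) ∨ ∃ c c', c < y ∧ y < c' ∧ i = (⟨c, true⟩, ⟨c', false⟩)

theorem keys_spec (C : List K) (c : K) (h : (c :: C).Pairwise (· ≤ ·)) :
    ∃ ks, (Sweep.keys (c :: C)).val = ⟨c, false⟩ :: ⟨c, true⟩ :: ks ∧
      (Sweep.keys (c :: C)).val.Pairwise (· < ·) ∧
      (∀ k ∈ ks, c < k.coord) ∧
      (∀ i ∈ pairs ⟨c, false⟩ (⟨c, true⟩ :: ks), Elementary (c :: C) i) ∧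
      (∀ y, c ≤ y → (∃ d ∈ c :: C, y ≤ d) →
        ∃ i ∈ pairs ⟨c, false⟩ (⟨c, true⟩ :: ks), Locates y i) ∧
      (Sweep.keys (c :: C)).val.length ≤ 2 * (C.length + 1) ∧
      (Sweep.keys (c :: C)).cost ≤ 2 * (C.length + 1) := by
  induction C generalizing c with
  | nil =>
    refine ⟨[], ?_⟩
    simp [Sweep.keys, pairs, Elementary, Locates, Key.lt_def]
    intro y h₁ h₂
    exact le_antisymm h₁ h₂
  | cons d C ih =>
    rw [List.pairwise_cons] at h
    obtain ⟨h, hd⟩ := h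
    obtain ⟨ks, h₁, h₂, h₃, h₄, h₅, h₆, h₇⟩ := ih d hd
    have hcd : c ≤ d := h d (by simp)
    rcases hcd.eq_or_lt with rfl | hcd
    · refine ⟨ks, ?_, ?_, h₃, ?_, ?_, ?_, ?_⟩
      · simpa [Sweep.keys] using h₁
      · simpa [Sweep.keys] using h₂
      · intro i hi
        rcases h₄ i hi with ⟨a, ha, rfl⟩ | ⟨a, ha, b, hb, hab, hn, rfl⟩
        · exact Or.inl ⟨a, List.mem_cons_of_mem _ ha, rfl⟩
        · refine Or.inr ⟨a, List.mem_cons_of_mem _ ha, b, List.mem_cons_of_mem _ hb, hab, ?_, rfl⟩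
          intro x hx
          rcases List.mem_cons.1 hx with rfl | hx
          · exact hn _ (by simp)
          · exact hn x hx
      · rintro y hy ⟨x, hx, hyx⟩
        refine h₅ y hy ⟨x, ?_, hyx⟩
        rcases List.mem_cons.1 hx with rfl | hx
        · simp
        · exact hx
      · simp only [Sweep.keys, bind_val, pure_val, lt_val, lt_irrefl, decide_false,
          Bool.false_eq_true, if_false, List.length_cons] at h₆ ⊢
        omega
      · simp only [Sweep.keys, bind_cost, pure_cost, lt_cost, tick_cost, lt_val,
          lt_irrefl, decide_false, Bool.false_eq_true, if_false, List.length_cons] at h₇ ⊢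
        omega
    · have hv : (Sweep.keys (c :: d :: C)).val =
          ⟨c, false⟩ :: ⟨c, true⟩ :: ⟨d, false⟩ :: ⟨d, true⟩ :: ks := by
        simp [Sweep.keys, hcd, h₁]
      have hk : ∀ k ∈ (⟨d, false⟩ :: ⟨d, true⟩ :: ks : List (Key K)), c < k.coord := by
        intro k hk
        simp only [List.mem_cons] at hk
        rcases hk with rfl | rfl | hk
        · exact hcd
        · exact hcd
        · exact hcd.trans (h₃ k hk)
      refine ⟨_, hv, ?_, hk, ?_, ?_, ?_, ?_⟩
      · rw [hv, List.pairwise_cons, List.pairwise_cons, ← h₁]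
        refine ⟨?_, ?_, h₂⟩
        · intro k hk'
          rw [h₁] at hk'
          rcases List.mem_cons.1 hk' with rfl | hk'
          · simp [Key.lt_def]
          · exact (Key.lt_def _ _).2 (Or.inl (hk k hk'))
        · intro k hk'
          rw [h₁] at hk'
          exact (Key.lt_def _ _).2 (Or.inl (hk k hk'))
      · intro i hi
        simp only [pairs, List.mem_cons] at hi h₄
        rcases hi with rfl | rfl | hi
        · exact Or.inl ⟨c, by simp, rfl⟩
        · refine Or.inr ⟨c, by simp, d, by simp, hcd, ?_, rfl⟩
          intro x hx
          rcases List.mem_cons.1 hx with rfl | hx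
          · exact Or.inl le_rfl
          · rcases List.mem_cons.1 hx with rfl | hx
            · exact Or.inr le_rfl
            · exact Or.inr ((List.pairwise_cons.1 hd).1 x hx)
        · rcases h₄ i hi with ⟨a, ha, rfl⟩ | ⟨a, ha, b, hb, hab, hn, rfl⟩
          · exact Or.inl ⟨a, List.mem_cons_of_mem _ ha, rfl⟩
          · refine Or.inr ⟨a, List.mem_cons_of_mem _ ha, b, List.mem_cons_of_mem _ hb, hab, ?_, rfl⟩
            intro x hx
            rcases List.mem_cons.1 hx with rfl | hx
            · exact Or.inl (h a ha)
            · exact hn x hx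
      · rintro y hy ⟨x, hx, hyx⟩
        rcases hy.eq_or_lt with rfl | hy
        · exact ⟨_, by simp [pairs], Or.inl rfl⟩
        rcases lt_or_ge y d with hyd | hyd
        · exact ⟨(⟨c, true⟩, ⟨d, false⟩), by simp [pairs], Or.inr ⟨c, d, hy, hyd, rfl⟩⟩
        · have hx' : x ∈ d :: C := by
            rcases List.mem_cons.1 hx with rfl | hx
            · exact absurd (hy.trans_le hyx) (lt_irrefl _)
            · exact hx
          obtain ⟨i, hi, hi'⟩ := h₅ y hyd ⟨x, hx', hyx⟩
          exact ⟨i, List.mem_cons_of_mem _ (List.mem_cons_of_mem _ hi), hi'⟩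
      · rw [hv]
        rw [h₁] at h₆
        simp only [List.length_cons] at h₆ ⊢
        omega
      · simp only [Sweep.keys, bind_cost, ite_cost, pure_cost, lt_cost, tick_cost,
          List.length_cons] at h₇ ⊢
        split_ifs <;> omega

/-- A tree without stored intervals whose leaves are the elementary intervals of the coordinates
`C` between `lo` and `hi`. -/
structure IsTreeOver (T : SegTree K) (C : List K) (lo hi : K) : Prop where
  spans : T = empty ∨ ∃ l r, Spans T l r
  fill_zero : fill 0 T = T
  elementary : ∀ i ∈ T.leaves, Elementary C i
  locates : ∀ y, lo ≤ y → y ≤ hi → ∃ i ∈ T.leaves, Locates y i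
  within : ∀ c ∈ C, lo ≤ c ∧ c ≤ hi

/-- Containing `lo` and `hi` makes the leaves exhaust the range between them. A chip too small for
the new module is included: then `lo ≤ hi` fails, there are no coordinates, and the tree is empty.
-/
theorem ofKeys_spec {C : List K} {lo hi : K} (hC : C.Pairwise (· ≤ ·))
    (hw : ∀ c ∈ C, lo ≤ c ∧ c ≤ hi) (hlo : lo ≤ hi → lo ∈ C) (hhi : lo ≤ hi → hi ∈ C) :
    IsTreeOver (ofKeys (Sweep.keys C).val).val C lo hi ∧
      (ofKeys (Sweep.keys C).val).val.height ≤ Nat.clog 2 (2 * C.length) ∧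
      (Sweep.keys C).cost + (ofKeys (Sweep.keys C).val).cost ≤ 8 * C.length + 2 := by
  match C with
  | [] =>
    have : ¬ lo ≤ hi := fun h => by simpa using hlo h
    simp only [Sweep.keys, bind_val, pure_val, ofKeys, height, bind_cost, tick_cost, pure_cost]
    exact ⟨⟨Or.inl rfl, rfl, by simp [leaves], fun y h₁ h₂ => absurd (h₁.trans h₂) this, by simp⟩,
      Nat.zero_le _, by omega⟩
  | c :: C =>
    obtain ⟨ks, h₁, h₂, h₃, h₄, h₅, h₆, h₇⟩ := keys_spec C c hC
    rw [h₁] at h₂ h₆ ⊢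
    obtain ⟨b₁, b₂, b₃, b₄, b₅, b₆⟩ := build_spec (ks.length + 1) (by omega) ⟨c, false⟩
      (⟨c, true⟩ :: ks) [] rfl h₂
    rw [List.append_nil] at b₁ b₂ b₃ b₄ b₅ b₆
    simp only [List.length_cons] at h₆ ⊢
    simp only [ofKeys, bind_val, length_val, pure_val, bind_cost, length_cost, tick_cost, pure_cost,
      List.length_cons]
    refine ⟨⟨Or.inr ⟨_, _, b₂⟩, b₄, ?_, ?_, hw⟩, b₅.trans (Nat.clog_mono_right 2 (by omega)), by omega⟩
    · rw [b₁]
      exact h₄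
    · intro y hy₁ hy₂
      rw [b₁]
      refine h₅ y ?_ ⟨hi, hhi (hy₁.trans hy₂), hy₂⟩
      refine le_trans ?_ hy₁
      rcases List.mem_cons.1 (hlo (hy₁.trans hy₂)) with h | h
      · exact h.ge
      · exact (List.pairwise_cons.1 hC).1 _ h

/-! ### Retrieval -/

/-- The point `y` belongs to the closure of one of the pieces. -/
def InPieces (y : K) (ps : List (Key K × Key K)) : Prop :=
  ∃ i ∈ ps, i.1.coord ≤ y ∧ y ≤ i.2.coord

theorem push_spec {l r : Key K} (hlr : l ≤ r) {acc : List (Key K × Key K)}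
    (hacc : ∀ i ∈ acc, i.1 ≤ i.2 ∧ i.2 ≤ l) :
    (∀ i ∈ (push l r acc).val, i.1 ≤ i.2 ∧ i.2 ≤ r) ∧
      ∀ y, InPieces y (push l r acc).val ↔ InPieces y acc ∨ l.coord ≤ y ∧ y ≤ r.coord := by
  rcases acc with _ | ⟨⟨a, b⟩, acc⟩
  · simp [push, InPieces, hlr]
  · simp only [List.mem_cons, forall_eq_or_imp] at hacc
    obtain ⟨⟨hab, hbl⟩, hacc⟩ := hacc
    by_cases hlb : l ≤ b
    -- Pieces arrive in increasing order, so the test for joining can succeed only with equality.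
    · obtain rfl : l = b := le_antisymm hlb hbl
      simp only [push, bind_val, Key.le_val, le_refl, decide_true, if_true, pure_val,
        List.mem_cons, forall_eq_or_imp]
      refine ⟨⟨⟨hab.trans hlr, trivial⟩, fun i hi => ⟨(hacc i hi).1, (hacc i hi).2.trans hlr⟩⟩, ?_⟩
      intro y
      simp only [InPieces, List.mem_cons, exists_eq_or_imp]
      have h₁ := Key.coord_le hab
      have h₂ := Key.coord_le hlr
      constructor
      · rintro (⟨h₃, h₄⟩ | h)
        · rcases le_total y l.coord with h | h
          · exact Or.inl (Or.inl ⟨h₃, h⟩)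
          · exact Or.inr ⟨h, h₄⟩
        · exact Or.inl (Or.inr h)
      · rintro ((h | h) | h)
        · exact Or.inl ⟨h.1, h.2.trans h₂⟩
        · exact Or.inr h
        · exact Or.inl ⟨h₁.trans h.1, h.2⟩
    · simp only [push, bind_val, Key.le_val, hlb, decide_false, Bool.false_eq_true, if_false,
        pure_val, List.mem_cons, forall_eq_or_imp]
      refine ⟨⟨⟨hlr, le_rfl⟩, ⟨hab, hbl.trans hlr⟩,
        fun i hi => ⟨(hacc i hi).1, (hacc i hi).2.trans hlr⟩⟩, ?_⟩
      intro y
      simp only [InPieces, List.mem_cons, exists_eq_or_imp]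
      exact or_comm

theorem foldl_push_spec {ls : List (Key K × Key K)} (hls : ls.Pairwise fun i j => i.2 ≤ j.1)
    (hle : ∀ i ∈ ls, i.1 ≤ i.2) {acc : List (Key K × Key K)}
    (hacc : ∀ i ∈ acc, i.1 ≤ i.2 ∧ ∀ j ∈ ls, i.2 ≤ j.1) :
    (∀ i ∈ ls.foldl (fun a i => (push i.1 i.2 a).val) acc, i.1 ≤ i.2) ∧
      ∀ y, InPieces y (ls.foldl (fun a i => (push i.1 i.2 a).val) acc) ↔
        InPieces y acc ∨ InPieces y ls := by
  induction ls generalizing acc with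
  | nil => exact ⟨fun i hi => (hacc i hi).1, by simp [InPieces]⟩
  | cons j ls ih =>
    rw [List.pairwise_cons] at hls
    obtain ⟨h₁, h₂⟩ := push_spec (hle j (by simp))
      (acc := acc) (fun i hi => ⟨(hacc i hi).1, (hacc i hi).2 j (by simp)⟩)
    obtain ⟨h₃, h₄⟩ := ih hls.2 (fun i hi => hle i (List.mem_cons_of_mem _ hi))
      (acc := (push j.1 j.2 acc).val)
      (fun i hi => ⟨(h₁ i hi).1, fun k hk => (h₁ i hi).2.trans (hls.1 k hk)⟩)
    refine ⟨h₃, fun y => ?_⟩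
    rw [List.foldl_cons, h₄, h₂, or_assoc]
    simp only [InPieces, List.mem_cons, exists_eq_or_imp]

/-- The transversal extents of boxes as open intervals of keys. -/
def stored (S : Finset (Box K)) : Multiset (Key K × Key K) :=
  S.val.map fun B => (⟨B.b, true⟩, ⟨B.e, false⟩)

theorem covered_point {S : Finset (Box K)} (c : K) :
    Covered (stored S) ⟨c, false⟩ ⟨c, true⟩ ↔ ∃ B ∈ S, B.b < c ∧ c < B.e := by
  simp [Covered, stored]

theorem covered_gap {S : Finset (Box K)} (c c' : K) :
    Covered (stored S) ⟨c, true⟩ ⟨c', false⟩ ↔ ∃ B ∈ S, B.b ≤ c ∧ c' ≤ B.e := by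
  simp [Covered, stored]

/-- No coordinate of the box lies strictly between two adjacent points of `C`. -/
def Fits (C : List K) (lo hi : K) (B : Box K) : Prop :=
  (B.b ∈ C ∨ B.b < lo ∨ hi < B.b) ∧ (B.e ∈ C ∨ B.e < lo ∨ hi < B.e)

namespace IsTreeOver

variable {T : SegTree K} {C : List K} {lo hi : K}

theorem le_or_le (h : IsTreeOver T C lo hi) {c c' x : K} (hc : c ∈ C) (hc' : c' ∈ C)
    (hn : ∀ d ∈ C, d ≤ c ∨ c' ≤ d) (hx : x ∈ C ∨ x < lo ∨ hi < x) : x ≤ c ∨ c' ≤ x := by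
  rcases hx with hx | hx | hx
  · exact hn x hx
  · exact Or.inl (hx.le.trans (h.within c hc).1)
  · exact Or.inr ((h.within c' hc').2.trans hx.le)

/-- An uncovered gap is reported with its two end points. This is right: a box covering an end point
in its interior has no end inside the gap, so it would cover the gap as well. Conversely a point
located in a gap is uncovered only if the whole gap is. -/
theorem query_spec (h : IsTreeOver T C lo hi) {X : Box K} (hX : Fits C lo hi X)
    {S : Finset (Box K)} (hS : ∀ B ∈ S, Fits C lo hi B) :
    (∀ i ∈ (query ⟨X.b, false⟩ ⟨X.e, true⟩ (fill (stored S) T) []).val,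
      i.1.coord ≤ i.2.coord) ∧
    ∀ y, InPieces y (query ⟨X.b, false⟩ ⟨X.e, true⟩ (fill (stored S) T) []).val ↔
      (lo ≤ y ∧ y ≤ hi) ∧ (X.b ≤ y ∧ y ≤ X.e) ∧ ∀ B ∈ S, ¬(B.b < y ∧ y < B.e) := by
  classical
  rcases h.spans with rfl | ⟨l, r, hsp⟩
  · simp only [fill, query, bind_val, pure_val, InPieces, List.not_mem_nil, false_and,
      exists_false, false_iff, not_and, false_implies, implies_true, true_and]
    intro y hy
    obtain ⟨i, hi, -⟩ := h.locates y hy.1 hy.2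
    simp [leaves] at hi
  · rw [hsp.query_val]
    obtain ⟨h₁, h₂⟩ := foldl_push_spec (ls := T.leaves.filter fun i =>
        ((⟨X.b, false⟩ : Key K) ≤ i.1 ∧ i.2 ≤ ⟨X.e, true⟩) ∧ ¬Covered (stored S) i.1 i.2)
      (hsp.pairwise_leaves.sublist List.filter_sublist)
      (fun i hi => (hsp.of_mem_leaves i (List.mem_filter.1 hi).1).2.1.le) (acc := []) (by simp)
    refine ⟨fun i hi => Key.coord_le (h₁ i hi), fun y => ?_⟩
    rw [h₂]
    simp only [InPieces, List.not_mem_nil, false_and, exists_false, false_or, List.mem_filter,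
      decide_eq_true_eq]
    constructor
    · rintro ⟨i, ⟨hi, ⟨hi₁, hi₂⟩, hi₃⟩, hy₁, hy₂⟩
      rcases h.elementary i hi with ⟨c, hc, rfl⟩ | ⟨c, hc, c', hc', hcc, hn, rfl⟩
      · obtain rfl : c = y := le_antisymm hy₁ hy₂
        rw [covered_point] at hi₃
        push Not at hi₃
        simp only [Key.false_le_false, Key.true_le_true] at hi₁ hi₂
        exact ⟨h.within c hc, ⟨hi₁, hi₂⟩, fun B hB hB' => absurd hB'.2 (not_lt.2 (hi₃ B hB hB'.1))⟩
      · rw [covered_gap] at hi₃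
        push Not at hi₃
        simp only [Key.false_le_true] at hi₁ hi₂ hy₁ hy₂
        refine ⟨⟨(h.within c hc).1.trans hy₁, hy₂.trans (h.within c' hc').2⟩,
          ⟨hi₁.trans hy₁, hy₂.trans hi₂⟩, fun B hB hB' => ?_⟩
        have e₁ := (h.le_or_le hc hc' hn (hS B hB).1).resolve_right
          (not_le.2 (hB'.1.trans_le hy₂))
        have e₂ := (h.le_or_le hc hc' hn (hS B hB).2).resolve_left
          (not_le.2 (hy₁.trans_lt hB'.2))
        exact absurd (hi₃ B hB e₁) (not_lt.2 e₂)
    · rintro ⟨hy, ⟨hy₁, hy₂⟩, hu⟩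
      obtain ⟨i, hi, hyi⟩ := h.locates y hy.1 hy.2
      rcases hyi with rfl | ⟨c, c', hc, hc', rfl⟩
      · refine ⟨_, ⟨hi, by simp [hy₁, hy₂], ?_⟩, le_rfl, le_rfl⟩
        rw [covered_point]
        rintro ⟨B, hB, hB'⟩
        exact hu B hB hB'
      · rcases h.elementary _ hi with ⟨d, -, hd⟩ | ⟨d, hd, d', hd', -, hn, he⟩
        · simp at hd
        simp only [Prod.mk.injEq, Key.mk.injEq, and_true] at he
        obtain ⟨rfl, rfl⟩ := he
        have e₁ := (h.le_or_le hd hd' hn hX.1).resolve_right (not_le.2 (hy₁.trans_lt hc'))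
        have e₂ := (h.le_or_le hd hd' hn hX.2).resolve_left (not_le.2 (hc.trans_le hy₂))
        refine ⟨_, ⟨hi, by simp [e₁, e₂], ?_⟩, hc.le, hc'.le⟩
        rw [covered_gap]
        rintro ⟨B, hB, hB₁, hB₂⟩
        exact hu B hB ⟨hB₁.trans_lt hc, hc'.trans_le hB₂⟩

/-- Neighboring leaves are a point and an adjacent gap, and coverage of the point extends to the
gap. So the status changes only where a covered gap meets an uncovered point, which is then an end
of the covering box lying in the interior of no stored box. -/
theorem query_cost_le (h : IsTreeOver T C lo hi) (X : Box K) {S : Finset (Box K)}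
    (hS : ∀ B ∈ S, Fits C lo hi B) {D : Finset (Key K)} (hb : (⟨X.b, false⟩ : Key K) ∈ D)
    (he : (⟨X.e, true⟩ : Key K) ∈ D)
    (hDe : ∀ B ∈ S, X.b ≤ B.e → B.e ≤ X.e → (∀ B' ∈ S, ¬(B'.b < B.e ∧ B.e < B'.e)) →
      (⟨B.e, false⟩ : Key K) ∈ D)
    (hDb : ∀ B ∈ S, X.b ≤ B.b → B.b ≤ X.e → (∀ B' ∈ S, ¬(B'.b < B.b ∧ B.b < B'.e)) →
      (⟨B.b, true⟩ : Key K) ∈ D) :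
    (query ⟨X.b, false⟩ ⟨X.e, true⟩ (fill (stored S) T) []).cost ≤
      19 * (1 + 2 * (T.height * D.card)) := by
  classical
  rcases h.spans with rfl | ⟨l, r, hsp⟩
  · simp [fill, query, height]
  refine (hsp.query_cost_le hb he ?_ []).trans ?_
  · intro i hi j hj hij hsi hjt
    rcases h.elementary i hi with ⟨c, hc, rfl⟩ | ⟨c, hc, c', hc', hcc, hn, rfl⟩ <;>
    rcases h.elementary j hj with ⟨d, hd, rfl⟩ | ⟨d, hd, d', hd', hdd, hm, rfl⟩
    · simp at hij
    · simp only [Key.mk.injEq, and_true] at hij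
      subst hij
      rw [covered_point, covered_gap]
      by_cases hcov : ∃ B ∈ S, B.b < c ∧ c < B.e
      · left
        refine ⟨fun _ => ?_, fun _ => hcov⟩
        obtain ⟨B, hB, hB₁, hB₂⟩ := hcov
        exact ⟨B, hB, hB₁.le, (h.le_or_le hd hd' hm (hS B hB).2).resolve_left (not_le.2 hB₂)⟩
      · by_cases hcov' : ∃ B ∈ S, B.b ≤ c ∧ d' ≤ B.e
        · right
          obtain ⟨B, hB, hB₁, hB₂⟩ := hcov'
          obtain rfl : B.b = c :=
            hB₁.eq_of_not_lt fun hlt => hcov ⟨B, hB, hlt, hdd.trans_le hB₂⟩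
          simp only [Key.false_le_false, Key.false_le_true] at hsi hjt
          exact hDb B hB hsi (hdd.le.trans hjt) fun B' hB' h' => hcov ⟨B', hB', h'⟩
        · exact Or.inl ⟨fun h' => absurd h' hcov, fun h' => absurd h' hcov'⟩
    · simp only [Key.mk.injEq, and_true] at hij
      subst hij
      rw [covered_point, covered_gap]
      by_cases hcov : ∃ B ∈ S, B.b < c' ∧ c' < B.e
      · left
        refine ⟨fun _ => hcov, fun _ => ?_⟩
        obtain ⟨B, hB, hB₁, hB₂⟩ := hcov
        exact ⟨B, hB, (h.le_or_le hc hc' hn (hS B hB).1).resolve_right (not_le.2 hB₁), hB₂.le⟩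
      · by_cases hcov' : ∃ B ∈ S, B.b ≤ c ∧ c' ≤ B.e
        · right
          obtain ⟨B, hB, hB₁, hB₂⟩ := hcov'
          obtain rfl : c' = B.e :=
            hB₂.eq_of_not_lt fun hlt => hcov ⟨B, hB, hB₁.trans_lt hcc, hlt⟩
          simp only [Key.false_le_true, Key.true_le_true] at hsi hjt
          exact hDe B hB (hsi.trans hcc.le) hjt fun B' hB' h' => hcov ⟨B', hB', h'⟩
        · exact Or.inl ⟨fun h' => absurd h' hcov', fun h' => absurd h' hcov⟩
    · simp at hij
  · gcongr
    exact Finset.filter_subset _ _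

theorem update_cost_le (h : IsTreeOver T C lo hi) (ins : Bool) (s t : Key K)
    (A : Multiset (Key K × Key K)) :
    (update ins s t (fill A T)).cost ≤ 15 * (1 + 2 * (T.height * 2)) := by
  classical
  rcases h.spans with rfl | ⟨l, r, hsp⟩
  · simp only [fill, update, bind_cost, tick_cost, pure_cost]
    omega
  refine (hsp.update_cost_le ins s t A {s, t} (by simp) (by simp)).trans ?_
  gcongr
  exact (Finset.card_filter_le _ _).trans Finset.card_le_two

theorem update_insert [DecidableEq (Box K)] (h : IsTreeOver T C lo hi) {S : Finset (Box K)}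
    {X : Box K} (hX : X ∉ S) :
    (update true ⟨X.b, true⟩ ⟨X.e, false⟩ (fill (stored S) T)).val =
      fill (stored (insert X S)) T := by
  have : stored (insert X S) = (⟨X.b, true⟩, ⟨X.e, false⟩) ::ₘ stored S := by
    simp [stored, Finset.insert_val_of_notMem hX]
  rw [this]
  rcases h.spans with rfl | ⟨l, r, hsp⟩
  · rfl
  · exact hsp.update_insert _ _ _

theorem update_delete [DecidableEq (Box K)] (h : IsTreeOver T C lo hi) {S : Finset (Box K)}
    {X : Box K} (hX : X ∈ S) :
    (update false ⟨X.b, true⟩ ⟨X.e, false⟩ (fill (stored S) T)).val =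
      fill (stored (S.erase X)) T := by
  have : stored S = (⟨X.b, true⟩, ⟨X.e, false⟩) ::ₘ stored (S.erase X) := by
    conv_lhs => rw [← Finset.insert_erase hX]
    simp [stored, Finset.insert_val_of_notMem (Finset.notMem_erase X S)]
  rw [this]
  rcases h.spans with rfl | ⟨l, r, hsp⟩
  · rfl
  · exact hsp.update_delete _ _ _

end IsTreeOver

end SegTree

/-! ### Order of events, active boxes and the event loop -/

/-- The sort key of an event. -/
def Event.sortKey {K : Type} (u : Event K) : K ×ₗ Bool ×ₗ K ×ₗ K :=
  toLex (u.pos, toLex (u.isOpen, toLex (u.b, u.e)))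

namespace Event

variable {K : Type} [LinearOrder K]

theorem le_val (u v : Event K) : (Event.le u v).val = true ↔ u.sortKey ≤ v.sortKey := by
  obtain ⟨p, o, b, e⟩ := u
  obtain ⟨p', o', b', e'⟩ := v
  simp only [Event.le, Event.sortKey, Prod.Lex.toLex_le_toLex, bind_val, ite_val, lt_val,
    pure_val, decide_eq_true_eq]
  rcases lt_trichotomy p p' with h | rfl | h
  · simp [h]
  · rcases lt_trichotomy b b' with h' | rfl | h'
    · cases o <;> cases o' <;> simp [h']
    · cases o <;> cases o' <;> simp
    · cases o <;> cases o' <;> simp [h'.not_gt, h'.ne', h']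
  · simp [h.not_gt, h.ne', h]

theorem le_cost_le (u v : Event K) : (Event.le u v).cost ≤ 6 := by
  simp only [Event.le, bind_cost, tick_cost, lt_cost, le_cost, ite_cost, pure_cost]
  split_ifs <;> omega

end Event

noncomputable instance Box.instDecidableEq {K : Type} : DecidableEq (Box K) := Classical.decEq _

namespace Sweep

variable {K : Type} [LinearOrder K]

/-- The opening event (`true`) or closing event (`false`) of a box. -/
def eventOf {K : Type} (g : Box K × Bool) : Event K :=
  if g.2 then ⟨g.1.p₁, true, g.1.b, g.1.e⟩ else ⟨g.1.p₂, false, g.1.b, g.1.e⟩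

/-- The boxes which are open when the sides of the box of event `g` are examined, if the events
occur in the order of the list `E`. -/
noncomputable def activeAt (S : Finset (Box K)) (E : List (Box K × Bool)) (g : Box K × Bool) :
    Finset (Box K) :=
  S.filter fun B => E.idxOf (B, true) < E.idxOf g ∧ E.idxOf g < E.idxOf (B, false)

/-- The list `E` contains the opening and the closing event of every box in `S`, ordered by position
with closing events before opening events. -/
structure IsTimeline (S : Finset (Box K)) (E : List (Box K × Bool)) : Prop where
  nodup : E.Nodup
  mem_iff : ∀ g, g ∈ E ↔ g.1 ∈ S
  sorted : E.Pairwise fun g g' => (eventOf g).pos < (eventOf g').pos ∨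
    (eventOf g).pos = (eventOf g').pos ∧ (g.2 = true → g'.2 = true)
  lt : ∀ B ∈ S, B.p₁ < B.p₂

namespace IsTimeline

variable {S : Finset (Box K)} {E : List (Box K × Bool)}

theorem of_idxOf_lt (h : IsTimeline S E) {g g' : Box K × Bool} (hg : g ∈ E) (hg' : g' ∈ E)
    (hlt : E.idxOf g < E.idxOf g') : (eventOf g).pos < (eventOf g').pos ∨
      (eventOf g).pos = (eventOf g').pos ∧ (g.2 = true → g'.2 = true) := by
  have := List.pairwise_iff_getElem.1 h.sorted _ _ (List.idxOf_lt_length_of_mem hg)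
    (List.idxOf_lt_length_of_mem hg') hlt
  simpa only [List.getElem_idxOf] using this

theorem pos_le (h : IsTimeline S E) {g g' : Box K × Bool} (hg : g ∈ E) (hg' : g' ∈ E)
    (hlt : E.idxOf g < E.idxOf g') : (eventOf g).pos ≤ (eventOf g').pos := by
  rcases h.of_idxOf_lt hg hg' hlt with h | h
  · exact h.le
  · exact h.1.le

theorem idxOf_lt (h : IsTimeline S E) {g g' : Box K × Bool} (hg : g ∈ E) (hg' : g' ∈ E)
    (hlt : (eventOf g).pos < (eventOf g').pos) : E.idxOf g < E.idxOf g' := by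
  rcases lt_trichotomy (E.idxOf g) (E.idxOf g') with h' | h' | h'
  · exact h'
  · rw [(List.idxOf_inj hg).1 h'] at hlt
    exact absurd hlt (lt_irrefl _)
  · exact absurd hlt (not_lt.2 (h.pos_le hg' hg h'))

theorem idxOf_open_lt_close (h : IsTimeline S E) {B : Box K} (hB : B ∈ S) :
    E.idxOf (B, true) < E.idxOf (B, false) :=
  h.idxOf_lt ((h.mem_iff _).2 hB) ((h.mem_iff _).2 hB) (h.lt B hB)

/-- A box which is crossed by the sweep line at an event is active. -/
theorem mem_activeAt (h : IsTimeline S E) {g : Box K × Bool} (hg : g ∈ E) {B : Box K} (hB : B ∈ S)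
    (h₁ : B.p₁ < (eventOf g).pos) (h₂ : (eventOf g).pos < B.p₂) : B ∈ activeAt S E g :=
  Finset.mem_filter.2 ⟨hB, h.idxOf_lt ((h.mem_iff _).2 hB) hg h₁,
    h.idxOf_lt hg ((h.mem_iff _).2 hB) h₂⟩

end IsTimeline

/-- Processing the events in the given order with the boxes in `A` open at the start is possible,
and `act` gives the boxes which are open when an event is examined. -/
def Consistent (act : Box K × Bool → Finset (Box K)) : Finset (Box K) → List (Box K × Bool) → Prop
  | _, [] => True
  | A, (X, true) :: gs => X ∉ A ∧ act (X, true) = A ∧ Consistent act (insert X A) gs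
  | A, (X, false) :: gs => X ∈ A ∧ act (X, false) = A.erase X ∧ Consistent act (A.erase X) gs

/-- After the events in `pre`, the open boxes are those opened at an index below `pre.length` and
closing at an index not below it. One further event changes this for its own box only, since no
other event has that index. The lists `pre` and `post` leave room for events of the outsides that
are never processed. -/
theorem IsTimeline.consistent {S : Finset (Box K)} {E : List (Box K × Bool)} (h : IsTimeline S E)
    (gs pre post : List (Box K × Bool)) (hE : E = pre ++ (gs ++ post)) :
    Consistent (activeAt S E) (S.filter fun B => E.idxOf (B, true) < pre.length ∧
      pre.length ≤ E.idxOf (B, false)) gs := by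
  induction gs generalizing pre with
  | nil => trivial
  | cons g gs ih =>
    have hgE : g ∈ E := by simp [hE]
    have hn : E.idxOf g = pre.length := by
      have hnd := h.nodup
      rw [hE, List.nodup_append] at hnd
      have : g ∉ pre := fun hg => hnd.2.2 g hg g (by simp) rfl
      rw [hE, List.idxOf_append_of_notMem this]
      simp
    have hne : ∀ g' : Box K × Bool, g' ≠ g → E.idxOf g' ≠ pre.length := fun g' hg' he =>
      hg' ((List.idxOf_inj hgE).1 (hn.trans he.symm)).symm
    have ih' := ih (pre ++ [g]) (by simp [hE])
    rw [List.length_append, List.length_singleton] at ih'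
    obtain ⟨X, o⟩ := g
    have hX : X ∈ S := (h.mem_iff _).1 hgE
    have hlt := h.idxOf_open_lt_close hX
    cases o with
    | true =>
      refine ⟨by simp [hn], ?_, ?_⟩
      · ext B
        have := hne (B, false) (by simp)
        simp only [activeAt, Finset.mem_filter, hn]
        constructor
        · rintro ⟨h₁, h₂, h₃⟩; exact ⟨h₁, h₂, by omega⟩
        · rintro ⟨h₁, h₂, h₃⟩; exact ⟨h₁, h₂, by omega⟩
      · convert ih' using 1
        ext B
        have h₁ := hne (B, false) (by simp)
        simp only [Finset.mem_insert, Finset.mem_filter]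
        constructor
        · rintro (rfl | ⟨h₂, h₃, h₄⟩)
          · exact ⟨hX, by omega, by omega⟩
          · exact ⟨h₂, by omega, by omega⟩
        · rintro ⟨h₂, h₃, h₄⟩
          by_cases hBX : B = X
          · exact Or.inl hBX
          · have := hne (B, true) (by simp [hBX])
            exact Or.inr ⟨h₂, by omega, by omega⟩
    | false =>
      have key : ∀ B, B ∈ S → ((E.idxOf (B, true) < pre.length ∧ pre.length < E.idxOf (B, false)) ↔
          B ≠ X ∧ E.idxOf (B, true) < pre.length ∧ pre.length ≤ E.idxOf (B, false)) := by
        intro B hB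
        constructor
        · rintro ⟨h₁, h₂⟩
          refine ⟨?_, h₁, h₂.le⟩
          rintro rfl
          omega
        · rintro ⟨h₁, h₂, h₃⟩
          have := hne (B, false) (by simp [h₁])
          exact ⟨h₂, by omega⟩
      refine ⟨?_, ?_, ?_⟩
      · simp only [Finset.mem_filter]
        exact ⟨hX, by omega, by omega⟩
      · ext B
        simp only [activeAt, Finset.mem_filter, hn, Finset.mem_erase]
        have := key B
        tauto
      · convert ih' using 1
        ext B
        have h₁ := hne (B, true) (by simp)
        simp only [Finset.mem_erase, Finset.mem_filter]
        have h₂ := key B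
        constructor
        · rintro ⟨h₃, h₄, h₅⟩
          have := (h₂ h₄).2 ⟨h₃, h₅⟩
          exact ⟨h₄, by omega, by omega⟩
        · rintro ⟨h₃, h₄, h₅⟩
          have := (h₂ h₃).1 ⟨by omega, by omega⟩
          exact ⟨this.1, h₃, this.2⟩

theorem emit_spec {K : Type} (p : K) (ps : List (Key K × Key K)) (out : List (Seg K)) :
    (∀ s, s ∈ (emit p ps out).val ↔ s ∈ out ∨ ∃ i ∈ ps, s = ⟨p, i.1.coord, i.2.coord⟩) ∧
      (emit p ps out).cost = ps.length + 1 := by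
  induction ps generalizing out with
  | nil => simp [emit]
  | cons i ps ih =>
    obtain ⟨l, r⟩ := i
    obtain ⟨h₁, h₂⟩ := ih (⟨p, l.coord, r.coord⟩ :: out)
    simp only [emit, bind_val, bind_cost, tick_cost, h₂, List.length_cons]
    refine ⟨fun s => ?_, by omega⟩
    rw [h₁]
    simp only [List.mem_cons, exists_eq_or_imp]
    tauto

/-- The retrieval at event `g` with the boxes in `A` stored in the tree. -/
def retrieve (T : SegTree K) (A : Finset (Box K)) (g : Box K × Bool) :
    Timed (List (Key K × Key K)) :=
  (SegTree.fill (SegTree.stored A) T).query ⟨g.1.b, false⟩ ⟨g.1.e, true⟩ []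

/-- The invariant is that the current tree is the skeleton filled with the open boxes. In the cost,
the factor 2 accounts for finding and for outputting the pieces, `15 + 60 * T.height` for the
update, and 2 for the call and the end of the output loop. -/
theorem process_spec {T : SegTree K} {C : List K} {lo hi : K} (hT : SegTree.IsTreeOver T C lo hi)
    {act : Box K × Bool → Finset (Box K)} (gs : List (Box K × Bool)) {A : Finset (Box K)}
    (hc : Consistent act A gs) (out : List (Seg K)) :
    (∀ s, s ∈ (process (gs.map eventOf) (SegTree.fill (SegTree.stored A) T) out).val ↔
      s ∈ out ∨ ∃ g ∈ gs, ∃ i ∈ (retrieve T (act g) g).val,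
        s = ⟨(eventOf g).pos, i.1.coord, i.2.coord⟩) ∧
    (process (gs.map eventOf) (SegTree.fill (SegTree.stored A) T) out).cost ≤
      1 + (gs.map fun g => 2 * (retrieve T (act g) g).cost + 17 + 60 * T.height).sum := by
  induction gs generalizing A out with
  | nil => simp [process]
  | cons g gs ih =>
    obtain ⟨X, o⟩ := g
    have hl := SegTree.length_query_le ⟨X.b, false⟩ ⟨X.e, true⟩
      (SegTree.fill (SegTree.stored (act (X, o))) T) []
    rw [List.length_nil, Nat.zero_add] at hl
    cases o with
    | true =>
      obtain ⟨h₁, h₂, h₃⟩ := hc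
      have hu := hT.update_insert h₁
      have hk := hT.update_cost_le true ⟨X.b, true⟩ ⟨X.e, false⟩ (SegTree.stored A)
      obtain ⟨e₁, e₂⟩ := emit_spec X.p₁ (retrieve T A (X, true)).val out
      obtain ⟨i₁, i₂⟩ := ih h₃ (emit X.p₁ (retrieve T A (X, true)).val out).val
      simp only [retrieve] at e₁ e₂ i₁ i₂
      rw [h₂] at hl
      simp only [List.map_cons, process, eventOf, if_true, bind_val, bind_cost, tick_cost, hu,
        List.sum_cons, h₂, retrieve, e₂]
      refine ⟨fun s => ?_, by omega⟩
      simp only [eventOf] at i₁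
      rw [i₁, e₁]
      simp only [List.mem_cons, exists_eq_or_imp, h₂, or_assoc, if_true]
    | false =>
      obtain ⟨h₁, h₂, h₃⟩ := hc
      have hu := hT.update_delete h₁
      have hk := hT.update_cost_le false ⟨X.b, true⟩ ⟨X.e, false⟩ (SegTree.stored A)
      obtain ⟨e₁, e₂⟩ := emit_spec X.p₂ (retrieve T (A.erase X) (X, false)).val out
      obtain ⟨i₁, i₂⟩ := ih h₃ (emit X.p₂ (retrieve T (A.erase X) (X, false)).val out).val
      simp only [retrieve] at e₁ e₂ i₁ i₂
      rw [h₂] at hl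
      simp only [List.map_cons, process, eventOf, if_false, Bool.false_eq_true, bind_val, bind_cost,
        tick_cost, hu, List.sum_cons, h₂, retrieve, e₂]
      refine ⟨fun s => ?_, by omega⟩
      simp only [eventOf] at i₁
      rw [i₁, e₁]
      simp only [List.mem_cons, exists_eq_or_imp, h₂, or_assoc, if_false, Bool.false_eq_true]

/-! ### Preparation of the sweep -/

theorem events_spec {K : Type} (rs : List (Box K)) (acc : List (Event K)) :
    (events rs acc).val.Perm
      ((rs.flatMap fun B => [(B, true), (B, false)]).map eventOf ++ acc) ∧
      (events rs acc).cost = rs.length + 1 := by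
  induction rs generalizing acc with
  | nil => simp [events]
  | cons r rs ih =>
    obtain ⟨h₁, h₂⟩ := ih (⟨r.p₁, true, r.b, r.e⟩ :: ⟨r.p₂, false, r.b, r.e⟩ :: acc)
    simp only [events, bind_val, bind_cost, h₂, tick_cost, List.length_cons]
    refine ⟨h₁.trans ?_, by omega⟩
    simp only [List.flatMap_cons, List.map_cons, eventOf, if_true, Bool.false_eq_true, if_false, List.cons_append, List.nil_append]
    refine List.perm_middle.trans (List.Perm.cons _ ?_)
    exact List.perm_middle

theorem collect_spec (lo hi c : K) (acc : List K) :
    (∀ x, x ∈ (collect lo hi c acc).val ↔ x ∈ acc ∨ x = c ∧ lo ≤ x ∧ x ≤ hi) ∧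
      (collect lo hi c acc).val.length ≤ acc.length + 1 ∧ (collect lo hi c acc).cost ≤ 3 := by
  simp only [collect, bind_val, ite_val, le_val, pure_val, decide_eq_true_eq, bind_cost, ite_cost,
    tick_cost, le_cost, pure_cost]
  refine ⟨fun x => ?_, by split_ifs <;> simp, by split_ifs <;> omega⟩
  split_ifs with h₁ h₂
  · simp only [List.mem_cons]
    constructor
    · rintro (rfl | h)
      · exact Or.inr ⟨rfl, h₁, h₂⟩
      · exact Or.inl h
    · rintro (h | h)
      · exact Or.inr h
      · exact Or.inl h.1
  · refine ⟨Or.inl, ?_⟩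
    rintro (h | ⟨rfl, -, h⟩)
    · exact h
    · exact absurd h h₂
  · refine ⟨Or.inl, ?_⟩
    rintro (h | ⟨rfl, h, -⟩)
    · exact h
    · exact absurd h h₁

theorem coords_spec (lo hi : K) (rs : List (Box K)) (acc : List K) :
    (∀ x, x ∈ (coords lo hi rs acc).val ↔
      x ∈ acc ∨ (∃ r ∈ rs, x = r.b ∨ x = r.e) ∧ lo ≤ x ∧ x ≤ hi) ∧
      (coords lo hi rs acc).val.length ≤ acc.length + 2 * rs.length ∧
      (coords lo hi rs acc).cost ≤ 7 * rs.length + 1 := by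
  induction rs generalizing acc with
  | nil => simp [coords]
  | cons r rs ih =>
    obtain ⟨h₁, h₂, h₃⟩ := collect_spec lo hi r.b acc
    obtain ⟨h₄, h₅, h₆⟩ := collect_spec lo hi r.e (collect lo hi r.b acc).val
    obtain ⟨h₇, h₈, h₉⟩ := ih (collect lo hi r.e (collect lo hi r.b acc).val).val
    simp only [coords, bind_val, bind_cost, tick_cost, List.length_cons]
    refine ⟨fun x => ?_, by omega, by omega⟩
    rw [h₇, h₄, h₁]
    simp only [List.mem_cons, exists_eq_or_imp]
    simp only [or_and_right, or_assoc]

/-- Sorting sees bare events only, and `eventOf` is not injective. The lift restores for each sorted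
event the box that it comes from. -/
theorem exists_perm_map_eq {α β : Type} (f : α → β) {l : List α} {l' : List β}
    (h : l'.Perm (l.map f)) : ∃ l'' : List α, l''.Perm l ∧ l''.map f = l' := by
  have := congrFun (congrFun (List.eq_map_comp_perm f) l') l
  rw [← eq_iff_iff.1 this] at h
  obtain ⟨l'', h₁, h₂⟩ := h
  exact ⟨l'', h₂, h₁.symm⟩

theorem exists_forall_lt [NoMinOrder K] [Nonempty K] (l : List K) : ∃ m, ∀ x ∈ l, m < x := by
  induction l with
  | nil => exact ⟨Classical.arbitrary K, by simp⟩
  | cons a l ih =>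
    obtain ⟨m, hm⟩ := ih
    obtain ⟨m', hm'⟩ := exists_lt (min a m)
    rw [lt_min_iff] at hm'
    refine ⟨m', fun x hx => ?_⟩
    rcases List.mem_cons.1 hx with rfl | hx
    · exact hm'.1
    · exact hm'.2.trans (hm x hx)

theorem exists_forall_gt [NoMaxOrder K] [Nonempty K] (l : List K) : ∃ m, ∀ x ∈ l, x < m :=
  exists_forall_lt (K := Kᵒᵈ) l

/-- The events of a sweep in their order: those of the given boxes, the closing event of the
outside to the left and the opening event of the outside to the right. -/
structure IsSchedule (p₁ p₂ b e : K) (rs : List (Box K)) (left right : Box K)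
    (G : List (Box K × Bool)) : Prop where
  left_eq : left.p₂ = p₁ ∧ left.b = b ∧ left.e = e
  right_eq : right.p₁ = p₂ ∧ right.b = b ∧ right.e = e
  left_lt : ∀ g ∈ G, left.p₁ < (eventOf g).pos
  lt_right : ∀ g ∈ G, (eventOf g).pos < right.p₂
  perm : G.Perm ((left, false) :: (right, true) :: rs.flatMap fun B => [(B, true), (B, false)])
  timeline : IsTimeline (insert left (insert right rs.toFinset))
    ((left, true) :: (G ++ [(right, false)]))

/-- The two outsides of the chip become ordinary boxes by cutting them off at positions `m` and `M`
beyond all events. Their artificial far ends come first and last in the timeline, and the algorithm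
never processes them. -/
theorem exists_schedule [NoMinOrder K] [NoMaxOrder K] (p₁ p₂ b e : K) {rs : List (Box K)}
    (hnd : rs.Nodup) (hlt : ∀ r ∈ rs, r.p₁ < r.p₂) :
    ∃ left right G, IsSchedule p₁ p₂ b e rs left right G ∧ G.map eventOf =
      (sort Event.le (events rs [⟨p₁, false, b, e⟩, ⟨p₂, true, b, e⟩]).val).val := by
  have : Nonempty K := ⟨p₁⟩
  obtain ⟨m, hm⟩ := exists_forall_lt (p₁ :: p₂ :: rs.map fun r => r.p₁)
  obtain ⟨M, hM⟩ := exists_forall_gt (p₁ :: p₂ :: rs.map fun r => r.p₂)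
  simp only [List.mem_cons, List.mem_map, forall_eq_or_imp, forall_exists_index, and_imp,
    forall_apply_eq_imp_iff₂] at hm hM
  obtain ⟨hm₁, hm₂, hm₃⟩ := hm
  obtain ⟨hM₁, hM₂, hM₃⟩ := hM
  obtain ⟨G, hG, hGL⟩ := exists_perm_map_eq eventOf
    (l := ((⟨m, p₁, b, e⟩ : Box K), false) :: ((⟨p₂, M, b, e⟩ : Box K), true) ::
      rs.flatMap fun B => [(B, true), (B, false)])
    (l' := (sort Event.le (events rs [⟨p₁, false, b, e⟩, ⟨p₂, true, b, e⟩]).val).val) (by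
      refine (sort_perm _ _).trans ((events_spec rs _).1.trans ?_)
      refine List.perm_append_comm.trans (List.Perm.of_eq ?_)
      simp [eventOf])
  obtain ⟨left, hl⟩ : ∃ x : Box K, x = ⟨m, p₁, b, e⟩ := ⟨_, rfl⟩
  obtain ⟨right, hr⟩ : ∃ x : Box K, x = ⟨p₂, M, b, e⟩ := ⟨_, rfl⟩
  rw [← hl, ← hr] at hG
  have hlr : left ≠ right := by
    rw [hl, hr]
    intro h
    rw [Box.mk.injEq] at h
    exact hm₂.ne h.1
  have hlm : left ∉ rs := fun h => by
    have := hm₃ _ h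
    rw [hl] at this
    exact lt_irrefl _ this
  have hrm : right ∉ rs := fun h => by
    have := hM₃ _ h
    rw [hr] at this
    exact lt_irrefl _ this
  have hpos : ∀ g ∈ G, m < (eventOf g).pos ∧ (eventOf g).pos < M := by
    intro g hg
    have hg' := hG.mem_iff.1 hg
    simp only [List.mem_cons, List.mem_flatMap, List.not_mem_nil, or_false] at hg'
    rcases hg' with rfl | rfl | ⟨r, hr', rfl | rfl⟩
    · simpa [eventOf, hl] using ⟨hm₁, hM₁⟩
    · simpa [eventOf, hr] using ⟨hm₂, hM₂⟩
    · exact ⟨hm₃ r hr', (hlt r hr').trans (hM₃ r hr')⟩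
    · exact ⟨(hm₃ r hr').trans (hlt r hr'), hM₃ r hr'⟩
  have hsorted : G.Pairwise fun g g' => (eventOf g).sortKey ≤ (eventOf g').sortKey := by
    have := sort_pairwise (r := fun u v : Event K => u.sortKey ≤ v.sortKey) Event.le_val
      (fun _ _ _ => le_trans) (fun _ _ => le_total _ _)
      (events rs [⟨p₁, false, b, e⟩, ⟨p₂, true, b, e⟩]).val
    rw [← hGL, List.pairwise_map] at this
    exact this
  have hE : ((left, true) :: (G ++ [(right, false)])).Perm
      ((left :: right :: rs).flatMap fun B => [(B, true), (B, false)]) := by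
    simp only [List.flatMap_cons, List.cons_append, List.nil_append]
    refine List.Perm.cons _ ((hG.append_right _).trans ?_)
    simp only [List.cons_append]
    refine List.Perm.cons _ (List.Perm.cons _ ?_)
    exact List.perm_append_comm
  refine ⟨left, right, G, ⟨by simp [hl], by simp [hr], ?_, ?_, hG, ?_, ?_, ?_, ?_⟩, hGL⟩
  · intro g hg
    simpa [hl] using (hpos g hg).1
  · intro g hg
    simpa [hr] using (hpos g hg).2
  · rw [hE.nodup_iff, List.nodup_flatMap]
    refine ⟨by simp, ?_⟩
    have : (left :: right :: rs).Nodup := by simp [hlr, hlm, hrm, hnd]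
    refine List.Pairwise.imp ?_ this
    intro B B' hBB
    simp [Function.onFun, Ne.symm hBB]
  · rintro ⟨B, o⟩
    rw [hE.mem_iff]
    cases o <;> simp
  · rw [List.pairwise_cons, List.pairwise_append]
    refine ⟨?_, ?_, by simp, ?_⟩
    · intro g hg
      left
      rcases List.mem_append.1 hg with hg | hg
      · simpa [eventOf, hl] using (hpos g hg).1
      · rw [List.mem_singleton.1 hg]
        simpa [eventOf, hl, hr] using hm₁.trans hM₁
    · refine List.Pairwise.imp ?_ hsorted
      intro g g' hgg
      simp only [Event.sortKey, Prod.Lex.toLex_le_toLex] at hgg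
      rcases hgg with h | ⟨h₁, h₂⟩
      · exact Or.inl h
      · refine Or.inr ⟨h₁, fun ho => ?_⟩
        by_contra ho'
        simp only [eventOf, ho, ho', if_true, if_false] at h₂
        revert h₂
        simp
    · intro g hg g' hg'
      rw [List.mem_singleton.1 hg']
      left
      simpa [eventOf, hr] using (hpos g hg).2
  · intro B hB
    simp only [Finset.mem_insert, List.mem_toFinset] at hB
    rcases hB with rfl | rfl | hB
    · simpa [hl] using hm₁
    · simpa [hr] using hM₂
    · exact hlt B hB

end Sweep

/-! ### The set of points reported by a sweep -/

namespace Sweep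

variable {K : Type} [LinearOrder K]

/-- All boxes of a sweep. -/
noncomputable def allBoxes (left right : Box K) (rs : List (Box K)) : Finset (Box K) :=
  insert left (insert right rs.toFinset)

/-- The retrieval at event `g` of the schedule `G`. -/
noncomputable def retrieveAt (T : SegTree K) (left right : Box K) (rs : List (Box K))
    (G : List (Box K × Bool)) (g : Box K × Bool) : Timed (List (Key K × Key K)) :=
  retrieve T (activeAt (allBoxes left right rs) ((left, true) :: (G ++ [(right, false)])) g) g

/-- Here the bookkeeping is separated from the geometry and the counting: output and cost are
expressed through the retrievals alone. The strict inequalities on `b` and `e` place the ends of the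
outsides off the tree, so they need no coordinate of their own. -/
theorem run_spec [NoMinOrder K] [NoMaxOrder K] {p₁ p₂ lo hi b e : K} {rs : List (Box K)}
    (hb : b < lo) (he : hi < e) (hnd : rs.Nodup) (hlt : ∀ r ∈ rs, r.p₁ < r.p₂) :
    ∃ left right G T C, IsSchedule p₁ p₂ b e rs left right G ∧ SegTree.IsTreeOver T C lo hi ∧
      T.height ≤ Nat.clog 2 (4 * rs.length + 4) ∧
      (∀ B ∈ allBoxes left right rs, SegTree.Fits C lo hi B) ∧
      (∀ s, s ∈ (run p₁ p₂ lo hi b e rs).val ↔ ∃ g ∈ G,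
        ∃ i ∈ (retrieveAt T left right rs G g).val,
          s = ⟨(eventOf g).pos, i.1.coord, i.2.coord⟩) ∧
      (run p₁ p₂ lo hi b e rs).cost ≤ 60 + 40 * rs.length +
        (30 * rs.length + 90) * Nat.clog 2 (4 * rs.length + 4) +
        (G.map fun g => 2 * (retrieveAt T left right rs G g).cost + 17 + 60 * T.height).sum := by
  obtain ⟨left, right, G, hS, hG⟩ := exists_schedule p₁ p₂ b e hnd hlt
  obtain ⟨ev₁, ev₂⟩ := events_spec rs [⟨p₁, false, b, e⟩, ⟨p₂, true, b, e⟩]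
  obtain ⟨a₁, a₂, a₃⟩ := collect_spec lo hi lo []
  obtain ⟨b₁, b₂, b₃⟩ := collect_spec lo hi hi (collect lo hi lo []).val
  obtain ⟨c₁, c₂, c₃⟩ := coords_spec lo hi rs (collect lo hi hi (collect lo hi lo []).val).val
  obtain ⟨cs, hcs⟩ : ∃ cs, cs =
    (coords lo hi rs (collect lo hi hi (collect lo hi lo []).val).val).val := ⟨_, rfl⟩
  have hsp := sort_perm Timed.le cs
  have hmem : ∀ x, x ∈ (sort Timed.le cs).val ↔
      (x = lo ∨ x = hi ∨ ∃ r ∈ rs, x = r.b ∨ x = r.e) ∧ lo ≤ x ∧ x ≤ hi := by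
    intro x
    rw [hsp.mem_iff, hcs, c₁, b₁, a₁]
    simp only [List.not_mem_nil, false_or, or_and_right, or_assoc]
  have hlen : cs.length ≤ 2 * rs.length + 2 := by
    rw [hcs]
    simp only [List.length_nil] at a₂
    omega
  have hsorted := sort_pairwise (cmp := Timed.le) (r := fun x y : K => x ≤ y) (by simp)
    (fun _ _ _ => le_trans) le_total cs
  obtain ⟨t₁, t₂, t₃⟩ := SegTree.ofKeys_spec (C := (sort Timed.le cs).val) (lo := lo) (hi := hi)
    hsorted (fun c hc => ((hmem c).1 hc).2) (fun h => (hmem _).2 ⟨Or.inl rfl, le_rfl, h⟩)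
    (fun h => (hmem _).2 ⟨Or.inr (Or.inl rfl), h, le_rfl⟩)
  obtain ⟨T, hT⟩ : ∃ T, T = (SegTree.ofKeys (keys (sort Timed.le cs).val).val).val := ⟨_, rfl⟩
  rw [← hT] at t₁ t₂
  have hcons := hS.timeline.consistent G [(left, true)] [(right, false)] rfl
  have hstart : ((insert left (insert right rs.toFinset)).filter fun B =>
      ((left, true) :: (G ++ [(right, false)])).idxOf (B, true) < [(left, true)].length ∧
      [(left, true)].length ≤ ((left, true) :: (G ++ [(right, false)])).idxOf (B, false)) =
      insert left ∅ := by
    ext B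
    have h₁ : ((left, true) : Box K × Bool) ≠ (B, false) := by simp
    rw [Finset.mem_filter, List.idxOf_cons_ne _ h₁]
    by_cases hB : B = left
    · subst hB
      simp
    · have h₂ : ((left, true) : Box K × Bool) ≠ (B, true) := by simp [Ne.symm hB]
      rw [List.idxOf_cons_ne _ h₂]
      simp [hB]
  rw [hstart] at hcons
  have hinit : (SegTree.update true ⟨b, true⟩ ⟨e, false⟩ T).val =
      SegTree.fill (SegTree.stored (insert left ∅)) T := by
    rw [← t₁.update_insert (Finset.notMem_empty left), hS.left_eq.2.1, hS.left_eq.2.2]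
    congr 2
    exact t₁.fill_zero.symm
  have hinitc : (SegTree.update true ⟨b, true⟩ ⟨e, false⟩ T).cost ≤ 15 * (1 + 2 * (T.height * 2)) := by
    have := t₁.update_cost_le true ⟨b, true⟩ ⟨e, false⟩ 0
    rwa [t₁.fill_zero] at this
  obtain ⟨q₁, q₂⟩ := process_spec t₁ G hcons []
  refine ⟨left, right, G, T, _, hS, t₁, ?_, ?_, ?_, ?_⟩
  · refine t₂.trans (Nat.clog_mono_right 2 ?_)
    have := hsp.length_eq
    omega
  · intro B hB
    simp only [allBoxes, Finset.mem_insert, List.mem_toFinset] at hB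
    rcases hB with rfl | rfl | hB
    · rw [SegTree.Fits, hS.left_eq.2.1, hS.left_eq.2.2]
      exact ⟨Or.inr (Or.inl hb), Or.inr (Or.inr he)⟩
    · rw [SegTree.Fits, hS.right_eq.2.1, hS.right_eq.2.2]
      exact ⟨Or.inr (Or.inl hb), Or.inr (Or.inr he)⟩
    · have key : ∀ x, (x = B.b ∨ x = B.e) → x ∈ (sort Timed.le cs).val ∨ x < lo ∨ hi < x := by
        intro x hx
        by_cases h₁ : lo ≤ x
        · by_cases h₂ : x ≤ hi
          · exact Or.inl ((hmem x).2 ⟨Or.inr (Or.inr ⟨B, hB, hx⟩), h₁, h₂⟩)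
          · exact Or.inr (Or.inr (not_le.1 h₂))
        · exact Or.inr (Or.inl (not_le.1 h₁))
      exact ⟨key _ (Or.inl rfl), key _ (Or.inr rfl)⟩
  · intro s
    simp only [run, bind_val, ← hcs, ← hT, hinit, ← hG]
    rw [q₁]
    simp only [List.not_mem_nil, false_or]
    rfl
  · have hL := sort_cost_le (cmp := Event.le) Event.le_cost_le
      (events rs [⟨p₁, false, b, e⟩, ⟨p₂, true, b, e⟩]).val
    have hevl : (events rs [⟨p₁, false, b, e⟩, ⟨p₂, true, b, e⟩]).val.length =
        2 * rs.length + 2 := by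
      rw [ev₁.length_eq]
      simp [List.length_flatMap]
      omega
    rw [hevl] at hL
    have hC := sort_cost_le (cmp := Timed.le) (k := 1) (fun x y : K => (le_cost x y).le) cs
    have hm₁ : Nat.clog 2 (2 * rs.length + 2) ≤ Nat.clog 2 (4 * rs.length + 4) :=
      Nat.clog_mono_right 2 (by omega)
    have hm₂ : Nat.clog 2 cs.length ≤ Nat.clog 2 (4 * rs.length + 4) :=
      Nat.clog_mono_right 2 (by omega)
    have hht : T.height ≤ Nat.clog 2 (4 * rs.length + 4) := by
      refine t₂.trans (Nat.clog_mono_right 2 ?_)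
      have := hsp.length_eq
      omega
    have hL' := Nat.mul_le_mul_left (2 * rs.length + 2) hm₁
    have hC' := Nat.mul_le_mul hlen hm₂
    have hln := hsp.length_eq
    simp only [run, bind_cost, tick_cost, ← hcs, ← hT, hinit, ← hG]
    change _ ≤ 60 + 40 * rs.length + (30 * rs.length + 90) * Nat.clog 2 (4 * rs.length + 4) +
      (G.map fun g => 2 * (retrieve T (activeAt (insert left (insert right rs.toFinset))
        ((left, true) :: (G ++ [(right, false)])) g) g).cost + 17 + 60 * T.height).sum
    generalize Nat.clog 2 (4 * rs.length + 4) = c at *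
    have e₁ : (30 * rs.length + 90) * c = 15 * ((2 * rs.length + 2) * c) + 60 * c := by ring
    rw [e₁]
    omega

/-- The reported segments consist of the points on sides of boxes which are not in the interior
of any box. -/
theorem mem_run_iff [NoMinOrder K] [NoMaxOrder K] {p₁ p₂ lo hi b e : K} {rs : List (Box K)}
    (hb : b < lo) (he : hi < e) (hnd : rs.Nodup) (hlt : ∀ r ∈ rs, r.p₁ < r.p₂) :
    (∀ s ∈ (run p₁ p₂ lo hi b e rs).val, s.lo ≤ s.hi) ∧
    ∀ p y, (∃ s ∈ (run p₁ p₂ lo hi b e rs).val, p = s.pos ∧ s.lo ≤ y ∧ y ≤ s.hi) ↔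
      (p₁ ≤ p ∧ p ≤ p₂) ∧ (lo ≤ y ∧ y ≤ hi) ∧
      (∀ r ∈ rs, ¬((r.p₁ < p ∧ p < r.p₂) ∧ (r.b < y ∧ y < r.e))) ∧
      (p = p₁ ∨ p = p₂ ∨ ∃ r ∈ rs, (p = r.p₁ ∨ p = r.p₂) ∧ r.b ≤ y ∧ y ≤ r.e) := by
  obtain ⟨left, right, G, T, C, hS, hT, -, hfit, hmem, -⟩ :=
    run_spec (p₁ := p₁) (p₂ := p₂) hb he hnd hlt
  obtain ⟨E, hE⟩ : ∃ E, E = (left, true) :: (G ++ [(right, false)]) := ⟨_, rfl⟩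
  have htl := hS.timeline
  rw [← hE] at htl
  obtain ⟨S, hSB⟩ : ∃ S, S = allBoxes left right rs := ⟨_, rfl⟩
  change IsTimeline (allBoxes left right rs) E at htl
  simp only [retrieveAt, retrieve, ← hE, ← hSB] at hmem
  rw [← hSB] at htl hfit
  have hact : ∀ g, ∀ B ∈ activeAt S E g, SegTree.Fits C lo hi B := fun g B hB =>
    hfit B (Finset.mem_filter.1 hB).1
  have hGE : ∀ g ∈ G, g ∈ E := fun g hg => by simp [hE, hg]
  have hEG : ∀ g ∈ E, g = (left, true) ∨ g = (right, false) ∨ g ∈ G := fun g hg => by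
    simp only [hE, List.mem_cons, List.mem_append, List.not_mem_nil, or_false] at hg
    tauto
  have hgfit : ∀ g ∈ G, SegTree.Fits C lo hi g.1 := fun g hg =>
    hfit _ ((htl.mem_iff g).1 (hGE g hg))
  have hq := fun g hg => hT.query_spec (hgfit g hg) (hact g)
  constructor
  · intro s hs
    obtain ⟨g, hg, i, hi', rfl⟩ := (hmem s).1 hs
    exact (hq g hg).1 i hi'
  intro p y
  have hstep : (∃ s ∈ (run p₁ p₂ lo hi b e rs).val, p = s.pos ∧ s.lo ≤ y ∧ y ≤ s.hi) ↔
      (lo ≤ y ∧ y ≤ hi) ∧ ∃ g ∈ G, p = (eventOf g).pos ∧ (g.1.b ≤ y ∧ y ≤ g.1.e) ∧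
        ∀ B ∈ activeAt S E g, ¬(B.b < y ∧ y < B.e) := by
    constructor
    · rintro ⟨s, hs, hp, hy⟩
      obtain ⟨g, hg, i, hi', rfl⟩ := (hmem s).1 hs
      obtain ⟨h₁, h₂, h₃⟩ := ((hq g hg).2 y).1 ⟨i, hi', hy⟩
      exact ⟨h₁, g, hg, hp, h₂, h₃⟩
    · rintro ⟨h₁, g, hg, hp, h₂, h₃⟩
      obtain ⟨i, hi', hy⟩ := ((hq g hg).2 y).2 ⟨h₁, h₂, h₃⟩
      exact ⟨_, (hmem _).2 ⟨g, hg, i, hi', rfl⟩, hp, hy⟩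
  rw [hstep]
  have hgp : ∀ g, g ∈ G ↔ g = (left, false) ∨ g = (right, true) ∨ g.1 ∈ rs := by
    rintro ⟨B, o⟩
    rw [hS.perm.mem_iff]
    cases o <;> simp
  have hSm : ∀ B, B ∈ S ↔ B = left ∨ B = right ∨ B ∈ rs := by simp [hSB, allBoxes]
  have hlb := hS.left_eq
  have hrb := hS.right_eq
  constructor
  · rintro ⟨hy, g, hg, rfl, hgy, hu⟩
    have hl := hS.left_lt g hg
    have hr := hS.lt_right g hg
    -- A box properly crossed by the line is active regardless of ties, so a reported point avoids
    -- its interior. Applied to the two outsides this confines the position to the range between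
    -- `p₁` and `p₂`.
    have hcov : ∀ B ∈ S, ¬((B.p₁ < (eventOf g).pos ∧ (eventOf g).pos < B.p₂) ∧
        (B.b < y ∧ y < B.e)) := fun B hB h =>
      hu B (htl.mem_activeAt (hGE g hg) hB h.1.1 h.1.2) h.2
    refine ⟨⟨?_, ?_⟩, hy, fun r hr' => hcov r ((hSm r).2 (Or.inr (Or.inr hr'))), ?_⟩
    · by_contra hlt'
      refine hcov left ((hSm _).2 (Or.inl rfl)) ⟨⟨hl, ?_⟩, ?_⟩
      · rw [hlb.1]; exact not_le.1 hlt'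
      · rw [hlb.2.1, hlb.2.2]; exact ⟨hb.trans_le hy.1, hy.2.trans_lt he⟩
    · by_contra hlt'
      refine hcov right ((hSm _).2 (Or.inr (Or.inl rfl))) ⟨⟨?_, hr⟩, ?_⟩
      · rw [hrb.1]; exact not_le.1 hlt'
      · rw [hrb.2.1, hrb.2.2]; exact ⟨hb.trans_le hy.1, hy.2.trans_lt he⟩
    · rcases (hgp g).1 hg with rfl | rfl | hgr
      · exact Or.inl hlb.1
      · exact Or.inr (Or.inl hrb.1)
      · refine Or.inr (Or.inr ⟨g.1, hgr, ?_, hgy⟩)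
        unfold eventOf
        split_ifs
        · exact Or.inl rfl
        · exact Or.inr rfl
  · rintro ⟨⟨hp₁, hp₂⟩, hy, hu, hside⟩
    refine ⟨hy, ?_⟩
    have hcov : ∀ B ∈ S, ¬((B.p₁ < p ∧ p < B.p₂) ∧ (B.b < y ∧ y < B.e)) := by
      intro B hB
      rcases (hSm B).1 hB with rfl | rfl | hB
      · rintro ⟨⟨-, h⟩, -⟩
        rw [hlb.1] at h
        exact absurd h (not_lt.2 hp₁)
      · rintro ⟨⟨h, -⟩, -⟩
        rw [hrb.1] at h
        exact absurd h (not_lt.2 hp₂)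
      · exact hu B hB
    have hside' : ∃ g ∈ G, p = (eventOf g).pos ∧ (g.1.b ≤ y ∧ y ≤ g.1.e) := by
      have hbe : b ≤ y ∧ y ≤ e := ⟨hb.le.trans hy.1, hy.2.trans he.le⟩
      rcases hside with rfl | rfl | ⟨r, hr, rfl | rfl, hry⟩
      · refine ⟨(left, false), (hgp _).2 (Or.inl rfl), hlb.1.symm, ?_⟩
        rw [hlb.2.1, hlb.2.2]; exact hbe
      · refine ⟨(right, true), (hgp _).2 (Or.inr (Or.inl rfl)), hrb.1.symm, ?_⟩
        rw [hrb.2.1, hrb.2.2]; exact hbe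
      · exact ⟨(r, true), (hgp _).2 (Or.inr (Or.inr hr)), rfl, hry⟩
      · exact ⟨(r, false), (hgp _).2 (Or.inr (Or.inr hr)), rfl, hry⟩
    obtain ⟨g₀, hg₀, hpg₀, hyg₀⟩ := hside'
    have hl := hS.left_lt g₀ hg₀
    have hr := hS.lt_right g₀ hg₀
    rw [← hpg₀] at hl hr
    have hposle : ∀ g ∈ G, ∀ g' ∈ E, E.idxOf g < E.idxOf g' →
      (eventOf g).pos ≤ (eventOf g').pos := fun g hg g' hg' => htl.pos_le (hGE g hg) hg'
    cases ho : g₀.2 with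
    | false =>
      -- Take the last closing event at `p` whose side contains `y`. An active box hiding `y` there
      -- cannot cross the line, so it would close at `p` later, contradicting maximality.
      obtain ⟨g, hgF, hmax⟩ := Finset.exists_max_image
        (G.toFinset.filter fun g => g.2 = false ∧ p = (eventOf g).pos ∧ g.1.b ≤ y ∧ y ≤ g.1.e)
        (fun g => E.idxOf g) ⟨g₀, by simp [hg₀, ho, hpg₀, hyg₀.1, hyg₀.2]⟩
      simp only [Finset.mem_filter, List.mem_toFinset] at hgF hmax
      obtain ⟨hg, hgo, hpg, hyg⟩ := hgF
      refine ⟨g, hg, hpg, hyg, fun B hB hBy => ?_⟩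
      obtain ⟨hBS, hB₁, hB₂⟩ := Finset.mem_filter.1 hB
      have hBE : ∀ o, (B, o) ∈ E := fun o => (htl.mem_iff _).2 hBS
      have h₂ : p ≤ B.p₂ := hpg ▸ htl.pos_le (hGE g hg) (hBE false) hB₂
      -- Strictness comes from the tie rule: at equal positions an opening event does not precede a
      -- closing one.
      have h₁ : B.p₁ < p := by
        rcases htl.of_idxOf_lt (hBE true) (hGE g hg) hB₁ with h | ⟨-, h⟩
        · rw [hpg]; exact h
        · rw [hgo] at h; simp at h
      rcases h₂.eq_or_lt with h₂ | h₂
      · have hBG : (B, false) ∈ G := by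
          rcases hEG _ (hBE false) with h | h | h
          · simp at h
          · simp only [Prod.mk.injEq, and_true] at h
            rw [← h, ← h₂] at hr
            exact absurd hr (lt_irrefl _)
          · exact h
        exact absurd hB₂ (not_lt.2 (hmax (B, false) ⟨hBG, rfl, h₂, hBy.1.le, hBy.2.le⟩))
      · exact hcov B hBS ⟨⟨h₁, h₂⟩, hBy⟩
    | true =>
      -- Dually, take the first opening event at `p` whose side contains `y`. A hiding box that does
      -- not cross the line would have opened at `p` earlier.
      obtain ⟨g, hgF, hmin⟩ := Finset.exists_min_image
        (G.toFinset.filter fun g => g.2 = true ∧ p = (eventOf g).pos ∧ g.1.b ≤ y ∧ y ≤ g.1.e)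
        (fun g => E.idxOf g) ⟨g₀, by simp [hg₀, ho, hpg₀, hyg₀.1, hyg₀.2]⟩
      simp only [Finset.mem_filter, List.mem_toFinset] at hgF hmin
      obtain ⟨hg, hgo, hpg, hyg⟩ := hgF
      refine ⟨g, hg, hpg, hyg, fun B hB hBy => ?_⟩
      obtain ⟨hBS, hB₁, hB₂⟩ := Finset.mem_filter.1 hB
      have hBE : ∀ o, (B, o) ∈ E := fun o => (htl.mem_iff _).2 hBS
      have h₁ : B.p₁ ≤ p := hpg ▸ htl.pos_le (hBE true) (hGE g hg) hB₁
      have h₂ : p < B.p₂ := by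
        rcases htl.of_idxOf_lt (hGE g hg) (hBE false) hB₂ with h | ⟨-, h⟩
        · rw [hpg]; exact h
        · simp [hgo] at h
      rcases h₁.eq_or_lt with h₁ | h₁
      · have hBG : (B, true) ∈ G := by
          rcases hEG _ (hBE true) with h | h | h
          · simp only [Prod.mk.injEq, and_true] at h
            rw [← h, h₁] at hl
            exact absurd hl (lt_irrefl _)
          · simp at h
          · exact h
        exact absurd hB₁ (not_lt.2 (hmin (B, true) ⟨hBG, rfl, h₁.symm, hBy.1.le, hBy.2.le⟩))
      · exact hcov B hBS ⟨⟨h₁, h₂⟩, hBy⟩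

end Sweep

/-! ### Charging argument and cost of a sweep -/

namespace Sweep

variable {K : Type} [LinearOrder K]

/-- No box extends another one in both transversal directions while being extended by it in both
directions of the sweep. -/
def NonCrossing (rs : List (Box K)) : Prop :=
  ∀ X ∈ rs, ∀ B ∈ rs, X ≠ B → ¬(X.b ≤ B.b ∧ B.e ≤ X.e ∧ B.p₁ ≤ X.p₁ ∧ X.p₂ ≤ B.p₂)

open Classical in
/-- The active boxes that are in relation `P` to the box of the event but to no active box. -/
noncomputable def charged (P : Box K → Box K → Prop) (S : Finset (Box K))
    (E : List (Box K × Bool)) (g : Box K × Bool) : Finset (Box K) :=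
  (activeAt S E g).filter fun B => P g.1 B ∧ ∀ B' ∈ activeAt S E g, ¬P B' B

namespace IsTimeline

variable {S : Finset (Box K)} {E : List (Box K × Bool)}

theorem not_mem_activeAt_self {K : Type} {S : Finset (Box K)} {E : List (Box K × Bool)} (X : Box K) (o : Bool) : X ∉ activeAt S E (X, o) := by
  cases o <;> simp [activeAt]

/-- `B` opened before `X` but does not extend `X` in the sweep direction, so it ends strictly
earlier. As `B` is still open at the later opening of `X'`, so is `X`. -/
theorem mem_activeAt_of_open (h : IsTimeline S E) {X X' B : Box K} (hX : X ∈ S) (hX' : X' ∈ S)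
    (hcr : ¬(B.p₁ ≤ X.p₁ ∧ X.p₂ ≤ B.p₂)) (hB : B ∈ activeAt S E (X, true))
    (hB' : B ∈ activeAt S E (X', true)) (hlt : E.idxOf (X, true) < E.idxOf (X', true)) :
    X ∈ activeAt S E (X', true) := by
  obtain ⟨hBS, h₁, -⟩ := Finset.mem_filter.1 hB
  obtain ⟨-, -, h₂⟩ := Finset.mem_filter.1 hB'
  have hm : ∀ B ∈ S, ∀ o, (B, o) ∈ E := fun B hB o => (h.mem_iff _).2 hB
  have e₁ : B.p₁ ≤ X.p₁ := h.pos_le (hm B hBS true) (hm X hX true) h₁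
  have e₂ : X'.p₁ ≤ B.p₂ := h.pos_le (hm X' hX' true) (hm B hBS false) h₂
  have e₃ : B.p₂ < X.p₂ := not_le.1 fun h' => hcr ⟨e₁, h'⟩
  exact Finset.mem_filter.2 ⟨hX, hlt,
    h.idxOf_lt (hm X' hX' true) (hm X hX false) (e₂.trans_lt e₃)⟩

/-- The time reversal of `mem_activeAt_of_open`: `B` closes after `X'` and does not extend it, so
`X'` began before `B` and was already open when `X` closed. -/
theorem mem_activeAt_of_close (h : IsTimeline S E) {X X' B : Box K} (hX : X ∈ S) (hX' : X' ∈ S)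
    (hcr : ¬(B.p₁ ≤ X'.p₁ ∧ X'.p₂ ≤ B.p₂)) (hB : B ∈ activeAt S E (X, false))
    (hB' : B ∈ activeAt S E (X', false)) (hlt : E.idxOf (X, false) < E.idxOf (X', false)) :
    X' ∈ activeAt S E (X, false) := by
  obtain ⟨hBS, h₁, -⟩ := Finset.mem_filter.1 hB
  obtain ⟨-, -, h₂⟩ := Finset.mem_filter.1 hB'
  have hm : ∀ B ∈ S, ∀ o, (B, o) ∈ E := fun B hB o => (h.mem_iff _).2 hB
  have e₁ : B.p₁ ≤ X.p₂ := h.pos_le (hm B hBS true) (hm X hX false) h₁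
  have e₂ : X'.p₂ ≤ B.p₂ := h.pos_le (hm X' hX' false) (hm B hBS false) h₂
  have e₃ : X'.p₁ < B.p₁ := not_le.1 fun h' => hcr ⟨h', e₂⟩
  exact Finset.mem_filter.2 ⟨hX',
    h.idxOf_lt (hm X' hX' true) (hm X hX false) (e₃.trans_le e₁), hlt⟩

/-- Every box is charged by at most one opening event and at most one closing event. -/
theorem sum_card_charged_le (h : IsTimeline S E) {P : Box K → Box K → Prop} {R : Finset (Box K)}
    (hR : R ⊆ S) (o : Bool)
    (hcr : ∀ X ∈ R, ∀ B ∈ S, X ≠ B → P X B → ¬(B.p₁ ≤ X.p₁ ∧ X.p₂ ≤ B.p₂)) :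
    ∑ X ∈ R, (charged P S E (X, o)).card ≤ S.card := by
  classical
  rw [← Finset.card_biUnion]
  · apply Finset.card_le_card
    intro B hB
    obtain ⟨X, -, hB⟩ := Finset.mem_biUnion.1 hB
    exact (Finset.mem_filter.1 (Finset.mem_filter.1 hB).1).1
  · have key : ∀ X ∈ R, ∀ X' ∈ R, E.idxOf (X, o) < E.idxOf (X', o) → ∀ B,
        B ∈ charged P S E (X, o) → B ∈ charged P S E (X', o) → False := by
      intro X hX X' hX' hlt B hB hB'
      obtain ⟨h₁, h₂, h₃⟩ := Finset.mem_filter.1 hB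
      obtain ⟨h₄, h₅, h₆⟩ := Finset.mem_filter.1 hB'
      have hBS := (Finset.mem_filter.1 h₁).1
      have hne : X ≠ B := fun h => not_mem_activeAt_self (S := S) (E := E) X o (by rwa [← h] at h₁)
      have hne' : X' ≠ B := fun h =>
        not_mem_activeAt_self (S := S) (E := E) X' o (by rwa [← h] at h₄)
      cases o with
      | true =>
        -- The earlier box `X` is active at the opening of `X'` and still in relation `P` to `B`,
        -- which forbids charging `B` there. For closing events the later box plays this role at the
        -- earlier event.
        exact h₆ X (h.mem_activeAt_of_open (hR hX) (hR hX') (hcr X hX B hBS hne h₂) h₁ h₄ hlt) h₂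
      | false =>
        exact h₃ X' (h.mem_activeAt_of_close (hR hX) (hR hX') (hcr X' hX' B hBS hne' h₅) h₁ h₄
          hlt) h₅
    intro X hX X' hX' hne
    rw [Function.onFun, Finset.disjoint_left]
    intro B hB hB'
    rcases lt_trichotomy (E.idxOf (X, o)) (E.idxOf (X', o)) with h' | h' | h'
    · exact key X hX X' hX' h' B hB hB'
    · have := (List.idxOf_inj ((h.mem_iff (X, o)).2 (hR hX))).1 h'
      exact hne (Prod.mk.inj this).1
    · exact key X' hX' X hX h' B hB' hB

end IsTimeline

theorem card_image_le_one {α β : Type} [DecidableEq β] {s : Finset α} {f : α → β}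
    (h : ∀ x ∈ s, ∀ y ∈ s, f x = f y) : (s.image f).card ≤ 1 := by
  rw [Finset.card_le_one]
  simpa only [Finset.mem_image, forall_exists_index, and_imp, forall_apply_eq_imp_iff₂] using h

/-- The strict nesting of transversal extents at the upper end. -/
def NestedEnd (X B : Box K) : Prop := X.b ≤ B.b ∧ B.e < X.e

/-- The strict nesting of transversal extents at the lower end. -/
def NestedStart (X B : Box K) : Prop := X.b < B.b ∧ B.e ≤ X.e

-- The break keys are sorted by their origin. Four belong to `X` itself. Boxes starting below `X`
-- and ending on its side contribute at most one uncovered upper end, because the one reaching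
-- farther hides the end of the other; symmetrically from above. All remaining boxes are nested in
-- `X`. If another active box had one of these nested strictly at the same end, it would hide that
-- end, so each such box is charged.
open Classical in
theorem retrieve_cost_le {T : SegTree K} {C : List K} {lo hi : K}
    (hT : SegTree.IsTreeOver T C lo hi) {S : Finset (Box K)} {E : List (Box K × Bool)}
    (hfit : ∀ B ∈ S, SegTree.Fits C lo hi B) (hbe : ∀ B ∈ S, B.b < B.e) (g : Box K × Bool) :
    (retrieve T (activeAt S E g) g).cost ≤ 19 * (1 + 2 * (T.height *
      (6 + (charged NestedEnd S E g).card + (charged NestedStart S E g).card))) := by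
  obtain ⟨A, hA⟩ : ∃ A, A = activeAt S E g := ⟨_, rfl⟩
  have hAS : ∀ B ∈ A, B ∈ S := fun B hB => by
    rw [hA] at hB
    exact (Finset.mem_filter.1 hB).1
  obtain ⟨X, o⟩ := g
  obtain ⟨R, hR⟩ : ∃ R : Finset (Key K), R = (A.filter fun B => B.b < X.b ∧ X.b ≤ B.e ∧
    ∀ B' ∈ A, ¬(B'.b < B.e ∧ B.e < B'.e)).image fun B => ⟨B.e, false⟩ := ⟨_, rfl⟩
  obtain ⟨L, hL⟩ : ∃ L : Finset (Key K), L = (A.filter fun B => X.e < B.e ∧ B.b ≤ X.e ∧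
    ∀ B' ∈ A, ¬(B'.b < B.b ∧ B.b < B'.e)).image fun B => ⟨B.b, true⟩ := ⟨_, rfl⟩
  have hRc : R.card ≤ 1 := by
    rw [hR]
    refine card_image_le_one fun B hB B' hB' => ?_
    obtain ⟨h₁, h₂, h₃, h₄⟩ := Finset.mem_filter.1 hB
    obtain ⟨h₅, h₆, h₇, h₈⟩ := Finset.mem_filter.1 hB'
    rcases lt_trichotomy B.e B'.e with h | h | h
    · exact absurd ⟨h₆.trans_le h₃, h⟩ (h₄ B' h₅)
    · rw [h]
    · exact absurd ⟨h₂.trans_le h₇, h⟩ (h₈ B h₁)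
  have hLc : L.card ≤ 1 := by
    rw [hL]
    refine card_image_le_one fun B hB B' hB' => ?_
    obtain ⟨h₁, h₂, h₃, h₄⟩ := Finset.mem_filter.1 hB
    obtain ⟨h₅, h₆, h₇, h₈⟩ := Finset.mem_filter.1 hB'
    rcases lt_trichotomy B.b B'.b with h | h | h
    · exact absurd ⟨h, h₇.trans_lt h₂⟩ (h₈ B h₁)
    · rw [h]
    · exact absurd ⟨h, h₃.trans_lt h₆⟩ (h₄ B' h₅)
  obtain ⟨N, hN⟩ : ∃ N : Finset (Key K), N =
    (charged NestedEnd S E (X, o)).image fun B => ⟨B.e, false⟩ := ⟨_, rfl⟩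
  obtain ⟨N', hN'⟩ : ∃ N : Finset (Key K), N =
    (charged NestedStart S E (X, o)).image fun B => ⟨B.b, true⟩ := ⟨_, rfl⟩
  have hNc : N.card ≤ (charged NestedEnd S E (X, o)).card := hN ▸ Finset.card_image_le
  have hNc' : N'.card ≤ (charged NestedStart S E (X, o)).card := hN' ▸ Finset.card_image_le
  obtain ⟨D₀, hD₀⟩ : ∃ D₀ : Finset (Key K), D₀ =
    {⟨X.b, false⟩, ⟨X.e, true⟩, ⟨X.e, false⟩, ⟨X.b, true⟩} := ⟨_, rfl⟩
  have hD₀c : D₀.card ≤ 4 := hD₀ ▸ Finset.card_le_four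
  have hD : (D₀ ∪ R ∪ L ∪ N ∪ N').card ≤ 6 + (charged NestedEnd S E (X, o)).card +
      (charged NestedStart S E (X, o)).card := by
    have u₁ := Finset.card_union_le (D₀ ∪ R ∪ L ∪ N) N'
    have u₂ := Finset.card_union_le (D₀ ∪ R ∪ L) N
    have u₃ := Finset.card_union_le (D₀ ∪ R) L
    have u₄ := Finset.card_union_le D₀ R
    omega
  rw [← hA]
  refine (hT.query_cost_le X (S := A) (fun B hB => hfit B (hAS B hB)) (D := D₀ ∪ R ∪ L ∪ N ∪ N')
    (by simp [hD₀]) (by simp [hD₀]) ?_ ?_).trans ?_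
  · intro B hB h₁ h₂ h₃
    simp only [Finset.mem_union]
    rcases lt_or_ge B.b X.b with h | h
    · exact Or.inl (Or.inl (Or.inl (Or.inr
        (hR ▸ Finset.mem_image_of_mem _ (Finset.mem_filter.2 ⟨hB, h, h₁, h₃⟩)))))
    · rcases h₂.eq_or_lt with h' | h'
      · exact Or.inl (Or.inl (Or.inl (Or.inl (by simp [hD₀, h']))))
      · refine Or.inl (Or.inr (hN ▸ Finset.mem_image_of_mem _ (Finset.mem_filter.2 ⟨hA ▸ hB,
          ⟨h, h'⟩, fun B' hB' hc => h₃ B' (hA ▸ hB') ⟨hc.1.trans_lt (hbe B (hAS B hB)), hc.2⟩⟩)))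
  · intro B hB h₁ h₂ h₃
    simp only [Finset.mem_union]
    rcases lt_or_ge X.e B.e with h | h
    · exact Or.inl (Or.inl (Or.inr
        (hL ▸ Finset.mem_image_of_mem _ (Finset.mem_filter.2 ⟨hB, h, h₂, h₃⟩))))
    · rcases h₁.eq_or_lt with h' | h'
      · exact Or.inl (Or.inl (Or.inl (Or.inl (by simp [hD₀, h']))))
      · refine Or.inr (hN' ▸ Finset.mem_image_of_mem _ (Finset.mem_filter.2 ⟨hA ▸ hB,
          ⟨h', h⟩, fun B' hB' hc => h₃ B' (hA ▸ hB') ⟨hc.1, (hbe B (hAS B hB)).trans_le hc.2⟩⟩))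
  · gcongr

theorem sum_map_events {K : Type} (f : Box K × Bool → ℕ) (rs : List (Box K)) :
    ((rs.flatMap fun B => [(B, true), (B, false)]).map f).sum =
      (rs.map fun B => f (B, true)).sum + (rs.map fun B => f (B, false)).sum := by
  induction rs with
  | nil => rfl
  | cons r rs ih =>
    simp only [List.flatMap_cons, List.cons_append, List.nil_append, List.map_cons, List.sum_cons,
      ih]
    omega

theorem card_allBoxes_le {K : Type} (left right : Box K) (rs : List (Box K)) :
    (allBoxes left right rs).card ≤ rs.length + 2 := by
  have h₁ := Finset.card_insert_le left (insert right rs.toFinset)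
  have h₂ := Finset.card_insert_le right rs.toFinset
  have h₃ := List.toFinset_card_le rs
  rw [allBoxes]
  omega

/-- Each of the two processed events of the outsides charges every box at most once, trivially. The
opening and the closing events of the modules contribute two more multiples of the number of boxes.
-/
theorem IsSchedule.sum_card_charged_le {p₁ p₂ b e : K} {rs : List (Box K)} {left right : Box K}
    {G : List (Box K × Bool)} (h : IsSchedule p₁ p₂ b e rs left right G) (hnd : rs.Nodup)
    {P : Box K → Box K → Prop}
    (hcr : ∀ X ∈ rs, ∀ B ∈ allBoxes left right rs, X ≠ B → P X B →
      ¬(B.p₁ ≤ X.p₁ ∧ X.p₂ ≤ B.p₂)) :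
    (G.map fun g => (charged P (allBoxes left right rs)
      ((left, true) :: (G ++ [(right, false)])) g).card).sum ≤ 4 * (rs.length + 2) := by
  classical
  have htl := h.timeline
  change IsTimeline (allBoxes left right rs) _ at htl
  have hsub : rs.toFinset ⊆ allBoxes left right rs := fun B hB => by
    simp only [allBoxes, Finset.mem_insert]
    exact Or.inr (Or.inr hB)
  have hcard := card_allBoxes_le left right rs
  generalize (left, true) :: (G ++ [(right, false)]) = E at htl ⊢
  have hle : ∀ g, (charged P (allBoxes left right rs) E g).card ≤ rs.length + 2 := fun g =>
    (Finset.card_le_card ((Finset.filter_subset _ _).trans (Finset.filter_subset _ _))).trans hcard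
  have hs := fun o => (htl.sum_card_charged_le hsub o (P := P)
    (fun X hX => hcr X (List.mem_toFinset.1 hX))).trans hcard
  simp only [List.sum_toFinset _ hnd] at hs
  rw [(h.perm.map _).sum_eq, List.map_cons, List.map_cons, List.sum_cons, List.sum_cons,
    sum_map_events]
  have e₁ := hle (left, false)
  have e₂ := hle (right, true)
  have e₃ := hs true
  have e₄ := hs false
  omega

theorem run_cost_le [NoMinOrder K] [NoMaxOrder K] {p₁ p₂ lo hi b e : K} {rs : List (Box K)}
    (hb : b < lo) (he : hi < e) (hbe' : b < e) (hnd : rs.Nodup)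
    (hlt : ∀ r ∈ rs, r.p₁ < r.p₂ ∧ r.b < r.e) (hin : ∀ r ∈ rs, b ≤ r.b ∧ r.e ≤ e)
    (hcr : NonCrossing rs) :
    (run p₁ p₂ lo hi b e rs).cost ≤
      3000 * ((rs.length + 1) * (Nat.clog 2 (4 * rs.length + 4) + 1)) := by
  obtain ⟨left, right, G, T, C, hS, hT, hh, hfit, -, hcost⟩ :=
    run_spec (p₁ := p₁) (p₂ := p₂) hb he hnd (fun r hr => (hlt r hr).1)
  have hmem : ∀ B ∈ allBoxes left right rs, (B.b = b ∧ B.e = e) ∨ B ∈ rs := by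
    intro B hB
    simp only [allBoxes, Finset.mem_insert, List.mem_toFinset] at hB
    rcases hB with rfl | rfl | hB
    · exact Or.inl hS.left_eq.2
    · exact Or.inl hS.right_eq.2
    · exact Or.inr hB
  have hbe : ∀ B ∈ allBoxes left right rs, B.b < B.e := by
    intro B hB
    rcases hmem B hB with h | h
    · rw [h.1, h.2]; exact hbe'
    · exact (hlt B h).2
  have c₁ := hS.sum_card_charged_le hnd (P := NestedEnd) (by
    intro X hX B hB hne hP
    rcases hmem B hB with h | h
    -- The outsides have the full extent from `b` to `e`, so strict nesting inside a module box is
    -- impossible. Only pairs of module boxes need the non-crossing hypothesis.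
    · exact absurd (hP.2.trans_le (hin X hX).2) (by rw [h.2]; exact lt_irrefl _)
    · exact fun h' => hcr X hX B h hne ⟨hP.1, hP.2.le, h'⟩)
  have c₂ := hS.sum_card_charged_le hnd (P := NestedStart) (by
    intro X hX B hB hne hP
    rcases hmem B hB with h | h
    · exact absurd ((hin X hX).1.trans_lt hP.1) (by rw [h.1]; exact lt_irrefl _)
    · exact fun h' => hcr X hX B h hne ⟨hP.1.le, hP.2, h'⟩)
  have hlen : G.length = 2 * rs.length + 2 := by
    rw [hS.perm.length_eq]
    simp [List.length_flatMap]
    omega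
  simp only [retrieveAt] at hcost
  have hr := fun g => retrieve_cost_le (E := (left, true) :: (G ++ [(right, false)])) hT hfit hbe g
  generalize (left, true) :: (G ++ [(right, false)]) = E at c₁ c₂ hcost hr
  generalize allBoxes left right rs = S at c₁ c₂ hcost hr
  -- The constants come from doubling the retrieval bound: `55 = 2 * 19 + 17`, `516 = 2 * 19 * 2 * 6
  -- + 60` and `76 = 2 * 19 * 2`.
  have hsum : ∀ G' : List (Box K × Bool),
      (G'.map fun g => 2 * (retrieve T (activeAt S E g) g).cost + 17 + 60 * T.height).sum ≤
      G'.length * (55 + 516 * T.height) + 76 * (T.height *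
        ((G'.map fun g => (charged NestedEnd S E g).card).sum +
          (G'.map fun g => (charged NestedStart S E g).card).sum)) := by
    intro G'
    induction G' with
    | nil => simp
    | cons g G' ih =>
      have := hr g
      simp only [List.map_cons, List.sum_cons, List.length_cons]
      nlinarith
  have h₁ := hsum G
  rw [hlen] at h₁
  have h₂ : T.height * ((G.map fun g => (charged NestedEnd S E g).card).sum +
      (G.map fun g => (charged NestedStart S E g).card).sum) ≤
      Nat.clog 2 (4 * rs.length + 4) * (8 * (rs.length + 2)) := Nat.mul_le_mul hh (by omega)
  have h₃ : (2 * rs.length + 2) * (55 + 516 * T.height) ≤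
      (2 * rs.length + 2) * (55 + 516 * Nat.clog 2 (4 * rs.length + 4)) :=
    Nat.mul_le_mul_left _ (by omega)
  generalize Nat.clog 2 (4 * rs.length + 4) = c at *
  nlinarith [Nat.zero_le (rs.length * c)]

end Sweep

/-! ### The free space as a set of uncovered points, and its boundary -/

/-- The box with the roles of the two directions exchanged. -/
def Box.swap {K : Type} (r : Box K) : Box K := ⟨r.b, r.e, r.p₁, r.p₂⟩

theorem Box.swap_injective {K : Type} : Function.Injective (Box.swap (K := K)) := by
  rintro ⟨a, b, c, d⟩ ⟨a', b', c', d'⟩ h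
  simp only [Box.swap, Box.mk.injEq] at h ⊢
  tauto

/-- The module expanded by `a` to the left and right and by `c` to the bottom and top. -/
def Rect.expand {K : Type} [Field K] (a c : K) (m : Rect K) : Box K :=
  ⟨m.x - a, m.x + m.w + a, m.y - c, m.y + m.h + c⟩

theorem Rect.expand_injective {K : Type} [Field K] (a c : K) :
    Function.Injective (Rect.expand a c) := by
  rintro ⟨x, y, w, h⟩ ⟨x', y', w', h'⟩ he
  simp only [Rect.expand, Box.mk.injEq, sub_left_inj, add_left_inj, Rect.mk.injEq] at he ⊢
  obtain ⟨rfl, h₂, rfl, h₄⟩ := he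
  exact ⟨rfl, rfl, add_left_cancel h₂, add_left_cancel h₄⟩

theorem expandAll_spec {K : Type} [Field K] (a c : K) (M : List (Rect K)) :
    (expandAll a c M).val = M.map (Rect.expand a c) ∧
      (expandAll a c M).cost = 7 * M.length + 1 := by
  induction M with
  | nil => simp [expandAll]
  | cons m M ih =>
    simp only [expandAll, bind_val, bind_cost, pure_val, pure_cost, ih, List.map_cons, tick_cost,
      sub_val, sub_cost, add_val, add_cost, List.length_cons]
    exact ⟨rfl, by omega⟩

theorem swapAll_spec {K : Type} (rs : List (Box K)) :
    (swapAll rs).val = rs.map Box.swap ∧ (swapAll rs).cost = rs.length + 1 := by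
  induction rs with
  | nil => simp [swapAll]
  | cons r rs ih =>
    simp only [swapAll, bind_val, bind_cost, pure_val, pure_cost, ih, List.map_cons, tick_cost,
      List.length_cons]
    exact ⟨rfl, by omega⟩

/-- The points in a rectangle which are not in the interior of any box. -/
def uncovered (xl xh yl yh : ℝ) (rs : List (Box ℝ)) : Set (ℝ × ℝ) :=
  {q | (xl ≤ q.1 ∧ q.1 ≤ xh) ∧ (yl ≤ q.2 ∧ q.2 ≤ yh) ∧
    ∀ r ∈ rs, ¬((r.p₁ < q.1 ∧ q.1 < r.p₂) ∧ (r.b < q.2 ∧ q.2 < r.e))}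

/-- The points on the lines `p = xl` and `p = xh` and on the sides of the boxes which are orthogonal
to the first direction. -/
def onSide (xl xh : ℝ) (rs : List (Box ℝ)) : Set (ℝ × ℝ) :=
  {q | q.1 = xl ∨ q.1 = xh ∨ ∃ r ∈ rs, (q.1 = r.p₁ ∨ q.1 = r.p₂) ∧ r.b ≤ q.2 ∧ q.2 ≤ r.e}

theorem swap_mem_uncovered {xl xh yl yh : ℝ} {rs : List (Box ℝ)} {q : ℝ × ℝ} :
    q.swap ∈ uncovered yl yh xl xh (rs.map Box.swap) ↔ q ∈ uncovered xl xh yl yh rs := by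
  simp only [uncovered, Set.mem_ofPred_eq, List.mem_map, forall_exists_index, and_imp,
    forall_apply_eq_imp_iff₂, Box.swap, Prod.fst_swap, Prod.snd_swap]
  constructor
  · rintro ⟨h₁, h₂, h₃⟩
    exact ⟨h₂, h₁, fun r hr h => h₃ r hr ⟨h.2, h.1⟩⟩
  · rintro ⟨h₁, h₂, h₃⟩
    exact ⟨h₂, h₁, fun r hr h => h₃ r hr ⟨h.2, h.1⟩⟩

theorem isClosed_uncovered (xl xh yl yh : ℝ) (rs : List (Box ℝ)) :
    IsClosed (uncovered xl xh yl yh rs) := by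
  have : uncovered xl xh yl yh rs = (Set.Icc xl xh ×ˢ Set.Icc yl yh) ∩
      ⋂ r ∈ rs, (Set.Ioo r.p₁ r.p₂ ×ˢ Set.Ioo r.b r.e)ᶜ := by
    ext q
    simp only [uncovered, Set.mem_ofPred_eq, Set.mem_inter_iff, Set.mem_prod, Set.mem_Icc,
      Set.mem_iInter, Set.mem_compl_iff, Set.mem_Ioo, and_assoc]
  rw [this]
  exact (isClosed_Icc.prod isClosed_Icc).inter
    (isClosed_biInter fun r _ => (isOpen_Ioo.prod isOpen_Ioo).isClosed_compl)

theorem isClosed_onSide (xl xh : ℝ) (rs : List (Box ℝ)) : IsClosed (onSide xl xh rs) := by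
  have : onSide xl xh rs = {q : ℝ × ℝ | q.1 = xl} ∪ ({q : ℝ × ℝ | q.1 = xh} ∪
      ⋃ r ∈ {r | r ∈ rs}, ({r.p₁, r.p₂} : Set ℝ) ×ˢ Set.Icc r.b r.e) := by
    ext q
    simp only [onSide, Set.mem_ofPred_eq, Set.mem_union, Set.mem_iUnion, Set.mem_prod,
      Set.mem_insert_iff, Set.mem_singleton_iff, Set.mem_Icc, exists_prop]
  rw [this]
  refine (isClosed_eq continuous_fst continuous_const).union
    ((isClosed_eq continuous_fst continuous_const).union
      (rs.finite_toSet.isClosed_biUnion fun r _ => ?_))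
  exact (Set.toFinite _).isClosed.prod isClosed_Icc

theorem closure_compl_of_subset {U S : Set (ℝ × ℝ)} {q : ℝ × ℝ} (hU : U ⊆ Sᶜ)
    (hq : q ∈ closure U) : q ∉ interior S := by
  rw [← Set.mem_compl_iff, ← closure_compl]
  exact closure_mono hU hq

/-- Each such line or side lies in the closure of a forbidden set: a half plane beyond the chip or
the interior of a box. Nondegeneracy of the boxes is needed for the closure of the interior to reach
the sides. -/
theorem not_mem_interior_of_onSide {xl xh yl yh : ℝ} {rs : List (Box ℝ)}
    (hrs : ∀ r ∈ rs, r.p₁ < r.p₂ ∧ r.b < r.e) {q : ℝ × ℝ} (hq : q ∈ onSide xl xh rs) :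
    q ∉ interior (uncovered xl xh yl yh rs) := by
  rcases hq with h | h | ⟨r, hr, h, h'⟩
  · refine closure_compl_of_subset (U := Set.Iio xl ×ˢ Set.univ) ?_ ?_
    · rintro x hx hx'
      exact absurd hx'.1.1 (not_le.2 hx.1)
    · rw [closure_prod_eq, closure_Iio, closure_univ]
      exact ⟨h.le, trivial⟩
  · refine closure_compl_of_subset (U := Set.Ioi xh ×ˢ Set.univ) ?_ ?_
    · rintro x hx hx'
      exact absurd hx'.1.2 (not_le.2 hx.1)
    · rw [closure_prod_eq, closure_Ioi, closure_univ]
      exact ⟨h.ge, trivial⟩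
  · refine closure_compl_of_subset (U := Set.Ioo r.p₁ r.p₂ ×ˢ Set.Ioo r.b r.e) ?_ ?_
    · rintro x hx hx'
      exact hx'.2.2 r hr hx
    · rw [closure_prod_eq, closure_Ioo (hrs r hr).1.ne, closure_Ioo (hrs r hr).2.ne]
      refine ⟨?_, h'⟩
      rcases h with h | h
      · rw [h]; exact Set.left_mem_Icc.2 (hrs r hr).1.le
      · rw [h]; exact Set.right_mem_Icc.2 (hrs r hr).1.le

theorem frontier_uncovered {xl xh yl yh : ℝ} {rs : List (Box ℝ)}
    (hrs : ∀ r ∈ rs, r.p₁ < r.p₂ ∧ r.b < r.e) (q : ℝ × ℝ) :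
    q ∈ frontier (uncovered xl xh yl yh rs) ↔ q ∈ uncovered xl xh yl yh rs ∧
      (q ∈ onSide xl xh rs ∨ q.swap ∈ onSide yl yh (rs.map Box.swap)) := by
  rw [(isClosed_uncovered xl xh yl yh rs).frontier_eq, Set.mem_sdiff]
  refine and_congr_right fun hq => ?_
  constructor
  · intro hint
    by_contra hside
    push Not at hside
    obtain ⟨hs, hs'⟩ := hside
    simp only [onSide, Set.mem_ofPred_eq, not_or, not_exists, not_and, List.mem_map,
      forall_exists_index, and_imp, forall_apply_eq_imp_iff₂, Box.swap, Prod.fst_swap,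
      Prod.snd_swap, not_le] at hs hs'
    obtain ⟨a₁, a₂, a₃⟩ := hs
    obtain ⟨b₁, b₂, b₃⟩ := hs'
    -- The neighborhood is the open rectangle minus the closed boxes. A point of a closed box that
    -- is on none of its sides would be in its interior, which is excluded.
    refine hint (mem_interior.2 ⟨(Set.Ioo xl xh ×ˢ Set.Ioo yl yh) ∩
      ⋂ r ∈ {r | r ∈ rs}, (Set.Icc r.p₁ r.p₂ ×ˢ Set.Icc r.b r.e)ᶜ, ?_, ?_, ?_⟩)
    · rintro x ⟨hx, hx'⟩
      refine ⟨⟨hx.1.1.le, hx.1.2.le⟩, ⟨hx.2.1.le, hx.2.2.le⟩, fun r hr h => ?_⟩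
      exact Set.mem_iInter₂.1 hx' r hr ⟨⟨h.1.1.le, h.1.2.le⟩, ⟨h.2.1.le, h.2.2.le⟩⟩
    · exact (isOpen_Ioo.prod isOpen_Ioo).inter (rs.finite_toSet.isOpen_biInter fun r _ =>
        (isClosed_Icc.prod isClosed_Icc).isOpen_compl)
    · refine ⟨⟨⟨lt_of_le_of_ne hq.1.1 (Ne.symm a₁), lt_of_le_of_ne hq.1.2 a₂⟩,
        ⟨lt_of_le_of_ne hq.2.1.1 (Ne.symm b₁), lt_of_le_of_ne hq.2.1.2 b₂⟩⟩, ?_⟩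
      refine Set.mem_iInter₂.2 fun r hr h => hq.2.2 r hr ?_
      obtain ⟨⟨h₁, h₂⟩, h₃, h₄⟩ := h
      refine ⟨⟨lt_of_le_of_ne h₁ fun he => ?_, lt_of_le_of_ne h₂ fun he => ?_⟩,
        ⟨lt_of_le_of_ne h₃ fun he => ?_, lt_of_le_of_ne h₄ fun he => ?_⟩⟩
      · exact absurd h₄ (not_le.2 (a₃ r hr (Or.inl he.symm) h₃))
      · exact absurd h₄ (not_le.2 (a₃ r hr (Or.inr he) h₃))
      · exact absurd h₂ (not_le.2 (b₃ r hr (Or.inl he.symm) h₁))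
      · exact absurd h₂ (not_le.2 (b₃ r hr (Or.inr he) h₁))
  · rintro (h | h)
    · exact not_mem_interior_of_onSide hrs h
    · intro hint
      refine not_mem_interior_of_onSide (yl := xl) (yh := xh) (rs := rs.map Box.swap) ?_ h ?_
      · simp only [List.mem_map, forall_exists_index, and_imp, forall_apply_eq_imp_iff₂, Box.swap]
        exact fun r hr => (hrs r hr).symm
      · have : uncovered yl yh xl xh (rs.map Box.swap) =
            (Homeomorph.prodComm ℝ ℝ).symm ⁻¹' uncovered xl xh yl yh rs := by
          ext x
          rw [← Prod.swap_swap x, swap_mem_uncovered]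
          rfl
        rw [this, ← Homeomorph.preimage_interior]
        exact hint

/-- A segment on the boundary orthogonal to the first direction belongs to sides orthogonal to the
first direction. -/
theorem mem_onSide_of_segment {xl xh yl yh : ℝ} {rs : List (Box ℝ)} {p a b : ℝ} (hab : a < b)
    (h : ∀ y ∈ Set.Icc a b, (p, y) ∈ onSide xl xh rs ∨
      (y, p) ∈ onSide yl yh (rs.map Box.swap)) :
    ∀ y ∈ Set.Icc a b, (p, y) ∈ onSide xl xh rs := by
  obtain ⟨F, hF⟩ : ∃ F : Set ℝ, F = {yl, yh} ∪ ⋃ r ∈ {r | r ∈ rs}, {r.b, r.e} := ⟨_, rfl⟩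
  have hfin : F.Finite := by
    rw [hF]
    exact (Set.toFinite _).union (rs.finite_toSet.biUnion fun r _ => Set.toFinite _)
  -- Off the finite set `F` of transversal side coordinates, only the first alternative is possible.
  -- Density and closedness then extend it to the whole segment.
  have hdense : Dense Fᶜ := hfin.countable.dense_compl ℝ
  have hclosed : IsClosed {y : ℝ | (p, y) ∈ onSide xl xh rs} :=
    (isClosed_onSide xl xh rs).preimage (by fun_prop : Continuous fun y : ℝ => (p, y))
  have hsub : Set.Ioo a b ∩ Fᶜ ⊆ {y : ℝ | (p, y) ∈ onSide xl xh rs} := by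
    rintro y ⟨hy, hyF⟩
    refine (h y ⟨hy.1.le, hy.2.le⟩).resolve_right fun hs => hyF ?_
    rw [hF]
    simp only [onSide, Set.mem_ofPred_eq, List.mem_map, exists_exists_and_eq_and, Box.swap] at hs
    simp only [Set.mem_union, Set.mem_insert_iff, Set.mem_singleton_iff, Set.mem_iUnion,
      Set.mem_ofPred_eq, exists_prop]
    rcases hs with hs | hs | ⟨r, hr, hs, -⟩
    · exact Or.inl (Or.inl hs)
    · exact Or.inl (Or.inr hs)
    · exact Or.inr ⟨r, hr, hs⟩
  have h₁ := hclosed.closure_subset_iff.2 hsub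
  have h₂ := hclosed.closure_subset_iff.2 ((hdense.open_subset_closure_inter isOpen_Ioo).trans h₁)
  rw [closure_Ioo hab.ne] at h₂
  exact h₂

/-! ### Placements -/

theorem disjoint_Ioo_iff {u v w w' : ℝ} (hw : 0 < w) (hw' : 0 < w') :
    Disjoint (Set.Ioo u (u + w)) (Set.Ioo v (v + w')) ↔ ¬(u < v + w' ∧ v < u + w) := by
  rw [Set.Ioo_disjoint_Ioo, min_le_iff, le_max_iff, le_max_iff, not_and_or, not_lt, not_lt]
  constructor
  · rintro ((h | h) | (h | h))
    · linarith
    · exact Or.inr h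
    · exact Or.inl h
    · linarith
  · rintro (h | h)
    · exact Or.inr (Or.inl h)
    · exact Or.inl (Or.inr h)

theorem disjoint_inner_iff {r s : Rect ℝ} (hr : 0 < r.w ∧ 0 < r.h) (hs : 0 < s.w ∧ 0 < s.h) :
    Disjoint r.inner s.inner ↔
      ¬((r.x < s.x + s.w ∧ s.x < r.x + r.w) ∧ (r.y < s.y + s.h ∧ s.y < r.y + r.h)) := by
  rw [Rect.inner, Rect.inner, Set.disjoint_prod, disjoint_Ioo_iff hr.1 hs.1,
    disjoint_Ioo_iff hr.2 hs.2, ← not_and_or]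

theorem closed_subset_iff {r : Rect ℝ} (hr : 0 < r.w ∧ 0 < r.h) (W H : ℝ) :
    r.closed ⊆ Rect.closed ⟨0, 0, W, H⟩ ↔
      (0 ≤ r.x ∧ r.x + r.w ≤ W) ∧ (0 ≤ r.y ∧ r.y + r.h ≤ H) := by
  have hne : (Set.Icc r.x (r.x + r.w) ×ˢ Set.Icc r.y (r.y + r.h)).Nonempty :=
    (Set.nonempty_Icc.2 (by linarith)).prod (Set.nonempty_Icc.2 (by linarith))
  simp only [Rect.closed, zero_add]
  rw [Set.prod_subset_prod_iff, Set.Icc_subset_Icc_iff (by linarith),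
    Set.Icc_subset_Icc_iff (by linarith)]
  have := Set.prod_nonempty_iff.1 hne
  simp only [this.1.ne_empty, this.2.ne_empty, or_false]

theorem freeSpace_eq {W H : ℝ} {M : List (Rect ℝ)} {wm hm : ℝ} (hw : 0 < wm) (hh : 0 < hm)
    (hM : IsPlacement W H M) : freeSpace W H M wm hm =
      uncovered (wm / 2) (W - wm / 2) (hm / 2) (H - hm / 2)
        (M.map (Rect.expand (wm / 2) (hm / 2))) := by
  ext q
  simp only [freeSpace, uncovered, Set.mem_ofPred_eq, List.mem_map, forall_exists_index, and_imp,
    forall_apply_eq_imp_iff₂]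
  rw [closed_subset_iff ⟨hw, hh⟩, and_assoc]
  simp only [moduleAt]
  refine and_congr ?_ (and_congr ?_ (forall₂_congr fun m hm' => ?_))
  · constructor <;> rintro ⟨h₁, h₂⟩ <;> constructor <;> linarith
  · constructor <;> rintro ⟨h₁, h₂⟩ <;> constructor <;> linarith
  · rw [disjoint_inner_iff ⟨hw, hh⟩ (hM.pos m hm')]
    simp only [Rect.expand]
    refine not_congr ⟨?_, ?_⟩
    · rintro ⟨⟨h₁, h₂⟩, h₃, h₄⟩
      refine ⟨⟨?_, ?_⟩, ?_, ?_⟩ <;> linarith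
    · rintro ⟨⟨h₁, h₂⟩, h₃, h₄⟩
      refine ⟨⟨?_, ?_⟩, ?_, ?_⟩ <;> linarith

namespace IsPlacement

variable {W H : ℝ} {M : List (Rect ℝ)}

theorem disjoint (hM : IsPlacement W H M) {m m' : Rect ℝ} (hm : m ∈ M) (hm' : m' ∈ M)
    (hne : m ≠ m') : Disjoint m.inner m'.inner :=
  have : Std.Symm fun m m' : Rect ℝ => Disjoint m.inner m'.inner := ⟨fun _ _ h => h.symm⟩
  hM.disj.forall hm hm' hne

theorem nodup (hM : IsPlacement W H M) : M.Nodup := by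
  refine List.Pairwise.imp_of_mem ?_ hM.disj
  rintro m m' hm - hd rfl
  have := hM.pos m hm
  rw [disjoint_inner_iff this this] at hd
  exact hd ⟨⟨by linarith, by linarith⟩, by linarith, by linarith⟩

/-- The common expansion cancels in all four inequalities. The modules themselves would then be
nested one way vertically and the other way horizontally, and as they have positive size their
interiors would meet. -/
theorem not_cross (hM : IsPlacement W H M) (a c : ℝ) {m m' : Rect ℝ} (hm : m ∈ M) (hm' : m' ∈ M)
    (hne : m ≠ m') : ¬((m.expand a c).b ≤ (m'.expand a c).b ∧
      (m'.expand a c).e ≤ (m.expand a c).e ∧ (m'.expand a c).p₁ ≤ (m.expand a c).p₁ ∧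
      (m.expand a c).p₂ ≤ (m'.expand a c).p₂) := by
  have hp := hM.pos m hm
  have hp' := hM.pos m' hm'
  have hd := (disjoint_inner_iff hp hp').1 (hM.disjoint hm hm' hne)
  simp only [Rect.expand]
  rintro ⟨h₁, h₂, h₃, h₄⟩
  exact hd ⟨⟨by linarith, by linarith⟩, by linarith, by linarith⟩

theorem expand_spec (hM : IsPlacement W H M) {a c : ℝ} (ha : 0 < a) (hc : 0 < c) :
    (M.map (Rect.expand a c)).Nodup ∧
    (∀ r ∈ M.map (Rect.expand a c), r.p₁ < r.p₂ ∧ r.b < r.e) ∧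
    (∀ r ∈ M.map (Rect.expand a c), 0 - c ≤ r.b ∧ r.e ≤ H + c) ∧
    (∀ r ∈ M.map (Rect.expand a c), 0 - a ≤ r.p₁ ∧ r.p₂ ≤ W + a) ∧
    Sweep.NonCrossing (M.map (Rect.expand a c)) ∧
    Sweep.NonCrossing ((M.map (Rect.expand a c)).map Box.swap) := by
  refine ⟨hM.nodup.map (Rect.expand_injective a c), ?_, ?_, ?_, ?_, ?_⟩
  · simp only [List.mem_map, forall_exists_index, and_imp, forall_apply_eq_imp_iff₂, Rect.expand]
    intro m hm
    have := hM.pos m hm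
    exact ⟨by linarith, by linarith⟩
  · simp only [List.mem_map, forall_exists_index, and_imp, forall_apply_eq_imp_iff₂, Rect.expand]
    intro m hm
    have := (closed_subset_iff (hM.pos m hm) W H).1 (hM.on_chip m hm)
    exact ⟨by linarith, by linarith⟩
  · simp only [List.mem_map, forall_exists_index, and_imp, forall_apply_eq_imp_iff₂, Rect.expand]
    intro m hm
    have := (closed_subset_iff (hM.pos m hm) W H).1 (hM.on_chip m hm)
    exact ⟨by linarith, by linarith⟩
  · intro X hX B hB hne
    obtain ⟨m, hm, rfl⟩ := List.mem_map.1 hX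
    obtain ⟨m', hm', rfl⟩ := List.mem_map.1 hB
    exact hM.not_cross a c hm hm' fun h => hne (by rw [h])
  · intro X hX B hB hne
    rw [List.map_map] at hX hB
    obtain ⟨m, hm, rfl⟩ := List.mem_map.1 hX
    obtain ⟨m', hm', rfl⟩ := List.mem_map.1 hB
    rintro ⟨h₁, h₂, h₃, h₄⟩
    exact hM.not_cross a c hm' hm (fun h => hne (by rw [h])) ⟨h₃, h₄, h₁, h₂⟩

end IsPlacement

/-! ### The two sweeps together -/

theorem findContourSegments_val (W H : ℝ) (M : List (Rect ℝ)) (wm hm : ℝ) :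
    (findContourSegments W H M wm hm).val =
      ⟨(Sweep.run (wm / 2) (W - wm / 2) (hm / 2) (H - hm / 2) (0 - hm / 2) (H + hm / 2)
          (M.map (Rect.expand (wm / 2) (hm / 2)))).val,
        (Sweep.run (hm / 2) (H - hm / 2) (wm / 2) (W - wm / 2) (0 - wm / 2) (W + wm / 2)
          ((M.map (Rect.expand (wm / 2) (hm / 2))).map Box.swap)).val⟩ := by
  simp only [findContourSegments, bind_val, half_val, sub_val, add_val, pure_val, expandAll_spec,
    swapAll_spec]

theorem findContourSegments_cost (W H : ℝ) (M : List (Rect ℝ)) (wm hm : ℝ) :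
    (findContourSegments W H M wm hm).cost = 8 * M.length + 11 +
      (Sweep.run (wm / 2) (W - wm / 2) (hm / 2) (H - hm / 2) (0 - hm / 2) (H + hm / 2)
          (M.map (Rect.expand (wm / 2) (hm / 2)))).cost +
        (Sweep.run (hm / 2) (H - hm / 2) (wm / 2) (W - wm / 2) (0 - wm / 2) (W + wm / 2)
          ((M.map (Rect.expand (wm / 2) (hm / 2))).map Box.swap)).cost := by
  simp only [findContourSegments, bind_cost, half_val, half_cost, sub_val, sub_cost,
    add_val, add_cost, pure_cost, expandAll_spec, swapAll_spec, tick_cost, List.length_map]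
  omega

theorem isContourOf_findContourSegments {W H : ℝ} {M : List (Rect ℝ)} {wm hm : ℝ} (hw : 0 < wm)
    (hh : 0 < hm) (hM : IsPlacement W H M) :
    (findContourSegments W H M wm hm).val.IsContourOf (freeSpace W H M wm hm) := by
  rw [findContourSegments_val, freeSpace_eq hw hh hM]
  obtain ⟨hnd, hlt, -, -, -, -⟩ := hM.expand_spec (half_pos hw) (half_pos hh)
  generalize M.map (Rect.expand (wm / 2) (hm / 2)) = rs at hnd hlt
  obtain ⟨v₁, v₂⟩ := Sweep.mem_run_iff (p₁ := wm / 2) (p₂ := W - wm / 2) (lo := hm / 2)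
    (hi := H - hm / 2) (b := 0 - hm / 2) (e := H + hm / 2) (by linarith) (by linarith) hnd
    (fun r hr => (hlt r hr).1)
  obtain ⟨h₁, h₂⟩ := Sweep.mem_run_iff (p₁ := hm / 2) (p₂ := H - hm / 2) (lo := wm / 2)
    (hi := W - wm / 2) (b := 0 - wm / 2) (e := W + wm / 2) (rs := rs.map Box.swap) (by linarith)
    (by linarith) (hnd.map Box.swap_injective) (by
      simp only [List.mem_map, forall_exists_index, and_imp, forall_apply_eq_imp_iff₂, Box.swap]
      exact fun r hr => (hlt r hr).2)
  generalize hG : (Contour.mk (Sweep.run (wm / 2) (W - wm / 2) (hm / 2) (H - hm / 2) (0 - hm / 2)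
    (H + hm / 2) rs).val (Sweep.run (hm / 2) (H - hm / 2) (wm / 2) (W - wm / 2) (0 - wm / 2)
    (W + wm / 2) (rs.map Box.swap)).val) = G
  have hv : ∀ q, q ∈ G.verticalPart ↔
      q ∈ uncovered (wm / 2) (W - wm / 2) (hm / 2) (H - hm / 2) rs ∧
        q ∈ onSide (wm / 2) (W - wm / 2) rs := by
    intro q
    have := v₂ q.1 q.2
    rw [← hG]
    simp only [Contour.verticalPart, Set.mem_iUnion, Set.mem_prod, Set.mem_singleton_iff,
      Set.mem_Icc, exists_prop, this, uncovered, onSide, Set.mem_ofPred_eq, and_assoc]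
  have hh' : ∀ q, q ∈ G.horizontalPart ↔
      q ∈ uncovered (wm / 2) (W - wm / 2) (hm / 2) (H - hm / 2) rs ∧
        q.swap ∈ onSide (hm / 2) (H - hm / 2) (rs.map Box.swap) := by
    intro q
    have := h₂ q.2 q.1
    rw [← swap_mem_uncovered, ← hG]
    simp only [Contour.horizontalPart, Set.mem_iUnion, Set.mem_prod, Set.mem_singleton_iff,
      Set.mem_Icc, exists_prop, uncovered, onSide, Set.mem_ofPred_eq, Prod.fst_swap,
      Prod.snd_swap, and_comm (b := q.2 = _), this, and_assoc]
  have hfr := fun q => frontier_uncovered (xl := wm / 2) (xh := W - wm / 2) (yl := hm / 2)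
    (yh := H - hm / 2) hlt q
  refine ⟨?_, ?_, ?_, ?_, ?_⟩
  · rw [← hG]; exact v₁
  · rw [← hG]; exact h₁
  · ext q
    rw [Set.mem_union, hv, hh', hfr, and_or_left]
  · intro p a b hab hsub
    have key : ∀ y ∈ Set.Icc a b, (p, y) ∈ frontier _ := fun y hy => hsub ⟨rfl, hy⟩
    rintro ⟨p', y⟩ ⟨hp, hy⟩
    obtain rfl : p' = p := hp
    refine (hv _).2 ⟨((hfr _).1 (key y hy)).1, ?_⟩
    exact mem_onSide_of_segment hab (fun y hy => ((hfr _).1 (key y hy)).2) y hy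
  · intro p a b hab hsub
    have key : ∀ x ∈ Set.Icc a b, (x, p) ∈ frontier _ := fun x hx => hsub ⟨hx, rfl⟩
    rintro ⟨x, p'⟩ ⟨hx, hp⟩
    obtain rfl : p' = p := hp
    refine (hh' _).2 ⟨((hfr _).1 (key x hx)).1, ?_⟩
    refine mem_onSide_of_segment (xl := hm / 2) (xh := H - hm / 2) (yl := wm / 2)
      (yh := W - wm / 2) hab (fun x hx => ?_) x hx
    have hss : (rs.map Box.swap).map Box.swap = rs := by
      rw [List.map_map]
      exact List.map_id rs
    rw [hss]
    exact ((hfr _).1 (key x hx)).2.symm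

/-- For `n ≥ 2` one has `4 * n + 4 ≤ n ^ 4`, which bounds the rounded-down part by `4 * log n / log
2`. The two extra units cost at most `2 * log n / log 2`, and `6 / log 2 < 9`. -/
theorem clog_le_log {n : ℕ} (hn : 2 ≤ n) :
    (Nat.clog 2 (4 * n + 4) : ℝ) + 1 ≤ 9 * Real.log n := by
  obtain ⟨k, hk⟩ : ∃ k, Nat.clog 2 (4 * n + 4) = k + 1 :=
    ⟨Nat.clog 2 (4 * n + 4) - 1, by
      have := Nat.clog_pos (b := 2) (n := 4 * n + 4) (by omega) (by omega)
      omega⟩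
  have h₁ : 2 ^ k < 4 * n + 4 :=
    (Nat.lt_clog_iff_pow_lt (by omega)).1 (by omega)
  have h₂ : 4 * n + 4 ≤ n ^ 4 := by
    calc 4 * n + 4 ≤ 2 ^ 3 * n := by omega
      _ ≤ n ^ 3 * n := Nat.mul_le_mul_right _ (Nat.pow_le_pow_left hn 3)
      _ = n ^ 4 := by ring
  have h₃ : (2 : ℝ) ^ k ≤ (n : ℝ) ^ 4 := by exact_mod_cast (h₁.le.trans h₂)
  have h₄ := Real.log_le_log (by positivity) h₃
  rw [Real.log_pow, Real.log_pow] at h₄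
  have h₅ : Real.log 2 ≤ Real.log n := Real.log_le_log (by norm_num) (by exact_mod_cast hn)
  have h₆ := Real.log_two_gt_d9
  push_cast at h₄
  rw [hk]
  push_cast
  nlinarith

theorem findContourSegments_cost_le {W H : ℝ} {M : List (Rect ℝ)} {wm hm : ℝ} (hw : 0 < wm)
    (hh : 0 < hm) (hM : IsPlacement W H M) (hn : 2 ≤ M.length) :
    (findContourSegments W H M wm hm).cost ≤
      6020 * ((M.length + 1) * (Nat.clog 2 (4 * M.length + 4) + 1)) := by
  obtain ⟨hnd, hlt, hb, hp, hc, hc'⟩ := hM.expand_spec (half_pos hw) (half_pos hh)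
  -- A module on the chip gives the chip positive width and height, so the outsides have
  -- nondegenerate transversal extents.
  obtain ⟨m, hm'⟩ := List.exists_mem_of_length_pos (by omega : 0 < M.length)
  have hpos := hM.pos m hm'
  have hchip := (closed_subset_iff hpos W H).1 (hM.on_chip m hm')
  rw [findContourSegments_cost]
  have e₁ := Sweep.run_cost_le (p₁ := wm / 2) (p₂ := W - wm / 2) (lo := hm / 2)
    (hi := H - hm / 2) (b := 0 - hm / 2) (e := H + hm / 2) (by linarith) (by linarith)
    (by linarith) hnd hlt hb hc
  have e₂ := Sweep.run_cost_le (p₁ := hm / 2) (p₂ := H - hm / 2) (lo := wm / 2)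
    (hi := W - wm / 2) (b := 0 - wm / 2) (e := W + wm / 2)
    (rs := (M.map (Rect.expand (wm / 2) (hm / 2))).map Box.swap) (by linarith) (by linarith)
    (by linarith) (hnd.map Box.swap_injective)
    (fun r hr => by
      obtain ⟨r', hr', rfl⟩ := List.mem_map.1 hr
      exact (hlt r' hr').symm)
    (fun r hr => by
      obtain ⟨r', hr', rfl⟩ := List.mem_map.1 hr
      exact hp r' hr') hc'
  simp only [List.length_map] at e₁ e₂
  -- Each sweep takes 3000 of the constant; the remaining 20 covers the linear preparation of `8 *
  -- M.length + 11` steps.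
  have e₃ : M.length + 1 ≤ (M.length + 1) * (Nat.clog 2 (4 * M.length + 4) + 1) :=
    Nat.le_mul_of_pos_right _ (Nat.succ_pos _)
  omega

theorem theorem3 :
    (∀ (W H : ℝ) (M : List (Rect ℝ)) (wm hm : ℝ), 0 < wm → 0 < hm → IsPlacement W H M →
      (findContourSegments W H M wm hm).val.IsContourOf (freeSpace W H M wm hm)) ∧
    ∃ C : ℝ, ∀ (W H : ℝ) (M : List (Rect ℝ)) (wm hm : ℝ), 0 < wm → 0 < hm →
      IsPlacement W H M → 2 ≤ M.length →
      ((findContourSegments W H M wm hm).cost : ℝ) ≤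
        C * ((M.length : ℝ) * Real.log (M.length : ℝ)) := by
  -- The constant is `6020 * 2 * 9`: the cost constant, `n + 1 ≤ 2 * n`, and the passage to the
  -- natural logarithm.
  refine ⟨fun W H M wm hm hw hh hM => isContourOf_findContourSegments hw hh hM, 108360, ?_⟩
  intro W H M wm hm hw hh hM hn
  have h₁ : ((findContourSegments W H M wm hm).cost : ℝ) ≤
      6020 * ((M.length + 1) * (Nat.clog 2 (4 * M.length + 4) + 1)) := by
    exact_mod_cast findContourSegments_cost_le hw hh hM hn
  have h₂ := clog_le_log hn
  have hn' : (2 : ℝ) ≤ M.length := by exact_mod_cast hn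
  have h₃ : (M.length + 1 : ℝ) * (Nat.clog 2 (4 * M.length + 4) + 1) ≤
      (2 * M.length) * (9 * Real.log M.length) :=
    mul_le_mul (by linarith) h₂ (by positivity) (by positivity)
  linarith
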